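/- Let $k$ be an algebraically closed field of characteristic zero and let $S$ be a toric log del Pezzo surface over $k$ of Picard number one, that is, a complete normal toric surface with ample anticanonical $\mathbb{Q}$-divisor $-K_S$ (its singularities are then automatically log terminal) and with Picard number one. For positive integers $a,b,c$ let $\mathbb{P}(a,b,c)$ be the weighted projective plane $\operatorname{Proj} k[x_0,x_1,x_2]$ with $\deg x_0=a$, $\deg x_1=b$, $\deg x_2=c$, and let $\operatorname{Sing}(S)$ be the set of singular points of $S$. A toric log del Pezzo surface $S_0$ of Picard number one with minimal resolution $S_0'$ is called basic if $D^2\ge -2$ for every torus-invariant curve $D$ on $S_0'$ that meets a $(-1)$-curve. One says that $S$ admits a cascade to $S_0$ (equivalently, that $S$ is obtained by inverting a cascade from $S_0$) if there are $t\ge 0$, toric log del Pezzo surfaces $S_0,S_1,\dots,S_t\cong S$ of Picard number one with $S_0$ basic, with minimal resolutions $S_i'\to S_i$, and toric blow-downs $S'_t\to S'_{t-1}\to\cdots\to S'_0$ (each the inverse of the blow-up of one torus-fixed point). Let $S(3A_2)$ and, for $n\ge 2$, $S(std^2_n)$ denote the basic surfaces on whose minimal resolutions the torus-invariant curves form a cycle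 with self-intersection numbers, in cyclic order, $$(-2,\,-2,-1,-2,\,-2,\,-1,-2,-2,-1)\qquad\text{and}\qquad(-n,\,-2,-1,-2,\,n-2,\,-2,-1,-2),$$ respectively. Then: 1. If $|\operatorname{Sing}(S)|\le 1$, then $S\cong\mathbb{P}(1,1,n)$ for some integer $n\ge 1$. 2. If $|\operatorname{Sing}(S)|=2$, then $S\cong\mathbb{P}(1,q,(n-1)q+q_1)$ for some integers $n\ge 2$ and $1\le q_1<q$ with $\gcd(q,q_1)=1$. 3. If $|\operatorname{Sing}(S)|=3$, then $S$ admits a cascade to $S(3A_2)$ or to $S(std^2_n)$ for some $n\ge 2$. In particular, if $|\operatorname{Sing}(S)|\le 2$, then $S$ is isomorphic to a weighted projective plane. -/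

import Mathlib

open CategoryTheory CategoryTheory.Limits AlgebraicGeometry

universe u

namespace ToricSurface

/-! ### Lattices, cones and complete fans in the plane -/

/-- The pairing between the character lattice `M = ℤ²` and the lattice `N = ℤ²`. -/
def pairing (m v : ℤ × ℤ) : ℤ := m.1 * v.1 + m.2 * v.2

/-- The determinant of two vectors of `N = ℤ²`. -/
def det (u v : ℤ × ℤ) : ℤ := u.1 * v.2 - u.2 * v.1

/-- A complete (rational, strongly convex, polyhedral) fan in the plane `N ⊗ ℝ`. Such a fan is
determined by the finite set of primitive generators of its rays, and a finite set of primitive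
vectors arises in this way if and only if it is contained in no closed half-plane. -/
structure CompleteFan where
  rays : Finset (ℤ × ℤ)
  primitive : ∀ v ∈ rays, Int.gcd v.1 v.2 = 1
  complete : ∀ m : ℤ × ℤ, m ≠ 0 → ∃ v ∈ rays, pairing m v < 0

namespace CompleteFan

/-- `v` is the ray generator that follows `u` counterclockwise, that is, `u` and `v` span a
two-dimensional cone of the fan. -/
def Adj (F : CompleteFan) (u v : ℤ × ℤ) : Prop :=
  u ∈ F.rays ∧ v ∈ F.rays ∧ 0 < det u v ∧ ∀ w ∈ F.rays, ¬ (0 < det u w ∧ 0 < det w v)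

/-- The cones of the fan, each one encoded by the set of primitive generators of its rays. -/
def IsCone (F : CompleteFan) (c : Finset (ℤ × ℤ)) : Prop :=
  c = ∅ ∨ (∃ v ∈ F.rays, c = {v}) ∨ ∃ u v, F.Adj u v ∧ c = {u, v}

/-- The poset of cones of the fan, ordered by the relation of being a face. -/
abbrev Cone (F : CompleteFan) : Type := {c : Finset (ℤ × ℤ) // F.IsCone c}

/-- The zero cone. -/
def zeroCone (F : CompleteFan) : F.Cone := ⟨∅, Or.inl rfl⟩

theorem isCone_subset {F : CompleteFan} {c d : Finset (ℤ × ℤ)} (hd : F.IsCone d) (h : c ⊆ d) :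
    F.IsCone c := by
  rcases hd with rfl | ⟨v, hv, rfl⟩ | ⟨u, v, huv, rfl⟩
  · exact Or.inl (Finset.subset_empty.mp h)
  · rcases Finset.subset_singleton_iff.mp h with rfl | rfl
    · exact Or.inl rfl
    · exact Or.inr (Or.inl ⟨v, hv, rfl⟩)
  · by_cases h1 : u ∈ c <;> by_cases h2 : v ∈ c
    · refine Or.inr (Or.inr ⟨u, v, huv, Finset.Subset.antisymm h ?_⟩)
      intro x hx
      simp only [Finset.mem_insert, Finset.mem_singleton] at hx
      rcases hx with rfl | rfl <;> assumption
    · refine Or.inr (Or.inl ⟨u, huv.1, Finset.Subset.antisymm ?_ (by simpa using h1)⟩)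
      intro x hx
      have := h hx
      simp only [Finset.mem_insert, Finset.mem_singleton] at this ⊢
      rcases this with rfl | rfl
      · rfl
      · exact absurd hx h2
    · refine Or.inr (Or.inl ⟨v, huv.2.1, Finset.Subset.antisymm ?_ (by simpa using h2)⟩)
      intro x hx
      have := h hx
      simp only [Finset.mem_insert, Finset.mem_singleton] at this ⊢
      rcases this with rfl | rfl
      · exact absurd hx h1
      · rfl
    · refine Or.inl (Finset.eq_empty_of_forall_notMem ?_)
      intro x hx
      have := h hx
      simp only [Finset.mem_insert, Finset.mem_singleton] at this
      rcases this with rfl | rfl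
      · exact h1 hx
      · exact h2 hx

/-- Every face `c` of a cone `d` is cut out by a character which is nonnegative on `d`. -/
theorem exists_character {F : CompleteFan} {c d : Finset (ℤ × ℤ)} (hd : F.IsCone d) (h : c ⊆ d) :
    ∃ m : ℤ × ℤ, ∀ v ∈ d, 0 ≤ pairing m v ∧ (pairing m v = 0 ↔ v ∈ c) := by
  have key : ∀ w ∈ d, ∃ m : ℤ × ℤ, 0 < pairing m w ∧ ∀ v ∈ d, v ≠ w → pairing m v = 0 := by
    rcases hd with rfl | ⟨v, hv, rfl⟩ | ⟨u, v, huv, rfl⟩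
    · simp
    · intro w hw
      rw [Finset.mem_singleton] at hw
      subst hw
      refine ⟨w, ?_, by simp⟩
      have hne : w ≠ 0 := by
        rintro rfl
        simpa using F.primitive _ hv
      have : w.1 ≠ 0 ∨ w.2 ≠ 0 := by
        by_contra! hc
        exact hne (Prod.ext hc.1 hc.2)
      unfold pairing
      rcases this with h0 | h0
      · have := mul_self_pos.mpr h0
        nlinarith [mul_self_nonneg w.2]
      · have := mul_self_pos.mpr h0
        nlinarith [mul_self_nonneg w.1]
    · have hdet := huv.2.2.1
      simp only [det] at hdet
      intro w hw
      simp only [Finset.mem_insert, Finset.mem_singleton] at hw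
      rcases hw with rfl | rfl
      · refine ⟨(v.2, -v.1), by simp only [pairing]; linarith, ?_⟩
        intro x hx hxw
        simp only [Finset.mem_insert, Finset.mem_singleton] at hx
        rcases hx with rfl | rfl
        · exact absurd rfl hxw
        · simp only [pairing]; ring
      · refine ⟨(-u.2, u.1), by simp only [pairing]; linarith, ?_⟩
        intro x hx hxw
        simp only [Finset.mem_insert, Finset.mem_singleton] at hx
        rcases hx with rfl | rfl
        · simp only [pairing]; ring
        · exact absurd rfl hxw
  choose! g hg1 hg2 using key
  have hadd : ∀ (s : Finset (ℤ × ℤ)) (v : ℤ × ℤ),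
      pairing (∑ w ∈ s, g w) v = ∑ w ∈ s, pairing (g w) v := by
    intro s v
    simp only [pairing, Prod.fst_sum, Prod.snd_sum, Finset.sum_mul, Finset.sum_add_distrib]
  refine ⟨∑ w ∈ d \ c, g w, fun v hv => ?_⟩
  rw [hadd]
  by_cases hvc : v ∈ c
  · have : ∑ w ∈ d \ c, pairing (g w) v = 0 := by
      refine Finset.sum_eq_zero fun w hw => ?_
      rw [Finset.mem_sdiff] at hw
      refine hg2 w hw.1 v hv ?_
      rintro rfl
      exact hw.2 hvc
    simp [this, hvc]
  · have : ∑ w ∈ d \ c, pairing (g w) v = pairing (g v) v := by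
      refine Finset.sum_eq_single v (fun w hw hwv => hg2 w (Finset.mem_sdiff.mp hw).1 v hv hwv.symm)
        fun hv' => absurd (Finset.mem_sdiff.mpr ⟨hv, hvc⟩) hv'
    rw [this]
    exact ⟨(hg1 v hv).le, by simp [hvc, (hg1 v hv).ne']⟩

end CompleteFan

/-! ### Affine toric charts -/

/-- The monoid `σ^∨ ∩ M` of characters that are nonnegative on the cone generated by `c`. -/
def dualMonoid (c : Finset (ℤ × ℤ)) : AddSubmonoid (ℤ × ℤ) where
  carrier := {m | ∀ v ∈ c, 0 ≤ pairing m v}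
  zero_mem' := by simp [pairing]
  add_mem' {a b} ha hb v hv := by
    have h1 := ha v hv
    have h2 := hb v hv
    simp only [pairing, Prod.fst_add, Prod.snd_add] at *
    linarith

theorem dualMonoid_anti {c d : Finset (ℤ × ℤ)} (h : c ⊆ d) : dualMonoid d ≤ dualMonoid c :=
  fun _ hm v hv => hm v (h hv)

section charts

variable (k : Type u) [Field k]

/-- The coordinate ring `k[σ^∨ ∩ M]` of the affine toric surface of the cone generated by `c`. -/
abbrev ChartRing (c : Finset (ℤ × ℤ)) : Type u := AddMonoidAlgebra k (dualMonoid c)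

/-- The inclusion `k[σ^∨ ∩ M] → k[τ^∨ ∩ M]` for a face `τ` of `σ`. -/
noncomputable def chartMap {c d : Finset (ℤ × ℤ)} (h : c ⊆ d) : ChartRing k d →+* ChartRing k c :=
  AddMonoidAlgebra.mapDomainRingHom k (AddSubmonoid.inclusion (dualMonoid_anti h))

theorem chartMap_single {c d : Finset (ℤ × ℤ)} (h : c ⊆ d) (m : dualMonoid d) (a : k) :
    chartMap k h (AddMonoidAlgebra.single m a) =
      AddMonoidAlgebra.single (AddSubmonoid.inclusion (dualMonoid_anti h) m) a := by
  simp [chartMap]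

theorem isLocalization_chartMap {c d : Finset (ℤ × ℤ)} (h : c ⊆ d) (m : dualMonoid d)
    (hm : ∀ v ∈ d, (pairing m v = 0 ↔ v ∈ c)) :
    @IsLocalization.Away _ _ (AddMonoidAlgebra.single m (1 : k)) (ChartRing k c) _
      (chartMap k h).toAlgebra := by
  let i := AddSubmonoid.inclusion (dualMonoid_anti h)
  let _ := (chartMap k h).toAlgebra
  have hX : ∀ n : ℕ, algebraMap (ChartRing k d) (ChartRing k c)
      (AddMonoidAlgebra.single m (1 : k) ^ n) = AddMonoidAlgebra.single (n • i m) 1 := by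
    intro n
    rw [AddMonoidAlgebra.single_pow, one_pow]
    change chartMap k h _ = _
    rw [chartMap_single, map_nsmul]
  have hX1 := hX 1
  rw [pow_one, one_smul] at hX1
  have hneg : -(m : ℤ × ℤ) ∈ dualMonoid c := by
    intro v hv
    have := (hm v (h hv)).mpr hv
    simp only [pairing, Prod.fst_neg, Prod.snd_neg] at this ⊢
    linarith
  refine IsLocalization.Away.mk _ ?_ ?_ ?_
  · rw [hX1]
    refine IsUnit.of_mul_eq_one (AddMonoidAlgebra.single ⟨_, hneg⟩ 1) ?_
    rw [AddMonoidAlgebra.single_mul_single, mul_one, AddMonoidAlgebra.one_def]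
    congr 1
    ext <;> simp [i]
  · intro s
    induction s using AddMonoidAlgebra.induction_linear with
    | zero => exact ⟨0, 0, by simp⟩
    | add x y hx hy =>
      obtain ⟨n₁, a₁, h₁⟩ := hx
      obtain ⟨n₂, a₂, h₂⟩ := hy
      refine ⟨n₁ + n₂, a₁ * AddMonoidAlgebra.single m 1 ^ n₂ +
        a₂ * AddMonoidAlgebra.single m 1 ^ n₁, ?_⟩
      rw [map_add, map_mul, map_mul, map_pow, map_pow, ← h₁, ← h₂]
      ring
    | single p r =>
      let N : ℕ := ∑ v ∈ d, (pairing p v).natAbs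
      have hmem : (p : ℤ × ℤ) + N • (m : ℤ × ℤ) ∈ dualMonoid d := by
        intro v hv
        have h1 : pairing ((p : ℤ × ℤ) + N • (m : ℤ × ℤ)) v = pairing p v + N * pairing m v := by
          simp only [pairing, Prod.fst_add, Prod.snd_add, nsmul_eq_mul,
            Prod.fst_mul, Prod.snd_mul, Prod.fst_natCast, Prod.snd_natCast]
          ring
        rw [h1]
        have hm0 : 0 ≤ pairing m v := m.2 v hv
        by_cases hvc : v ∈ c
        · have hp : 0 ≤ pairing p v := p.2 v hvc
          positivity
        · have hm1 : 1 ≤ pairing m v := by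
            have := mt (hm v hv).mp hvc
            omega
          have hN : (pairing p v).natAbs ≤ N :=
            Finset.single_le_sum (f := fun v => (pairing p v).natAbs) (fun _ _ => Nat.zero_le _) hv
          have hN' : ((pairing p v).natAbs : ℤ) ≤ N := by exact_mod_cast hN
          have : (N : ℤ) ≤ N * pairing m v := by nlinarith
          omega
      refine ⟨N, AddMonoidAlgebra.single ⟨_, hmem⟩ r, ?_⟩
      rw [← map_pow, hX, AddMonoidAlgebra.single_mul_single, mul_one]
      change _ = chartMap k h _
      rw [chartMap_single]
      congr 1
  · intro a b hab
    refine ⟨0, ?_⟩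
    have hinj : Function.Injective (chartMap k h) :=
      AddMonoidAlgebra.mapDomain_injective (AddSubmonoid.inclusion_injective (dualMonoid_anti h))
    rw [hinj hab]

/-- The affine toric surface `Spec k[σ^∨ ∩ M]` of the cone generated by `c`. -/
noncomputable abbrev chart (c : Finset (ℤ × ℤ)) : Scheme.{u} := Spec (.of (ChartRing k c))

/-- The embedding of the affine toric surface of a face into that of a cone. -/
noncomputable def chartIncl {c d : Finset (ℤ × ℤ)} (h : c ⊆ d) : chart k c ⟶ chart k d :=
  Spec.map (CommRingCat.ofHom (chartMap k h))

theorem chartIncl_self (c : Finset (ℤ × ℤ)) :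
    chartIncl k (Finset.Subset.refl c) = 𝟙 (chart k c) := by
  have : chartMap k (Finset.Subset.refl c) = RingHom.id _ :=
    AddMonoidAlgebra.mapDomainRingHom_id
  rw [chartIncl, this]
  exact Spec.map_id _

theorem chartIncl_comp {c d e : Finset (ℤ × ℤ)} (h₁ : c ⊆ d) (h₂ : d ⊆ e) :
    chartIncl k h₁ ≫ chartIncl k h₂ = chartIncl k (h₁.trans h₂) := by
  have : (chartMap k h₁).comp (chartMap k h₂) = chartMap k (h₁.trans h₂) :=
    (AddMonoidAlgebra.mapDomainRingHom_comp _ _).symm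
  rw [chartIncl, chartIncl, ← Spec.map_comp, ← CommRingCat.ofHom_comp, this]
  rfl

theorem isOpenImmersion_chartIncl {c d : Finset (ℤ × ℤ)} (h : c ⊆ d) (m : dualMonoid d)
    (hm : ∀ v ∈ d, (pairing m v = 0 ↔ v ∈ c)) : IsOpenImmersion (chartIncl k h) := by
  let _ := (chartMap k h).toAlgebra
  have := isLocalization_chartMap k h m hm
  exact IsOpenImmersion.of_isLocalization (R := ChartRing k d) (S := ChartRing k c)
    (AddMonoidAlgebra.single m (1 : k))

theorem range_chartIncl {c d : Finset (ℤ × ℤ)} (h : c ⊆ d) (m : dualMonoid d)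
    (hm : ∀ v ∈ d, (pairing m v = 0 ↔ v ∈ c)) :
    Set.range (chartIncl k h) =
      (PrimeSpectrum.basicOpen (AddMonoidAlgebra.single m (1 : k)) :
        Set (PrimeSpectrum (ChartRing k d))) := by
  let _ := (chartMap k h).toAlgebra
  have := isLocalization_chartMap k h m hm
  exact PrimeSpectrum.localization_away_comap_range (ChartRing k c)
    (AddMonoidAlgebra.single m (1 : k))

/-! ### The toric surface of a complete fan -/

variable (F : CompleteFan)

/-- The diagram of the affine toric surfaces of the cones of the fan. -/
noncomputable def chartFunctor : F.Cone ⥤ Scheme.{u} where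
  obj c := chart k c.1
  map f := chartIncl k (leOfHom f)
  map_id c := chartIncl_self k c.1
  map_comp f g := (chartIncl_comp k (leOfHom f) (leOfHom g)).symm

instance isOpenImmersion_chartFunctor_map {c d : F.Cone} (f : c ⟶ d) :
    IsOpenImmersion ((chartFunctor k F).map f) := by
  obtain ⟨m, hm⟩ := CompleteFan.exists_character d.2 (leOfHom f)
  exact isOpenImmersion_chartIncl k (leOfHom f) ⟨m, fun v hv => (hm v hv).1⟩
    fun v hv => (hm v hv).2

instance isLocallyDirected_chartFunctor :
    (chartFunctor k F ⋙ Scheme.forget).IsLocallyDirected where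
  cond := by
    intro c₁ c₂ d f₁ f₂ x₁ x₂ hx
    change chart k c₁.1 at x₁
    change chart k c₂.1 at x₂
    have h₁ : c₁.1 ⊆ d.1 := leOfHom f₁
    have h₂ : c₂.1 ⊆ d.1 := leOfHom f₂
    replace hx : chartIncl k h₁ x₁ = chartIncl k h₂ x₂ := hx
    obtain ⟨m₁, hm₁⟩ := CompleteFan.exists_character d.2 h₁
    obtain ⟨m₂, hm₂⟩ := CompleteFan.exists_character d.2 h₂
    let n₁ : dualMonoid d.1 := ⟨m₁, fun v hv => (hm₁ v hv).1⟩
    let n₂ : dualMonoid d.1 := ⟨m₂, fun v hv => (hm₂ v hv).1⟩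
    have h : c₁.1 ∩ c₂.1 ⊆ d.1 := Finset.inter_subset_left.trans h₁
    let e : F.Cone := ⟨c₁.1 ∩ c₂.1, CompleteFan.isCone_subset d.2 h⟩
    have hn : ∀ v ∈ d.1, (pairing (n₁ + n₂ : dualMonoid d.1) v = 0 ↔ v ∈ c₁.1 ∩ c₂.1) := by
      intro v hv
      have e₁ := hm₁ v hv
      have e₂ := hm₂ v hv
      have : pairing (n₁ + n₂ : dualMonoid d.1) v = pairing m₁ v + pairing m₂ v := by
        simp only [n₁, n₂, pairing, AddSubmonoid.coe_add, Prod.fst_add, Prod.snd_add]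
        ring
      rw [this, Finset.mem_inter, ← e₁.2, ← e₂.2]
      omega
    have hmem : chartIncl k h₁ x₁ ∈ Set.range (chartIncl k h) := by
      have r₁ : chartIncl k h₁ x₁ ∈ Set.range (chartIncl k h₁) := ⟨x₁, rfl⟩
      have r₂ : chartIncl k h₁ x₁ ∈ Set.range (chartIncl k h₂) := ⟨x₂, hx.symm⟩
      rw [range_chartIncl k h₁ n₁ fun v hv => (hm₁ v hv).2] at r₁
      rw [range_chartIncl k h₂ n₂ fun v hv => (hm₂ v hv).2] at r₂
      rw [range_chartIncl k h (n₁ + n₂) hn,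
        show AddMonoidAlgebra.single (n₁ + n₂) (1 : k) =
          AddMonoidAlgebra.single n₁ (1 : k) * AddMonoidAlgebra.single n₂ (1 : k) by
            rw [AddMonoidAlgebra.single_mul_single, mul_one], PrimeSpectrum.basicOpen_mul]
      exact ⟨r₁, r₂⟩
    obtain ⟨y, hy⟩ := hmem
    have i₁ : c₁.1 ∩ c₂.1 ⊆ c₁.1 := Finset.inter_subset_left
    have i₂ : c₁.1 ∩ c₂.1 ⊆ c₂.1 := Finset.inter_subset_right
    have o₁ : IsOpenImmersion (chartIncl k h₁) := isOpenImmersion_chartFunctor_map k F f₁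
    have o₂ : IsOpenImmersion (chartIncl k h₂) := isOpenImmersion_chartFunctor_map k F f₂
    refine ⟨e, homOfLE i₁, homOfLE i₂, y, ?_, ?_⟩
    · change chartIncl k i₁ y = x₁
      apply (chartIncl k h₁).isOpenEmbedding.injective
      rw [← Scheme.Hom.comp_apply, chartIncl_comp, hy]
    · change chartIncl k i₂ y = x₂
      apply (chartIncl k h₂).isOpenEmbedding.injective
      rw [← Scheme.Hom.comp_apply, chartIncl_comp, ← hx, hy]

/-- The structure morphism of an affine toric chart. -/
noncomputable def chartStr (c : Finset (ℤ × ℤ)) : chart k c ⟶ Spec (.of k) :=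
  Spec.map (CommRingCat.ofHom (algebraMap k (ChartRing k c)))

theorem chartIncl_str {c d : Finset (ℤ × ℤ)} (h : c ⊆ d) :
    chartIncl k h ≫ chartStr k d = chartStr k c := by
  have : (chartMap k h).comp (algebraMap k (ChartRing k d)) = algebraMap k (ChartRing k c) :=
    AddMonoidAlgebra.mapDomainRingHom_comp_algebraMap _
  rw [chartIncl, chartStr, ← Spec.map_comp, ← CommRingCat.ofHom_comp, this]
  rfl

/-- The toric surface `X_F` of a complete fan `F`: the scheme over `k` obtained by gluing the
affine toric surfaces `Spec k[σ^∨ ∩ M]`, where `σ` runs over the cones of `F`, along the open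
subschemes that correspond to common faces. -/
noncomputable def toricSurface : Over (Spec (.of k)) :=
  Over.mk (colimit.desc (chartFunctor k F)
    { pt := Spec (.of k)
      ι := { app := fun c => chartStr k c.1
             naturality := fun _ _ f =>
               (chartIncl_str k (leOfHom f)).trans (Category.comp_id _).symm } })

/-- The embedding of the chart of a cone into the toric surface. -/
noncomputable def chartι (c : F.Cone) : chart k c.1 ⟶ (toricSurface k F).left :=
  colimit.ι (chartFunctor k F) c

/-- The embedding of the torus `Spec k[M]`, the chart of the zero cone, into the toric surface. -/
noncomputable def torusι : chart k ∅ ⟶ (toricSurface k F).left :=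
  chartι k F F.zeroCone

end charts

/-! ### Singular points, the Picard number and weighted projective planes -/

/-- The set `Sing(X)` of singular points: the local ring is not regular. -/
def singularLocus (X : Scheme.{u}) : Set X := {x | ¬ IsRegularLocalRing (X.presheaf.stalk x)}

section picard

variable (X : Scheme.{u}) [IsIntegral X]

/-- The subgroup `𝒪_{X,x}^×` of the multiplicative group `K(X)^×` of the function field. -/
noncomputable def localUnits (x : X) : Subgroup (X.functionField)ˣ :=
  (Units.map (algebraMap (X.presheaf.stalk x) X.functionField).toMonoidHom).range

/-- The stalk `K(X)^× / 𝒪_{X,x}^×` at `x` of the sheaf of Cartier divisors. -/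
def LocalDivisor (x : X) : Type u := (X.functionField)ˣ ⧸ localUnits X x

noncomputable instance instCommGroupLocalDivisor (x : X) : CommGroup (LocalDivisor X x) :=
  inferInstanceAs (CommGroup ((X.functionField)ˣ ⧸ localUnits X x))

/-- The germ at `x` of the Cartier divisor of a rational function. -/
noncomputable def localDivisor (x : X) : (X.functionField)ˣ →* LocalDivisor X x :=
  QuotientGroup.mk' (localUnits X x)

/-- The group of Cartier divisors of an integral scheme, the global sections of the sheaf
`K^× / 𝒪^×`: families of elements of the stalks `K(X)^× / 𝒪_{X,x}^×` that are given by one rational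
function in a neighbourhood of every point. -/
noncomputable def cartierDivisors : Subgroup (∀ x : X, LocalDivisor X x) where
  carrier := {D | ∀ x : X, ∃ f : (X.functionField)ˣ, ∃ U : X.Opens, x ∈ U ∧
    ∀ y ∈ U, D y = localDivisor X y f}
  one_mem' _ := ⟨1, ⊤, trivial, fun y _ => (map_one (localDivisor X y)).symm⟩
  mul_mem' := by
    intro D E hD hE x
    obtain ⟨f, U, hxU, hf⟩ := hD x
    obtain ⟨g, V, hxV, hg⟩ := hE x
    refine ⟨f * g, U ⊓ V, ⟨hxU, hxV⟩, fun y hy => ?_⟩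
    rw [Pi.mul_apply, hf y hy.1, hg y hy.2, map_mul]
  inv_mem' := by
    intro D hD x
    obtain ⟨f, U, hxU, hf⟩ := hD x
    refine ⟨f⁻¹, U, hxU, fun y hy => ?_⟩
    rw [Pi.inv_apply, hf y hy, map_inv]

/-- The homomorphism that sends a rational function to its principal Cartier divisor. -/
noncomputable def principalDivisor : (X.functionField)ˣ →* cartierDivisors X where
  toFun f := ⟨fun x => localDivisor X x f, fun _ => ⟨f, ⊤, trivial, fun _ _ => rfl⟩⟩
  map_one' := Subtype.ext (funext fun x => map_one (localDivisor X x))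
  map_mul' f g := Subtype.ext (funext fun x => map_mul (localDivisor X x) f g)

/-- The Picard group of an integral scheme, as the group of Cartier divisors modulo linear
equivalence. -/
abbrev PicardGroup : Type u := cartierDivisors X ⧸ (principalDivisor X).range

end picard

/-- `X` is integral and its Picard number is one. The Picard number is taken to be the rank of the
Picard group; on a complete toric surface, linear and numerical equivalence of Cartier divisors
agree up to torsion, so that this is the rank of the Néron-Severi group. -/
def HasPicardNumberOne (X : Scheme.{u}) : Prop :=
  ∃ _ : IsIntegral X, Module.rank ℤ (Additive (PicardGroup X)) = 1

section weighted

variable (k : Type u) [Field k] (w : Fin 3 → ℕ)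

/-- The grading of `k[x₀, x₁, x₂]` in which `xᵢ` has degree `w i`. -/
abbrev weightedGrading : ℕ → Submodule k (MvPolynomial (Fin 3) k) :=
  MvPolynomial.weightedHomogeneousSubmodule k w

noncomputable instance instGradedWeightedGrading : GradedAlgebra (weightedGrading k w) :=
  MvPolynomial.weightedGradedAlgebra k w

/-- The weighted projective plane `ℙ(w₀, w₁, w₂) = Proj k[x₀, x₁, x₂]` as a scheme over `k`. -/
noncomputable def weightedProjectivePlane : Over (Spec (.of k)) :=
  Over.mk (Proj.toSpecZero (weightedGrading k w) ≫
    Spec.map (CommRingCat.ofHom (algebraMap k (weightedGrading k w 0))))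

end weighted

/-! ### Toric log del Pezzo surfaces and cascades -/

namespace CompleteFan

variable (F : CompleteFan)

/-- The anticanonical divisor of the toric surface of `F` is the sum of the torus-invariant curves,
and it is ample if and only if its support function is strictly convex, that is, if and only if for
each two-dimensional cone, spanned by `u` and `v`, all the other ray generators lie strictly on the
same side of the line through `u` and `v` as the origin. (In other words, the ray generators are the
vertices of a convex polygon and `F` consists of the cones over its faces.) The singularities of a
toric surface are cyclic quotient singularities and therefore always log terminal. -/
def IsLogDelPezzo : Prop :=
  ∀ u v, F.Adj u v → ∀ w ∈ F.rays, w ≠ u → w ≠ v → 0 < det (v - u) (w - u)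

/-- On the smooth toric surface of `F`, the torus-invariant curve `D_v` has self-intersection
number `a`: if `u` and `w` are the neighbours of `v`, then `u + w = -a v`. -/
def SelfInt (v : ℤ × ℤ) (a : ℤ) : Prop :=
  ∃ u w, F.Adj u v ∧ F.Adj v w ∧ u + w = (-a) • v

/-- Let the toric surface of `F` be the minimal resolution of `S`. Then `S` is basic: `D² ≥ -2` for
every torus-invariant curve `D` that meets a `(-1)`-curve `C`. (All curves of negative
self-intersection on a complete toric surface are torus-invariant.) -/
def IsBasic : Prop :=
  ∀ c d, F.SelfInt c (-1) → (F.Adj c d ∨ F.Adj d c) → ∀ a, F.SelfInt d a → -2 ≤ a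

/-- The dual graph of the torus-invariant curves on the smooth toric surface of `F` is the cycle
whose vertices have the weights in the list `b`, in this cyclic order. -/
def HasDualCycle (b : List ℤ) : Prop :=
  ∃ ρ : Fin b.length → ℤ × ℤ, Function.Injective ρ ∧ Set.range ρ = (F.rays : Set (ℤ × ℤ)) ∧
    ∀ i, F.Adj (ρ i) (ρ (finRotate _ i)) ∧ F.SelfInt (ρ i) (b.get i)

end CompleteFan

section cascade

variable (k : Type u) [Field k]

/-- `S` is a toric log del Pezzo surface over `k`. -/
def IsToricLogDelPezzo (S : Over (Spec (.of k))) : Prop :=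
  ∃ F : CompleteFan, F.IsLogDelPezzo ∧ Nonempty (S ≅ toricSurface k F)

/-- A toric morphism that extends the identity of the torus. (Between complete toric surfaces, such
a morphism is proper and birational.) -/
def IsToric {F' F : CompleteFan} (f : toricSurface k F' ⟶ toricSurface k F) : Prop :=
  torusι k F' ≫ f.left = torusι k F

/-- `π` is the minimal resolution of the toric surface of `F`: its source is smooth, and no
exceptional curve is a `(-1)`-curve. The exceptional curves are the torus-invariant curves that
belong to the new rays. -/
structure IsMinimalResolution {F' F : CompleteFan} (π : toricSurface k F' ⟶ toricSurface k F) :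
    Prop where
  toric : IsToric k π
  smooth : singularLocus (toricSurface k F').left = ∅
  minimal : ∀ v ∈ F'.rays, v ∉ F.rays → ¬ F'.SelfInt v (-1)

/-- `φ` is a toric blow-down between smooth toric surfaces, i.e. the blow-up of the torus-fixed point
of a two-dimensional cone. If the cone is spanned by `u` and `v`, it is subdivided by `u + v`. -/
structure IsToricBlowDown {F' F : CompleteFan} (φ : toricSurface k F' ⟶ toricSurface k F) :
    Prop where
  toric : IsToric k φ
  starSubdivision : ∃ u v, F.Adj u v ∧ F'.rays = insert (u + v) F.rays

/-- `S` admits a cascade to the basic surface whose minimal resolution is the smooth toric surface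
with dual cycle `b`: there is a diagram
`S'_t → S'_{t-1} → ⋯ → S'_0` of toric blow-downs, where `S'_i` is the toric surface of `F' i`, and
where `S'_i` is the minimal resolution of a toric log del Pezzo surface `S_i` of Picard number one,
the toric surface of `F i`, such that `S ≅ S_t` and `S_0` is basic. -/
def AdmitsCascadeTo (S : Over (Spec (.of k))) (b : List ℤ) : Prop :=
  ∃ (t : ℕ) (F F' : ℕ → CompleteFan),
    Nonempty (S ≅ toricSurface k (F t)) ∧
    (∀ i ≤ t, (F i).IsLogDelPezzo ∧ HasPicardNumberOne (toricSurface k (F i)).left) ∧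
    (∀ i ≤ t, ∃ π : toricSurface k (F' i) ⟶ toricSurface k (F i), IsMinimalResolution k π) ∧
    (∀ i < t, ∃ φ : toricSurface k (F' (i + 1)) ⟶ toricSurface k (F' i), IsToricBlowDown k φ) ∧
    (F' 0).IsBasic ∧ (F' 0).HasDualCycle b

end cascade

/-- The weights of the dual cycle of the smooth toric surface `[[s₁², F₁, s₂², F₂]]` with a
`ℙ¹`-fibration whose two torus-invariant sections have self-intersection numbers `s₁` and `s₂` and
whose two torus-invariant fibres have the weighted dual graphs `F₁` and `F₂` (chains). -/
def fibrationCycle (s₁ : ℤ) (F₁ : List ℤ) (s₂ : ℤ) (F₂ : List ℤ) : List ℤ :=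
  s₁ :: F₁ ++ s₂ :: F₂

/-- The singular fibre of type `I₀`. -/
def fibreI : List ℤ := [-2, -1, -2]

/-- The singular fibre of type `II₀`. -/
def fibreII : List ℤ := [-1, -2, -2, -1]

/-- The dual cycle of the minimal resolution of `S(3A₂)`. -/
def cycle3A2 : List ℤ := fibrationCycle (-2) fibreI (-2) fibreII

/-- The dual cycle of the minimal resolution of `S(std²_n)`. -/
def cycleStd2 (n : ℕ) : List ℤ := fibrationCycle (-n) fibreI (n - 2) fibreI

end ToricSurface

/-! # Toric log del Pezzo surfaces of Picard number one -/

/-! Write `S` as the toric surface of a complete fan. Its Picard number is the number of rays minus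
two: Cartier divisors are principal on the torus, so up to torsion the Picard group is spanned by
the torus-invariant curves, and the relations come from the rank-two character lattice
(`Atlas.rank_picardGroup`). Hence there are three rays `u₀, u₁, u₂`, in counterclockwise order. The
singular points are the fixed points of the cones with determinant at least `2`
(`Atlas.encard_singularLocus`): a smooth cone gives a polynomial ring, whereas a cone of larger
determinant has three irreducible characters, hence a cotangent space of dimension at least three on
a surface.

The relation `det u₁ u₂ • u₀ + det u₂ u₀ • u₁ + det u₀ u₁ • u₂ = 0` settles the case of at most two
singular points. If `det u₁ u₂ = 1`, then `u₁, u₂` is a basis, and the degree-zero localizations of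
`k[x₀, x₁, x₂]` with weights `1, det u₂ u₀, det u₀ u₁` are the coordinate rings of the affine
charts. The last two weights are coprime because `u₀` is primitive, and division with remainder
brings them into the required form.

Suppose that all three determinants are at least `2`, and pass to the minimal resolution. Record a
curve `v` with neighbours `p, n` by the integer `c` with `p + n = c v`, the negative of its
self-intersection number. The curves between two original rays have `c ≥ 2`, so a linear function
that starts to increase on such an arc keeps increasing. Comparing the functions `det uᵢ` with the
cyclic order shows that the original curves have `c ≤ 1` and that at most one has `c ≤ 0`; so at
least two original curves are `(-1)`-curves.

If a `(-1)`-curve has a neighbour with `c ≥ 3`, contracting it and taking a suitable neighbour as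
the new vertex yields the minimal resolution of another such triangle (`exists_blowDown`), and one
inducts on the number of rays. Otherwise the surface is basic, and around a `(-1)`-curve `u₀ = b +
a` the chain is `x, b, u₀, a, y` with `x = b - a = -y`: a fibre of type `(-2, -1, -2)` between two
sections. The function `det y`, monotone on the arcs, determines how the chains around two
`(-1)`-curves fit together. Either both join the same two sections, which gives the cycle of
`S(std²_n)`, or the chains overlap and the third original curve is also a `(-1)`-curve, which gives
the cycle of `S(3A₂)`. -/

namespace ToricSurface

/-! ### Stalks and rational functions on affine open charts -/

section openCharts

variable {R : Type u} [CommRing R] {X : Scheme.{u}} (j : Spec (.of R) ⟶ X) [IsOpenImmersion j]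

/-- The functions on an affine chart as sections over its image. -/
noncomputable def chartSection : R →+* Γ(X, j ''ᵁ ⊤) :=
  ((Scheme.ΓSpecIso (.of R)).inv ≫ (j.appIso ⊤).inv).hom

theorem mem_image_top (p : PrimeSpectrum R) : j p ∈ j ''ᵁ ⊤ := ⟨p, trivial, rfl⟩

/-- The functions on an affine chart as elements of the stalk at a point of its image. -/
noncomputable def chartGerm (p : PrimeSpectrum R) : R →+* X.presheaf.stalk (j p) :=
  (X.presheaf.germ (j ''ᵁ ⊤) (j p) (mem_image_top j p)).hom.comp (chartSection j)

theorem stalkMap_chartGerm (p : Spec (.of R)) (a : R) :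
    j.stalkMap p (chartGerm j p a) = StructureSheaf.toStalk R p a := by
  have h : ((Scheme.ΓSpecIso (.of R)).inv ≫ (j.appIso ⊤).inv) ≫
      X.presheaf.germ (j ''ᵁ ⊤) (j p) (mem_image_top j p) ≫ j.stalkMap p =
      StructureSheaf.toStalk R p := by
    rw [Scheme.Hom.germ_stalkMap, Category.assoc, Scheme.Hom.appIso_inv_app_assoc]
    have := (Spec (.of R)).presheaf.germ_res (eqToHom (j.preimage_image_eq ⊤)) p
      (mem_image_top j p)
    rw [this]
    rfl
  exact congrArg (fun g => g.hom a) h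

/-- An open immersion induces isomorphisms on stalks, and the stalk of `Spec R` at `p` is the
localization there; `stalkMap_chartGerm` matches the two structure maps from `R`. -/
theorem isLocalization_chartGerm (p : PrimeSpectrum R) :
    @IsLocalization.AtPrime R _ (X.presheaf.stalk (j p)) _ (chartGerm j p).toAlgebra
      p.asIdeal _ := by
  let _ := (chartGerm j p).toAlgebra
  refine (IsLocalization.isLocalization_iff_of_ringEquiv p.asIdeal.primeCompl
      (@asIso _ _ _ _ (j.stalkMap p) (inferInstanceAs (IsIso (j.stalkMap (id p : Spec (.of R)))))).commRingCatIsoToRingEquiv).mpr ?_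
  have h := StructureSheaf.IsLocalization.to_stalk R p
  have he : ((asIso (C := CommRingCat) (j.stalkMap (id p : Spec (.of R)))).commRingCatIsoToRingEquiv.toRingHom.comp
      (algebraMap R (X.presheaf.stalk (j p)))) = (StructureSheaf.toStalk R p).hom :=
    RingHom.ext (stalkMap_chartGerm j p)
  exact Eq.mpr (congrArg (fun g => @IsLocalization R _ p.asIdeal.primeCompl _ _ g.toAlgebra) he) h

theorem isRegularLocalRing_stalk_iff (p : PrimeSpectrum R) :
    IsRegularLocalRing (X.presheaf.stalk (j p)) ↔
      IsRegularLocalRing (Localization.AtPrime p.asIdeal) := by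
  let _ := (chartGerm j p).toAlgebra
  have := isLocalization_chartGerm j p
  let e := (IsLocalization.algEquiv p.asIdeal.primeCompl (X.presheaf.stalk (j p))
    (Localization.AtPrime p.asIdeal)).toRingEquiv
  exact ⟨fun _ => .of_ringEquiv e, fun _ => .of_ringEquiv e.symm⟩

variable [IsIntegral X] [Nontrivial R]

/-- The functions on an affine chart as rational functions. -/
noncomputable def chartRational : R →+* X.functionField :=
  have : Nonempty (j ''ᵁ ⊤ : X.Opens) :=
    ⟨⟨_, mem_image_top j (Classical.arbitrary (PrimeSpectrum R))⟩⟩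
  (X.germToFunctionField (j ''ᵁ ⊤)).hom.comp (chartSection j)

theorem algebraMap_chartGerm (p : PrimeSpectrum R) (a : R) :
    algebraMap (X.presheaf.stalk (j p)) X.functionField (chartGerm j p a) = chartRational j a := by
  have : Nonempty (j ''ᵁ ⊤ : X.Opens) := ⟨⟨_, mem_image_top j p⟩⟩
  exact Scheme.algebraMap_germ_eq_germToFunctionField X _ _

theorem chartRational_injective : Function.Injective (chartRational j) := by
  have : Nonempty (j ''ᵁ ⊤ : X.Opens) :=
    ⟨⟨_, mem_image_top j (Classical.arbitrary (PrimeSpectrum R))⟩⟩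
  have h1 := Scheme.germToFunctionField_injective X (j ''ᵁ ⊤)
  refine Function.Injective.comp (g := (X.germToFunctionField (j ''ᵁ ⊤)).hom) h1 (f := chartSection j) ?_
  exact ((ConcreteCategory.isIso_iff_bijective
    ((Scheme.ΓSpecIso (.of R)).inv ≫ (j.appIso ⊤).inv)).mp inferInstance).1

/-- The stalk is `R` localized at `p`, so its units are the fractions `a / b` with both terms
outside `p`. Writing this without division turns all later questions about Cartier divisors into
questions about rings. -/
theorem mem_localUnits_iff (p : PrimeSpectrum R) (f : (X.functionField)ˣ) :
    f ∈ localUnits X (j p) ↔ ∃ a b : R, a ∉ p.asIdeal ∧ b ∉ p.asIdeal ∧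
      f * chartRational j b = chartRational j a := by
  let _ := (chartGerm j p).toAlgebra
  have := isLocalization_chartGerm j p
  have hal : ∀ a, algebraMap R (X.presheaf.stalk (j p)) a = chartGerm j p a := fun _ => rfl
  have hu : ∀ a ∉ p.asIdeal, IsUnit (chartGerm j p a) := fun a ha =>
    IsLocalization.map_units (X.presheaf.stalk (j p)) (⟨a, ha⟩ : p.asIdeal.primeCompl)
  constructor
  · rintro ⟨v, rfl⟩
    obtain ⟨⟨a, b⟩, h⟩ := IsLocalization.surj p.asIdeal.primeCompl (v : X.presheaf.stalk (j p))
    simp only [hal] at h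
    refine ⟨a, b, ?_, b.2, ?_⟩
    · intro ha
      have h2 : IsUnit (chartGerm j p a) := by
        rw [← h]
        exact v.isUnit.mul (hu _ b.2)
      have := (IsLocalization.AtPrime.isUnit_to_map_iff (X.presheaf.stalk (j p)) p.asIdeal a).mp h2
      exact this ha
    · have := congrArg (algebraMap (X.presheaf.stalk (j p)) X.functionField) h
      rw [map_mul, algebraMap_chartGerm, algebraMap_chartGerm] at this
      exact this
  · rintro ⟨a, b, ha, hb, h⟩
    obtain ⟨va, hva⟩ := hu a ha
    obtain ⟨vb, hvb⟩ := hu b hb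
    refine ⟨va * vb⁻¹, ?_⟩
    rw [map_mul, map_inv, mul_inv_eq_iff_eq_mul]
    ext
    change algebraMap (X.presheaf.stalk (j p)) X.functionField va =
      f * algebraMap (X.presheaf.stalk (j p)) X.functionField vb
    rw [hva, hvb, algebraMap_chartGerm, algebraMap_chartGerm, h]

/-- The generic point of `X` is the image of that of the chart, so the function field is the
localization of `R` at the zero ideal. -/
theorem exists_fraction (hR : IsDomain R) (f : X.functionField) :
    ∃ a b : R, b ≠ 0 ∧ f * chartRational j b = chartRational j a := by
  by_cases hf : f = 0
  · exact ⟨0, 1, one_ne_zero, by simp [hf]⟩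
  · have hgen : j (genericPoint (Spec (.of R))) = genericPoint X :=
      genericPoint_eq_of_isOpenImmersion j
    have hbij : Function.Bijective
        (algebraMap (X.presheaf.stalk (j (genericPoint (Spec (.of R))))) X.functionField) := by
      have h : X.presheaf.stalkSpecializes
          ((genericPoint_spec X).specializes (Set.mem_univ (j (genericPoint (Spec (.of R)))))) =
          (X.presheaf.stalkCongr (.of_eq hgen)).hom := rfl
      change Function.Bijective (X.presheaf.stalkSpecializes _).hom
      rw [h]
      exact (ConcreteCategory.isIso_iff_bijective _).mp inferInstance
    obtain ⟨s, rfl⟩ := hbij.2 f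
    let _ := (chartGerm j (genericPoint (Spec (.of R)))).toAlgebra
    have := isLocalization_chartGerm j (genericPoint (Spec (.of R)))
    obtain ⟨⟨a, b⟩, h⟩ := IsLocalization.surj
      (show PrimeSpectrum R from genericPoint (Spec (.of R))).asIdeal.primeCompl s
    refine ⟨a, b, ?_, ?_⟩
    · intro hb
      exact b.2 (hb ▸ zero_mem _)
    · have := congrArg (algebraMap (X.presheaf.stalk (j (genericPoint (Spec (.of R)))))
        X.functionField) h
      rw [map_mul] at this
      erw [algebraMap_chartGerm, algebraMap_chartGerm] at this
      exact this

/-- Functions on nested charts are compared as rational functions. The identity is checked in the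
stalk at one point of the smaller chart, where the stalk map is injective. -/
theorem chartRational_comp {R' : Type u} [CommRing R'] [Nontrivial R'] (φ : R →+* R')
    (j' : Spec (.of R') ⟶ X) [IsOpenImmersion j']
    (hj : Spec.map (CommRingCat.ofHom φ) ≫ j = j') (a : R) :
    chartRational j' (φ a) = chartRational j a := by
  subst hj
  set i := Spec.map (CommRingCat.ofHom φ)
  let p : Spec (.of R') := Classical.arbitrary (PrimeSpectrum R')
  rw [← algebraMap_chartGerm (i ≫ j) p, ← algebraMap_chartGerm j (i p)]
  change algebraMap (X.presheaf.stalk (j (i p))) X.functionField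
    (chartGerm (i ≫ j) p (φ a)) = _
  congr 1
  have hinj : Function.Injective ((i ≫ j).stalkMap p) :=
    ((ConcreteCategory.isIso_iff_bijective ((i ≫ j).stalkMap p)).mp inferInstance).1
  apply hinj
  have h1 := stalkMap_chartGerm (i ≫ j) p (φ a)
  have h2 := stalkMap_chartGerm j (i p) a
  have h3 : (i ≫ j).stalkMap p = j.stalkMap (i p) ≫ i.stalkMap p := Scheme.Hom.stalkMap_comp i j p
  refine h1.trans ?_
  rw [h3]
  refine Eq.trans ?_ (congrArg (i.stalkMap p) h2).symm
  exact (stalkMap_toStalk_apply (CommRingCat.ofHom φ) p a).symm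

end openCharts
end ToricSurface

/-! ### Atlases: recognizing a toric surface by its charts -/

namespace ToricSurface

variable (k : Type u) [Field k] (F : CompleteFan)

/-- Open immersions of the affine toric charts of a fan into a scheme `X` which identify `X` with
the toric surface of the fan. -/
structure Atlas (X : Scheme.{u}) where
  /-- The embedding of a chart. -/
  map : ∀ c : F.Cone, chart k c.1 ⟶ X
  isOpenImmersion : ∀ c, IsOpenImmersion (map c)
  incl_map : ∀ (c d : F.Cone) (h : c.1 ⊆ d.1), chartIncl k h ≫ map d = map c
  surjective : ∀ x : X, ∃ (c : F.Cone) (y : chart k c.1), map c y = x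
  inter : ∀ (c d : F.Cone) (x : chart k c.1) (y : chart k d.1), map c x = map d y →
    ∃ (e : F.Cone) (hc : e.1 ⊆ c.1) (hd : e.1 ⊆ d.1) (z : chart k e.1),
      chartIncl k hc z = x ∧ chartIncl k hd z = y

attribute [instance] Atlas.isOpenImmersion

/-- The charts of the toric surface of a fan. -/
noncomputable def toricAtlas : Atlas k F (toricSurface k F).left where
  map := chartι k F
  isOpenImmersion c := inferInstanceAs (IsOpenImmersion (colimit.ι (chartFunctor k F) c))
  incl_map c d h := colimit.w (chartFunctor k F) (homOfLE h : c ⟶ d)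
  surjective := Scheme.IsLocallyDirected.ι_jointly_surjective (chartFunctor k F)
  inter c d x y h := by
    obtain ⟨e, fc, fd, z, h1, h2⟩ :=
      (Scheme.IsLocallyDirected.ι_eq_ι_iff (chartFunctor k F) (i := c) (j := d)).mp h
    exact ⟨e, leOfHom fc, leOfHom fd, z, h1, h2⟩

theorem chartι_str (c : F.Cone) : chartι k F c ≫ (toricSurface k F).hom = chartStr k c.1 :=
  colimit.ι_desc _ _

variable {k F}

namespace Atlas

variable {X : Scheme.{u}} (A : Atlas k F X)

/-- Transport of an atlas along an isomorphism. -/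
noncomputable def congr {Y : Scheme.{u}} (e : X ≅ Y) : Atlas k F Y where
  map c := A.map c ≫ e.hom
  isOpenImmersion c := inferInstance
  incl_map c d h := by rw [← Category.assoc, A.incl_map c d h]
  surjective y := by
    obtain ⟨c, x, hx⟩ := A.surjective (e.inv y)
    refine ⟨c, x, ?_⟩
    rw [Scheme.Hom.comp_apply, hx, ← Scheme.Hom.comp_apply, e.inv_hom_id]
    rfl
  inter c d x y h := by
    rw [Scheme.Hom.comp_apply, Scheme.Hom.comp_apply] at h
    exact A.inter c d x y (e.hom.isOpenEmbedding.injective h)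

theorem map_incl (c d : F.Cone) (h : c.1 ⊆ d.1) (x : chart k c.1) :
    A.map d (chartIncl k h x) = A.map c x := by
  rw [← Scheme.Hom.comp_apply, A.incl_map]

/-- The morphism from the toric surface to a scheme with an atlas. -/
noncomputable def fromToric : (toricSurface k F).left ⟶ X :=
  colimit.desc (chartFunctor k F)
    { pt := X
      ι := { app := A.map
             naturality := fun c d f =>
               (A.incl_map c d (leOfHom f)).trans (Category.comp_id _).symm } }

theorem chartι_fromToric (c : F.Cone) : chartι k F c ≫ A.fromToric = A.map c :=
  colimit.ι_desc _ _

/-- The morphism is a bijective open map by the covering and intersection properties of the atlas.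
On stalks it is an isomorphism because its composite with each chart is an open immersion. -/
instance isIso_fromToric : IsIso A.fromToric := by
  have happ : ∀ (c : F.Cone) (y : chart k c.1), A.fromToric (chartι k F c y) = A.map c y := by
    intro c y
    rw [← Scheme.Hom.comp_apply, chartι_fromToric]
  have hinj : Function.Injective A.fromToric := by
    intro x y hxy
    obtain ⟨c, x, rfl⟩ := (toricAtlas k F).surjective x
    obtain ⟨d, y, rfl⟩ := (toricAtlas k F).surjective y
    change A.fromToric (chartι k F c x) = A.fromToric (chartι k F d y) at hxy
    rw [happ, happ] at hxy
    obtain ⟨e, hc, hd, z, rfl, rfl⟩ := A.inter c d x y hxy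
    rw [map_incl, map_incl]
  have hsurj : Function.Surjective A.fromToric := by
    intro x
    obtain ⟨c, y, rfl⟩ := A.surjective x
    exact ⟨_, happ c y⟩
  have hcover : ∀ x, ∃ c y, chartι k F c y = x := (toricAtlas k F).surjective
  have hopen : ∀ c, IsOpenImmersion (chartι k F c) := (toricAtlas k F).isOpenImmersion
  have hmap : IsOpenMap A.fromToric := by
    intro U hU
    have : A.fromToric '' U = ⋃ c, A.map c '' (chartι k F c ⁻¹' U) := by
      ext x
      simp only [Set.mem_image, Set.mem_iUnion, Set.mem_preimage]
      constructor
      · rintro ⟨y, hy, rfl⟩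
        obtain ⟨c, z, rfl⟩ := hcover y
        exact ⟨c, z, hy, (happ c z).symm⟩
      · rintro ⟨c, z, hz, rfl⟩
        exact ⟨_, hz, happ c z⟩
    rw [this]
    exact isOpen_iUnion fun c => (A.map c).isOpenEmbedding.isOpenMap _
      (hU.preimage (chartι k F c).continuous)
  rw [isIso_iff_isIso_stalkMap]
  refine ⟨?_, ?_⟩
  · exact TopCat.isIso_of_bijective_of_isOpenMap _ ⟨hinj, hsurj⟩ hmap
  · intro x
    obtain ⟨c, y, rfl⟩ := hcover x
    have h1 : IsIso ((chartι k F c ≫ A.fromToric).stalkMap y) := by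
      rw [chartι_fromToric]
      infer_instance
    rw [Scheme.Hom.stalkMap_comp (chartι k F c) A.fromToric y] at h1
    replace h1 : IsIso (A.fromToric.stalkMap (chartι k F c y) ≫ (chartι k F c).stalkMap y) := h1
    exact IsIso.of_isIso_comp_right _ ((chartι k F c).stalkMap y)

/-- A scheme with an atlas is isomorphic to the toric surface. -/
theorem nonempty_iso (S : Over (Spec (.of k))) (A : Atlas k F S.left)
    (hA : ∀ c, A.map c ≫ S.hom = chartStr k c.1) : Nonempty (toricSurface k F ≅ S) := by
  refine ⟨Over.isoMk (asIso A.fromToric) ?_⟩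
  refine colimit.hom_ext fun c => ?_
  change chartι k F c ≫ A.fromToric ≫ S.hom = chartι k F c ≫ (toricSurface k F).hom
  rw [← Category.assoc, chartι_fromToric, chartι_str, hA]

instance isDomain_chartRing (c : Finset (ℤ × ℤ)) : IsDomain (ChartRing k c) := by
  have : UniqueSums (dualMonoid c) :=
    UniqueSums.of_injective_addHom (dualMonoid c).subtype.toAddHom Subtype.val_injective
      inferInstance
  have : NoZeroDivisors (ChartRing k c) := inferInstance
  exact NoZeroDivisors.to_isDomain _

/-- The stalks embed in stalks of spectra of domains, so `X` is reduced. The torus is irreducible,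
and it is dense because it meets every nonempty open subset of every irreducible chart. -/
theorem isIntegral (A : Atlas k F X) : IsIntegral X := by
  have hred : IsReduced X := by
    have (x : X) : _root_.IsReduced (X.presheaf.stalk x) := by
      obtain ⟨c, y, rfl⟩ := A.surjective x
      exact isReduced_of_injective ((A.map c).stalkMap y).hom
        ((ConcreteCategory.isIso_iff_bijective ((A.map c).stalkMap y)).mp inferInstance).1
    exact isReduced_of_isReduced_stalk X
  have hirr : IrreducibleSpace X := by
    have hd : Dense (Set.range (A.map F.zeroCone)) := by
      rw [dense_iff_inter_open]
      rintro U hU ⟨x, hx⟩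
      obtain ⟨c, y, rfl⟩ := A.surjective x
      have h1 : IsOpen ((A.map c) ⁻¹' U) := hU.preimage (A.map c).continuous
      have h0 : IsOpenImmersion (chartIncl k (Finset.empty_subset c.1)) :=
        isOpenImmersion_chartFunctor_map k F
          (homOfLE (Finset.empty_subset c.1) : F.zeroCone ⟶ c)
      have h2 : IsOpen (Set.range (chartIncl k (Finset.empty_subset c.1))) :=
        (chartIncl k (Finset.empty_subset c.1)).isOpenEmbedding.isOpen_range
      have h3 : IrreducibleSpace (chart k c.1) := inferInstance
      obtain ⟨z, hz, w, rfl⟩ := nonempty_preirreducible_inter h1 h2 ⟨y, hx⟩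
        ⟨_, (Classical.arbitrary (PrimeSpectrum (ChartRing k ∅)) : chart k ∅), rfl⟩
      exact ⟨_, hz, w, (A.map_incl F.zeroCone c (Finset.empty_subset c.1) w).symm⟩
    have h3 : IrreducibleSpace (chart k (∅ : Finset (ℤ × ℤ))) := inferInstance
    have h4 : IsIrreducible (Set.range (A.map F.zeroCone)) := by
      rw [← Set.image_univ]
      exact (IrreducibleSpace.isIrreducible_univ _).image _ (A.map F.zeroCone).continuous.continuousOn
    have h5 := h4.closure
    rw [hd.closure_eq] at h5
    exact (irreducibleSpace_def X).mpr h5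
  exact isIntegral_of_irreducibleSpace_of_isReduced X

end Atlas
end ToricSurface

/-! ### Characters and regularity of affine charts -/

namespace ToricSurface

theorem pairing_add (m m' v : ℤ × ℤ) : pairing (m + m') v = pairing m v + pairing m' v := by
  simp only [pairing, Prod.fst_add, Prod.snd_add]; ring

theorem pairing_smul (a : ℤ) (m v : ℤ × ℤ) : pairing (a • m) v = a * pairing m v := by
  simp only [pairing, Prod.smul_fst, Prod.smul_snd, smul_eq_mul]; ring

theorem pairing_neg (m v : ℤ × ℤ) : pairing (-m) v = -pairing m v := by
  simp only [pairing, Prod.fst_neg, Prod.snd_neg]; ring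

theorem mem_dualMonoid_pair {u v m : ℤ × ℤ} :
    m ∈ dualMonoid {u, v} ↔ 0 ≤ pairing m u ∧ 0 ≤ pairing m v := by
  change (∀ w ∈ ({u, v} : Finset (ℤ × ℤ)), _) ↔ _
  simp

/-- A character is determined by its values on two independent vectors. -/
theorem ext_of_pairing {u v : ℤ × ℤ} (h : det u v ≠ 0) {m m' : ℤ × ℤ}
    (hu : pairing m u = pairing m' u) (hv : pairing m v = pairing m' v) : m = m' := by
  simp only [pairing, det] at *
  have h1 : (m.1 - m'.1) * (u.1 * v.2 - u.2 * v.1) = 0 := by linear_combination v.2 * hu - u.2 * hv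
  have h2 : (m.2 - m'.2) * (u.1 * v.2 - u.2 * v.1) = 0 := by linear_combination u.1 * hv - v.1 * hu
  have h3 := (mul_eq_zero.mp h1).resolve_right h
  have h4 := (mul_eq_zero.mp h2).resolve_right h
  exact Prod.ext (by linarith) (by linarith)

/-- Characters with prescribed values on a basis of the lattice. -/
theorem exists_pairing_eq {u v : ℤ × ℤ} (h : det u v = 1 ∨ det u v = -1) (a b : ℤ) :
    ∃ m : ℤ × ℤ, pairing m u = a ∧ pairing m v = b := by
  refine ⟨det u v • (a * v.2 - b * u.2, b * u.1 - a * v.1), ?_⟩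
  rcases h with h | h <;> rw [h] <;> simp only [det] at h <;>
    simp only [pairing, Prod.smul_fst, Prod.smul_snd, smul_eq_mul] <;> constructor
  · linear_combination a * h
  · linear_combination b * h
  · linear_combination (-a) * h
  · linear_combination (-b) * h

section regular

variable (k : Type u) [Field k]

/-- The characters that are nonnegative on a basis of the lattice form a free monoid. -/
noncomputable def dualMonoidEquiv {u v : ℤ × ℤ} (h : det u v = 1) :
    dualMonoid {u, v} ≃+ (Fin 2 →₀ ℕ) :=
  AddEquiv.ofBijective
    ({ toFun := fun m => Finsupp.equivFunOnFinite.symm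
        ![(pairing m u).toNat, (pairing m v).toNat]
       map_zero' := by ext i; fin_cases i <;> simp [pairing]
       map_add' := by
        rintro ⟨m, hm⟩ ⟨m', hm'⟩
        rw [mem_dualMonoid_pair] at hm hm'
        ext i
        rw [Finsupp.add_apply]
        fin_cases i
        · simpa [pairing_add] using Int.toNat_add hm.1 hm'.1
        · simpa [pairing_add] using Int.toNat_add hm.2 hm'.2 } :
      dualMonoid {u, v} →+ (Fin 2 →₀ ℕ)) (by
    constructor
    · rintro ⟨m, hm⟩ ⟨m', hm'⟩ h1
      have hm0 := mem_dualMonoid_pair.mp hm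
      have hm1 := mem_dualMonoid_pair.mp hm'
      have h2 := DFunLike.congr_fun h1 0
      have h3 := DFunLike.congr_fun h1 1
      simp only [AddMonoidHom.coe_mk, ZeroHom.coe_mk, Finsupp.equivFunOnFinite_symm_apply_apply,
        Matrix.cons_val_zero, Matrix.cons_val_one] at h2 h3
      have e1 : pairing m u = pairing m' u := by omega
      have e2 : pairing m v = pairing m' v := by omega
      exact Subtype.ext (ext_of_pairing (u := u) (v := v) (by omega) e1 e2)
    · intro f
      obtain ⟨m, h1, h2⟩ := exists_pairing_eq (Or.inl h) (f 0) (f 1)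
      refine ⟨⟨m, mem_dualMonoid_pair.mpr (by omega)⟩, ?_⟩
      ext i
      fin_cases i
      · simp [h1]
      · simp [h2])

theorem isRegularRing_chartRing {u v : ℤ × ℤ} (h : det u v = 1) :
    IsRegularRing (ChartRing k {u, v}) :=
  IsRegularRing.of_ringEquiv (R := MvPolynomial (Fin 2) k)
    (AddMonoidAlgebra.domCongr k k (dualMonoidEquiv h).symm).toRingEquiv

/-- The chart of a face is an open subscheme of the chart of the smooth cone, which is the spectrum
of a polynomial ring. -/
theorem isRegularLocalRing_of_subset {u v : ℤ × ℤ} (h : det u v = 1) {c : Finset (ℤ × ℤ)}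
    (hc : c ⊆ {u, v}) (p : PrimeSpectrum (ChartRing k c)) :
    IsRegularLocalRing (Localization.AtPrime p.asIdeal) := by
  have hreg := isRegularRing_chartRing k h
  have hopen : IsOpenImmersion (chartIncl k hc) := by
    obtain ⟨m, hm⟩ : ∃ m : ℤ × ℤ, ∀ w ∈ ({u, v} : Finset (ℤ × ℤ)),
        0 ≤ pairing m w ∧ (pairing m w = 0 ↔ w ∈ c) := by
      obtain ⟨m, h1, h2⟩ := exists_pairing_eq (Or.inl h)
        (if u ∈ c then 0 else 1) (if v ∈ c then 0 else 1)
      refine ⟨m, fun w hw => ?_⟩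
      simp only [Finset.mem_insert, Finset.mem_singleton] at hw
      rcases hw with rfl | rfl
      · rw [h1]; split_ifs with h3 <;> simp [h3]
      · rw [h2]; split_ifs with h3 <;> simp [h3]
    exact isOpenImmersion_chartIncl k hc ⟨m, fun v hv => (hm v hv).1⟩ fun v hv => (hm v hv).2
  rw [← isRegularLocalRing_stalk_iff (chartIncl k hc) p]
  have := isRegularLocalRing_stalk_iff (𝟙 (chart k {u, v}))
    (show PrimeSpectrum (ChartRing k {u, v}) from chartIncl k hc p)
  exact this.mpr (hreg.isRegularLocalRing_localization
    (show PrimeSpectrum (ChartRing k {u, v}) from chartIncl k hc p).asIdeal)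

variable {k}

/-- Evaluation at the torus-fixed point of a chart. -/
noncomputable def originEval {c : Finset (ℤ × ℤ)} (h0 : ∀ m m' : dualMonoid c, m + m' = 0 → m = 0) :
    ChartRing k c →+* k where
  toFun a := a.coeff 0
  map_zero' := rfl
  map_one' := AddMonoidAlgebra.coeff_one_zero
  map_add' _ _ := rfl
  map_mul' a b := by
    rw [AddMonoidAlgebra.coeff_mul_antidiag a b 0 {(0, 0)}]
    · simp
    · rintro ⟨m, m'⟩
      simp only [Finset.mem_singleton, Prod.mk.injEq]
      constructor
      · rintro ⟨rfl, rfl⟩; simp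
      · intro h
        exact ⟨h0 _ _ h, h0 _ _ (by rw [add_comm]; exact h)⟩

theorem originEval_single_self {c : Finset (ℤ × ℤ)}
    (h0 : ∀ m m' : dualMonoid c, m + m' = 0 → m = 0) (m : dualMonoid c) (hm : m ≠ 0) (r : k) :
    originEval h0 (AddMonoidAlgebra.single m r) = 0 := by
  change (AddMonoidAlgebra.single m r).coeff 0 = 0
  simp [AddMonoidAlgebra.coeff_single, hm]

/-- The coefficients at the origin and at three irreducible characters. -/
noncomputable def jetEval {c : Finset (ℤ × ℤ)} (h0 : ∀ m m' : dualMonoid c, m + m' = 0 → m = 0)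
    (e : Fin 3 → dualMonoid c) (he0 : ∀ i, e i ≠ 0)
    (he : ∀ i m m', m + m' = e i → m = 0 ∨ m' = 0) :
    ChartRing k c →+* TrivSqZeroExt k (Fin 3 → k) where
  toFun a := TrivSqZeroExt.inl (originEval h0 a) + TrivSqZeroExt.inr (fun i => a.coeff (e i))
  map_zero' := by ext <;> simp
  map_one' := by
    ext i
    · simp
    · simp [AddMonoidAlgebra.one_def, AddMonoidAlgebra.coeff_single, (he0 i).symm]
  map_add' a b := by ext <;> simp
  map_mul' a b := by
    ext i
    · simp
    · have : (a * b).coeff (e i) = a.coeff 0 * b.coeff (e i) + a.coeff (e i) * b.coeff 0 := by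
        classical
        rw [AddMonoidAlgebra.coeff_mul_antidiag a b (e i) {(0, e i), (e i, 0)}]
        · rw [Finset.sum_pair]
          intro h
          exact he0 i (congrArg Prod.snd h)
        · rintro ⟨m, m'⟩
          simp only [Finset.mem_insert, Finset.mem_singleton, Prod.mk.injEq]
          constructor
          · rintro (⟨rfl, rfl⟩ | ⟨rfl, rfl⟩) <;> simp
          · intro h
            rcases he i m m' h with rfl | rfl
            · exact Or.inl ⟨rfl, by simpa using h⟩
            · exact Or.inr ⟨by simpa using h, rfl⟩
      have h1 : ∀ a : ChartRing k c, originEval h0 a = a.coeff 0 := fun _ => rfl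
      simp [this, h1, mul_comm]

/-- Two dimensions are compared. By `hgen` the two functions `e 0`, `e 1` cut out the fixed point
set-theoretically, so the Krull dimension is at most two. The coefficients at the three irreducible
characters are additive derivations at the origin; assembled into a ring map to `TrivSqZeroExt k
(Fin 3 → k)`, they show that the maximal ideal needs at least three generators. -/
theorem not_isRegularLocalRing_of_irreducible {c : Finset (ℤ × ℤ)}
    (h0 : ∀ m m' : dualMonoid c, m + m' = 0 → m = 0)
    (e : Fin 3 → dualMonoid c) (hinj : Function.Injective e) (he0 : ∀ i, e i ≠ 0)
    (he : ∀ i m m', m + m' = e i → m = 0 ∨ m' = 0)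
    (hgen : ∀ m : dualMonoid c, ∃ n a b : ℕ, (0 < a ∨ 0 < b ∨ m = 0) ∧ n • m = a • e 0 + b • e 1)
    (P : Ideal (ChartRing k c)) [P.IsPrime] (hP : P = RingHom.ker (originEval h0)) :
    ¬ IsRegularLocalRing (Localization.AtPrime P) := by
  intro hreg
  classical
  let L := Localization.AtPrime P
  have hmemP : ∀ a, a ∈ P ↔ a.coeff 0 = 0 := by
    intro a
    rw [hP, RingHom.mem_ker]
    rfl
  have hspanP : P ≤ Ideal.span (Set.range fun m : {m : dualMonoid c // m ≠ 0} =>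
      (AddMonoidAlgebra.single m.1 (1 : k) : ChartRing k c)) := by
    intro a ha
    rw [hmemP] at ha
    rw [← AddMonoidAlgebra.sum_coeff_single a]
    refine Ideal.sum_mem _ fun m hm => ?_
    have hm0 : m ≠ 0 := by
      rintro rfl
      exact (Finsupp.mem_support_iff.mp hm) ha
    have : (AddMonoidAlgebra.single m (a.coeff m) : ChartRing k c) =
        AddMonoidAlgebra.single 0 (a.coeff m) * AddMonoidAlgebra.single m 1 := by
      rw [AddMonoidAlgebra.single_mul_single]; simp
    rw [this]
    exact Ideal.mul_mem_left _ _ (Ideal.subset_span ⟨⟨m, hm0⟩, rfl⟩)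
  -- the Krull dimension is at most two
  let x : Fin 3 → L := fun i => algebraMap (ChartRing k c) L (AddMonoidAlgebra.single (e i) 1)
  have hxm : ∀ i, x i ∈ IsLocalRing.maximalIdeal L := by
    intro i
    rw [IsLocalization.AtPrime.to_map_mem_maximal_iff L P, hmemP]
    simp [AddMonoidAlgebra.coeff_single, he0 i]
  have hdim : ringKrullDim L ≤ 2 := by
    rw [← IsLocalRing.maximalIdeal_height_eq_ringKrullDim]
    -- A prime containing `x 0` and `x 1` contains every nontrivial monomial, because a power of the
    -- monomial is a product of powers of `x 0` and `x 1`.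
    have hmin : IsLocalRing.maximalIdeal L ∈
        (Ideal.span (({x 0, x 1} : Finset L) : Set L)).minimalPrimes := by
      refine ⟨⟨inferInstance, ?_⟩, ?_⟩
      · rw [Ideal.span_le]
        intro y hy
        simp only [Finset.coe_insert, Finset.coe_singleton, Set.mem_insert_iff,
          Set.mem_singleton_iff] at hy
        rcases hy with rfl | rfl <;> exact hxm _
      · rintro q ⟨hq, hle⟩ -
        rw [← IsLocalization.AtPrime.map_eq_maximalIdeal P L, Ideal.map_le_iff_le_comap]
        refine hspanP.trans ?_
        rw [Ideal.span_le]
        rintro _ ⟨⟨m, hm⟩, rfl⟩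
        obtain ⟨n, a, b, hab, hn⟩ := hgen m
        have hx0 : x 0 ∈ q := hle (Ideal.subset_span (by simp))
        have hx1 : x 1 ∈ q := hle (Ideal.subset_span (by simp))
        have hpow : (algebraMap (ChartRing k c) L (AddMonoidAlgebra.single m 1)) ^ n =
            x 0 ^ a * x 1 ^ b := by
          simp only [x, ← map_pow, ← map_mul, AddMonoidAlgebra.single_pow,
            AddMonoidAlgebra.single_mul_single, one_pow, mul_one, hn]
        refine hq.mem_of_pow_mem n ?_
        rw [hpow]
        rcases hab with h | h | h
        · exact Ideal.mul_mem_right _ _ (Ideal.pow_mem_of_mem q hx0 a h)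
        · exact Ideal.mul_mem_left _ _ (Ideal.pow_mem_of_mem q hx1 b h)
        · exact absurd h hm
    have := Ideal.height_le_card_of_mem_minimalPrimes_span_finset hmin
    have h2 : (({x 0, x 1} : Finset L).card : ℕ∞) ≤ 2 := by
      exact_mod_cast Finset.card_le_two
    exact WithBot.coe_le_coe.mpr (this.trans h2)
  have hrank : (IsLocalRing.maximalIdeal L).spanFinrank ≤ 2 := by
    have h := hreg.spanFinrank_maximalIdeal
    rw [← h] at hdim
    exact_mod_cast hdim
  -- the cotangent space has dimension at least three
  let Ψ : ChartRing k c →+* TrivSqZeroExt k (Fin 3 → k) := jetEval h0 e he0 he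
  have hunit : ∀ y : P.primeCompl, IsUnit (Ψ y) := by
    intro y
    rw [TrivSqZeroExt.isUnit_iff_isUnit_fst]
    have h1 : (Ψ y).fst = (y : ChartRing k c).coeff 0 := by
      simp only [Ψ, jetEval, RingHom.coe_mk, MonoidHom.coe_mk, OneHom.coe_mk,
        TrivSqZeroExt.fst_add, TrivSqZeroExt.fst_inl, TrivSqZeroExt.fst_inr, add_zero]
      rfl
    rw [h1, isUnit_iff_ne_zero]
    exact fun h => y.2 ((hmemP _).mpr h)
  -- Elements outside `P` have a nonzero constant term, so their jets are units and the jet map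
  -- extends to the local ring.
  let Φ : L →+* TrivSqZeroExt k (Fin 3 → k) := IsLocalization.lift hunit
  have hΦ : ∀ a, Φ (algebraMap _ L a) = Ψ a := fun a => IsLocalization.lift_eq hunit a
  have hfst : ∀ y ∈ IsLocalRing.maximalIdeal L, (Φ y).fst = 0 := by
    intro y hy
    by_contra h
    have h1 : IsUnit (Φ y) := (TrivSqZeroExt.isUnit_iff_isUnit_fst).mpr (isUnit_iff_ne_zero.mpr h)
    obtain ⟨⟨a, s⟩, has⟩ := IsLocalization.surj P.primeCompl y
    have ha : a ∈ P := by
      rw [← IsLocalization.AtPrime.to_map_mem_maximal_iff L P, ← has]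
      exact Ideal.mul_mem_right _ _ hy
    have h2 := congrArg Φ has
    rw [map_mul, hΦ, hΦ] at h2
    have h3 : IsUnit (Ψ a) := h2 ▸ h1.mul (hunit s)
    rw [TrivSqZeroExt.isUnit_iff_isUnit_fst, isUnit_iff_ne_zero] at h3
    apply h3
    simp only [Ψ, jetEval, RingHom.coe_mk, MonoidHom.coe_mk, OneHom.coe_mk,
        TrivSqZeroExt.fst_add, TrivSqZeroExt.fst_inl, TrivSqZeroExt.fst_inr, add_zero]
    exact (hmemP a).mp ha
  obtain ⟨T, hTcard, hTspan⟩ := Submodule.FG.exists_span_finset_card_eq_spanFinrank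
    (IsNoetherian.noetherian (IsLocalRing.maximalIdeal L))
  -- On the maximal ideal the constant term vanishes, so multiplying by an element of `L` only
  -- rescales the linear part; generators of the ideal therefore give `k`-generators of the linear
  -- parts.
  have hsnd : ∀ y ∈ IsLocalRing.maximalIdeal L,
      (Φ y).snd ∈ Submodule.span k ((T.image fun t => (Φ t).snd : Finset (Fin 3 → k)) :
        Set (Fin 3 → k)) := by
    intro y hy
    rw [← hTspan] at hy
    have hTmax : ∀ t ∈ T, t ∈ IsLocalRing.maximalIdeal L := fun t ht => by
      rw [← hTspan]; exact Submodule.subset_span ht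
    induction hy using Submodule.span_induction with
    | mem t ht => exact Submodule.subset_span (by simpa using ⟨t, ht, rfl⟩)
    | zero => simp
    | add a b _ _ ha hb => rw [map_add, TrivSqZeroExt.snd_add]; exact add_mem ha hb
    | smul l a ha' ha =>
      have h1 : (Φ a).fst = 0 := hfst a (by rw [← hTspan]; exact ha')
      rw [smul_eq_mul, map_mul, TrivSqZeroExt.snd_mul, h1]
      simpa using Submodule.smul_mem _ _ ha
  have hbasis : ∀ i, (Φ (x i)).snd = Pi.single i 1 := by
    intro i
    rw [hΦ]
    ext l
    simp only [Ψ, jetEval, RingHom.coe_mk, MonoidHom.coe_mk, OneHom.coe_mk,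
        TrivSqZeroExt.snd_add, TrivSqZeroExt.snd_inl, TrivSqZeroExt.snd_inr, zero_add,
        AddMonoidAlgebra.coeff_single, Finsupp.single_apply, hinj.eq_iff, Pi.single_apply]
    simp [eq_comm]
  have htop : Submodule.span k ((T.image fun t => (Φ t).snd : Finset (Fin 3 → k)) :
        Set (Fin 3 → k)) = ⊤ := by
    rw [eq_top_iff, ← (Pi.basisFun k (Fin 3)).span_eq, Submodule.span_le]
    rintro _ ⟨i, rfl⟩
    rw [Pi.basisFun_apply, ← hbasis]
    exact hsnd _ (hxm i)
  have h3 := finrank_span_finset_le_card (R := k) (T.image fun t => (Φ t).snd)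
  rw [Set.finrank, htop, finrank_top, Module.finrank_fin_fun] at h3
  have h4 := Finset.card_image_le (s := T) (f := fun t => (Φ t).snd)
  omega

end regular
end ToricSurface

/-! ### The fixed point of a cone that is not smooth -/

namespace ToricSurface

theorem dualMonoid_pair_zero {u v : ℤ × ℤ} (h : det u v ≠ 0) (m m' : dualMonoid {u, v})
    (hm : m + m' = 0) : m = 0 := by
  obtain ⟨m, h1⟩ := m
  obtain ⟨m', h2⟩ := m'
  rw [mem_dualMonoid_pair] at h1 h2
  have h3 : m + m' = 0 := congrArg Subtype.val hm
  have hu : pairing m u + pairing m' u = 0 := by rw [← pairing_add, h3]; simp [pairing]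
  have hv : pairing m v + pairing m' v = 0 := by rw [← pairing_add, h3]; simp [pairing]
  have e1 : pairing m u = pairing 0 u := by
    have : pairing 0 u = 0 := by simp [pairing]
    omega
  have e2 : pairing m v = pairing 0 v := by
    have : pairing 0 v = 0 := by simp [pairing]
    omega
  exact Subtype.ext (ext_of_pairing h e1 e2)

/-- The characters that vanish on a primitive vector. -/
theorem exists_smul_of_pairing_eq_zero {u m : ℤ × ℤ} (hu : Int.gcd u.1 u.2 = 1)
    (h : pairing m u = 0) : ∃ t : ℤ, m = t • (-u.2, u.1) := by
  have hb := Int.gcd_eq_gcd_ab u.1 u.2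
  rw [hu] at hb
  simp only [pairing] at h
  refine ⟨m.2 * Int.gcdA u.1 u.2 - m.1 * Int.gcdB u.1 u.2, ?_⟩
  push_cast at hb
  ext
  · simp only [Prod.smul_fst, smul_eq_mul]
    linear_combination m.1 * hb + Int.gcdA u.1 u.2 * h
  · simp only [Prod.smul_snd, smul_eq_mul]
    linear_combination m.2 * hb + Int.gcdB u.1 u.2 * h

/-- The torus-fixed point of the chart of a two-dimensional cone. -/
noncomputable def fixedPoint (k : Type u) [Field k] {u v : ℤ × ℤ} (h : det u v ≠ 0) :
    PrimeSpectrum (ChartRing k {u, v}) :=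
  ⟨RingHom.ker (originEval (k := k) (dualMonoid_pair_zero h)), RingHom.ker_isPrime _⟩

/-- The three irreducible characters are the primitive generators `e₁`, `e₂` of the two edges of the
dual cone and a character `w` in its interior with value `1` on `u` and value below `d` on `v`. Such
a `w` exists exactly because `d ≥ 2`. -/
theorem not_isRegularLocalRing_fixedPoint (k : Type u) [Field k] {u v : ℤ × ℤ}
    (hu : Int.gcd u.1 u.2 = 1) (hv : Int.gcd v.1 v.2 = 1) (h : 2 ≤ det u v) (h' : det u v ≠ 0) :
    ¬ IsRegularLocalRing (Localization.AtPrime (fixedPoint k h').asIdeal) := by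
  set d := det u v with hd
  have hb := Int.gcd_eq_gcd_ab u.1 u.2
  rw [hu] at hb
  push_cast at hb
  have huv : d = u.1 * v.2 - u.2 * v.1 := rfl
  let m₀ : ℤ × ℤ := (Int.gcdA u.1 u.2, Int.gcdB u.1 u.2)
  have hm₀ : pairing m₀ u = 1 := by simp only [pairing, m₀]; linarith
  let e₁ : ℤ × ℤ := (-u.2, u.1)
  let e₂ : ℤ × ℤ := (v.2, -v.1)
  have e₁u : pairing e₁ u = 0 := by simp only [pairing, e₁]; ring
  have e₁v : pairing e₁ v = d := by simp only [pairing, e₁, huv]; ring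
  have e₂u : pairing e₂ u = d := by simp only [pairing, e₂, huv]; ring
  have e₂v : pairing e₂ v = 0 := by simp only [pairing, e₂]; ring
  -- Adding multiples of `e₁` does not change the value on `u` and changes the value on `v` by
  -- multiples of `d`; this one reduces the latter modulo `d`.
  let w : ℤ × ℤ := m₀ + (-(pairing m₀ v / d)) • e₁
  have wu : pairing w u = 1 := by
    simp only [w]; rw [pairing_add, pairing_smul, hm₀, e₁u]; ring
  have wv : pairing w v = pairing m₀ v % d := by
    simp only [w]; rw [pairing_add, pairing_smul, e₁v, Int.emod_def]; ring
  have wv0 : 0 ≤ pairing w v := by rw [wv]; exact Int.emod_nonneg _ h'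
  have wvd : pairing w v < d := by rw [wv]; exact Int.emod_lt_of_pos _ (by omega)
  have hzero_u : ∀ m : ℤ × ℤ, pairing m u = 0 → ∃ t : ℤ, m = t • e₁ :=
    fun m hm => exists_smul_of_pairing_eq_zero hu hm
  have hzero_v : ∀ m : ℤ × ℤ, pairing m v = 0 → ∃ t : ℤ, m = t • e₂ := by
    intro m hm
    obtain ⟨t, ht⟩ := exists_smul_of_pairing_eq_zero hv hm
    refine ⟨-t, ?_⟩
    rw [ht]
    ext <;> simp [e₂]
  -- Otherwise `w` is a multiple of `e₂`, and `d` divides `pairing w u = 1`.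
  have wvne : pairing w v ≠ 0 := by
    intro h0
    obtain ⟨t, ht⟩ := hzero_v w h0
    rw [ht, pairing_smul, e₂u] at wu
    have h3 := Int.eq_one_or_neg_one_of_mul_eq_one' wu
    omega
  have M₁ : e₁ ∈ dualMonoid {u, v} := mem_dualMonoid_pair.mpr (by omega)
  have M₂ : e₂ ∈ dualMonoid {u, v} := mem_dualMonoid_pair.mpr (by omega)
  have M₃ : w ∈ dualMonoid {u, v} := mem_dualMonoid_pair.mpr (by omega)
  -- a nonnegative character that is zero on `u` or `v` and small is zero
  have small_u : ∀ m ∈ dualMonoid {u, v}, pairing m u = 0 → pairing m v < d → m = 0 := by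
    intro m hm h1 h2
    obtain ⟨t, rfl⟩ := hzero_u m h1
    rw [mem_dualMonoid_pair, pairing_smul, pairing_smul, e₁v] at hm
    rw [pairing_smul, e₁v] at h2
    have : t = 0 := by
      have h3 : t < 1 := by
        by_contra! h4
        nlinarith
      have h4 : 0 ≤ t := by
        by_contra! h4
        nlinarith
      omega
    rw [this, zero_smul]
  have small_v : ∀ m ∈ dualMonoid {u, v}, pairing m v = 0 → pairing m u < d → m = 0 := by
    intro m hm h1 h2
    obtain ⟨t, rfl⟩ := hzero_v m h1
    rw [mem_dualMonoid_pair, pairing_smul, pairing_smul, e₂u] at hm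
    rw [pairing_smul, e₂u] at h2
    have : t = 0 := by
      have h3 : t < 1 := by
        by_contra! h4
        nlinarith
      have h4 : 0 ≤ t := by
        by_contra! h4
        nlinarith
      omega
    rw [this, zero_smul]
  let e : Fin 3 → dualMonoid {u, v} := ![⟨e₁, M₁⟩, ⟨e₂, M₂⟩, ⟨w, M₃⟩]
  -- In a decomposition one summand vanishes on `u` (or on `v`) and takes a value below `d` on the
  -- other vector, so it is zero by `small_u` or `small_v`. For `w` this holds since the values on
  -- `u` add up to `1`.
  have hirr : ∀ i m m', m + m' = e i → m = 0 ∨ m' = 0 := by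
    rintro i ⟨m, hm⟩ ⟨m', hm'⟩ hmm
    have h1 : m + m' = (e i : ℤ × ℤ) := congrArg Subtype.val hmm
    have hu' : pairing m u + pairing m' u = pairing (e i : ℤ × ℤ) u := by rw [← pairing_add, h1]
    have hv' : pairing m v + pairing m' v = pairing (e i : ℤ × ℤ) v := by rw [← pairing_add, h1]
    have hmn := mem_dualMonoid_pair.mp hm
    have hmn' := mem_dualMonoid_pair.mp hm'
    suffices H : m = 0 ∨ m' = 0 from H.imp (fun h => Subtype.ext h) (fun h => Subtype.ext h)
    fin_cases i
    · change _ = pairing e₁ u at hu'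
      change _ = pairing e₁ v at hv'
      by_cases h2 : pairing m v < d
      · exact Or.inl (small_u m hm (by omega) h2)
      · exact Or.inr (small_u m' hm' (by omega) (by omega))
    · change _ = pairing e₂ u at hu'
      change _ = pairing e₂ v at hv'
      by_cases h2 : pairing m u < d
      · exact Or.inl (small_v m hm (by omega) h2)
      · exact Or.inr (small_v m' hm' (by omega) (by omega))
    · change _ = pairing w u at hu'
      change _ = pairing w v at hv'
      by_cases h2 : pairing m u = 0
      · exact Or.inl (small_u m hm h2 (by omega))
      · exact Or.inr (small_u m' hm' (by omega) (by omega))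
  have hzu : pairing 0 u = 0 := by simp [pairing]
  have hzv : pairing 0 v = 0 := by simp [pairing]
  refine not_isRegularLocalRing_of_irreducible (dualMonoid_pair_zero h') e ?_ ?_ hirr ?_ _ rfl
  · have hne : ∀ a b (ha : a ∈ dualMonoid {u, v}) (hb : b ∈ dualMonoid {u, v}),
        (⟨a, ha⟩ : dualMonoid {u, v}) = ⟨b, hb⟩ → pairing a u = pairing b u ∧
          pairing a v = pairing b v := by
      intro a b ha hb hab
      have := congrArg Subtype.val hab
      simp only at this
      rw [this]
      exact ⟨rfl, rfl⟩
    intro i j hij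
    fin_cases i <;> fin_cases j <;> first | rfl | (have := hne _ _ _ _ hij; exfalso; omega)
  · intro i hi
    have hval : (e i : ℤ × ℤ) = 0 := congrArg Subtype.val hi
    fin_cases i
    · have h2 : e₁ = 0 := hval
      rw [h2] at e₁v; omega
    · have h2 : e₂ = 0 := hval
      rw [h2] at e₂u; omega
    · have h2 : w = 0 := hval
      rw [h2] at wu; omega
  · rintro ⟨m, hm⟩
    have hmn := mem_dualMonoid_pair.mp hm
    -- The relation is `d m = (pairing m v) e₁ + (pairing m u) e₂`, Cramer's rule for the basis dual
    -- to `u, v`.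
    refine ⟨d.toNat, (pairing m v).toNat, (pairing m u).toNat, ?_, ?_⟩
    · by_cases h1 : pairing m u = 0
      · by_cases h2 : pairing m v < d
        · exact Or.inr (Or.inr (Subtype.ext (small_u m hm h1 h2)))
        · left; omega
      · right; left; omega
    · refine Subtype.ext (ext_of_pairing h' ?_ ?_)
      all_goals
        simp only [AddSubmonoid.coe_add, AddSubmonoidClass.coe_nsmul, ← natCast_zsmul, pairing_add,
          pairing_smul]
        rw [Int.toNat_of_nonneg (by omega), Int.toNat_of_nonneg hmn.1, Int.toNat_of_nonneg hmn.2]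
      · change d * _ = _ * pairing e₁ u + _ * pairing e₂ u
        rw [e₁u, e₂u]; ring
      · change d * _ = _ * pairing e₁ v + _ * pairing e₂ v
        rw [e₁v, e₂v]; ring

end ToricSurface

/-! ### Orbit strata and the singular locus -/

namespace ToricSurface

/-- The cone spanned by two adjacent rays. -/
def CompleteFan.Adj.cone {F : CompleteFan} {u v : ℤ × ℤ} (h : F.Adj u v) : F.Cone :=
  ⟨{u, v}, Or.inr (Or.inr ⟨u, v, h, rfl⟩)⟩

theorem CompleteFan.Adj.det_ne_zero {F : CompleteFan} {u v : ℤ × ℤ} (h : F.Adj u v) :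
    det u v ≠ 0 := h.2.2.1.ne'

/-- A primitive vector belongs to a basis of the lattice. -/
theorem exists_det_eq_one {v : ℤ × ℤ} (hv : Int.gcd v.1 v.2 = 1) : ∃ w, det v w = 1 := by
  have hb := Int.gcd_eq_gcd_ab v.1 v.2
  rw [hv] at hb
  push_cast at hb
  exact ⟨(-Int.gcdB v.1 v.2, Int.gcdA v.1 v.2), by simp only [det]; linarith⟩

namespace Atlas

variable {k : Type u} [Field k] {F : CompleteFan} {X : Scheme.{u}} (A : Atlas k F X)

/-- Every point lies in the open orbit stratum of a chart: the characters that are not invertible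
on the chart vanish at the point. -/
theorem exists_minimal_chart (x : X) : ∃ (c : F.Cone) (y : PrimeSpectrum (ChartRing k c.1)),
    A.map c y = x ∧ ∀ m : dualMonoid c.1, (∃ v ∈ c.1, pairing m v ≠ 0) →
      (AddMonoidAlgebra.single m 1 : ChartRing k c.1) ∈ y.asIdeal := by
  -- A cone with the fewest rays is chosen: a character that is not zero at the point would place
  -- the point in the chart of the face it cuts out.
  have hex : ∃ n : ℕ, ∃ (c : F.Cone) (y : chart k c.1), A.map c y = x ∧ c.1.card = n := by
    obtain ⟨c, y, h⟩ := A.surjective x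
    exact ⟨_, c, y, h, rfl⟩
  classical
  obtain ⟨c, y, hy, hc⟩ := Nat.find_spec hex
  refine ⟨c, y, hy, ?_⟩
  rintro m ⟨v, hv, hmv⟩
  by_contra hm
  let e : Finset (ℤ × ℤ) := c.1.filter fun v => pairing m v = 0
  have hec : e ⊆ c.1 := Finset.filter_subset _ _
  let e' : F.Cone := ⟨e, CompleteFan.isCone_subset c.2 hec⟩
  have hr := range_chartIncl k hec m (fun w hw => by simp [e, hw])
  have hyr : y ∈ Set.range (chartIncl k hec) := by
    rw [hr]
    exact hm
  obtain ⟨z, rfl⟩ := hyr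
  have hlt : e.card < Nat.find hex := by
    rw [← hc]
    refine Finset.card_lt_card ⟨hec, fun h => ?_⟩
    have := h hv
    simp only [e, Finset.mem_filter] at this
    exact hmv this.2
  refine Nat.find_min hex hlt ⟨e', z, ?_, rfl⟩
  rw [← hy]
  exact (A.map_incl e' c hec z).symm

/-- The nontrivial characters generate the ideal of the fixed point, which is maximal. -/
theorem eq_fixedPoint {u v : ℤ × ℤ} (h : det u v ≠ 0)
    (y : PrimeSpectrum (ChartRing k {u, v}))
    (hy : ∀ m : dualMonoid {u, v}, m ≠ 0 →
      (AddMonoidAlgebra.single m 1 : ChartRing k {u, v}) ∈ y.asIdeal) : y = fixedPoint k h := by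
  have hle : (fixedPoint k h).asIdeal ≤ y.asIdeal := by
    intro a ha
    have ha0 : a.coeff 0 = 0 := ha
    rw [← AddMonoidAlgebra.sum_coeff_single a]
    refine Ideal.sum_mem _ fun m hm => ?_
    have hm0 : m ≠ 0 := by
      rintro rfl
      exact (Finsupp.mem_support_iff.mp hm) ha0
    have : (AddMonoidAlgebra.single m (a.coeff m) : ChartRing k {u, v}) =
        AddMonoidAlgebra.single 0 (a.coeff m) * AddMonoidAlgebra.single m 1 := by
      rw [AddMonoidAlgebra.single_mul_single]; simp
    rw [this]
    exact Ideal.mul_mem_left _ _ (hy m hm0)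
  have hmax : (fixedPoint k h).asIdeal.IsMaximal := by
    refine RingHom.ker_isMaximal_of_surjective _ fun r => ⟨AddMonoidAlgebra.single 0 r, ?_⟩
    change (AddMonoidAlgebra.single 0 r : ChartRing k {u, v}).coeff 0 = r
    simp [AddMonoidAlgebra.coeff_single]
  exact PrimeSpectrum.ext (hmax.eq_of_le y.isPrime.ne_top hle).symm

theorem pairing_ne_zero_of_ne_zero {u v : ℤ × ℤ} (h : det u v ≠ 0) {m : ℤ × ℤ} (hm : m ≠ 0) :
    ∃ w ∈ ({u, v} : Finset (ℤ × ℤ)), pairing m w ≠ 0 := by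
  by_contra! hc
  refine hm (ext_of_pairing h (m' := 0) ?_ ?_)
  · rw [hc u (by simp)]; simp [pairing]
  · rw [hc v (by simp)]; simp [pairing]

/-- A cone containing, as a subset, the image of the fixed point of a cone contains that cone. -/
theorem subset_of_chartIncl_eq_fixedPoint {u v : ℤ × ℤ} (huv : F.Adj u v) {e : Finset (ℤ × ℤ)}
    (he : e ⊆ {u, v}) (z : chart k e)
    (hz : chartIncl k he z = (fixedPoint k huv.det_ne_zero : PrimeSpectrum _)) : {u, v} ⊆ e := by
  obtain ⟨m, hm⟩ := CompleteFan.exists_character huv.cone.2 he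
  by_contra hne
  obtain ⟨w, hw, hwe⟩ := Finset.not_subset.mp hne
  let m' : dualMonoid {u, v} := ⟨m, fun v hv => (hm v hv).1⟩
  have hr := range_chartIncl k he m' (fun w hw => (hm w hw).2)
  have hmem : chartIncl k he z ∈ Set.range (chartIncl k he) := ⟨z, rfl⟩
  rw [hr, hz] at hmem
  refine hmem ?_
  have hm0 : m' ≠ 0 := by
    intro h0
    have h1 : m = 0 := congrArg Subtype.val h0
    refine hwe ((hm w hw).2.mp ?_)
    rw [h1]; simp [pairing]
  exact originEval_single_self _ m' hm0 1

/-- The singular points of a toric surface are the fixed points of the cones that are not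
generated by a basis of the lattice. -/
theorem encard_singularLocus (A : Atlas k F X) : (singularLocus X).encard =
    {p : (ℤ × ℤ) × (ℤ × ℤ) | F.Adj p.1 p.2 ∧ det p.1 p.2 ≠ 1}.encard := by
  classical
  let B : Set ((ℤ × ℤ) × (ℤ × ℤ)) := {p | F.Adj p.1 p.2 ∧ det p.1 p.2 ≠ 1}
  let g : B → X := fun p => A.map p.2.1.cone (fixedPoint k p.2.1.det_ne_zero : PrimeSpectrum _)
  have hrange : singularLocus X = Set.range g := by
    ext x
    constructor
    · intro hx
      obtain ⟨c, y, rfl, hy⟩ := A.exists_minimal_chart x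
      have hx' : ¬ IsRegularLocalRing (Localization.AtPrime y.asIdeal) := fun h =>
        hx ((isRegularLocalRing_stalk_iff (A.map c) y).mpr h)
      obtain ⟨c, hc⟩ := c
      -- The cones of dimension zero and one are faces of smooth two-dimensional cones, which need
      -- not belong to the fan, so only two-dimensional cones contribute.
      rcases hc with rfl | ⟨v, hv, rfl⟩ | ⟨u, v, huv, rfl⟩
      · exact absurd (isRegularLocalRing_of_subset k (u := (1, 0)) (v := (0, 1)) (by simp [det])
          (Finset.empty_subset _) y) hx'
      · obtain ⟨w, hw⟩ := exists_det_eq_one (F.primitive v hv)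
        exact absurd (isRegularLocalRing_of_subset k hw (by simp) y) hx'
      · have hd : det u v ≠ 1 := fun hd =>
          hx' (isRegularLocalRing_of_subset k hd (Finset.Subset.refl _) y)
        refine ⟨⟨(u, v), huv, hd⟩, ?_⟩
        have := eq_fixedPoint huv.det_ne_zero y fun m hm => hy m
          (pairing_ne_zero_of_ne_zero huv.det_ne_zero fun h => hm (Subtype.ext h))
        rw [this]
        rfl
    · rintro ⟨⟨⟨u, v⟩, huv, hd⟩, rfl⟩
      intro hreg
      refine not_isRegularLocalRing_fixedPoint k (F.primitive u huv.1) (F.primitive v huv.2.1) ?_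
        huv.det_ne_zero ((isRegularLocalRing_stalk_iff (A.map huv.cone) _).mp hreg)
      have hp : 0 < det u v := huv.2.2.1
      have hd' : det u v ≠ 1 := hd
      change 2 ≤ det u v
      omega
  have hinj : Function.Injective g := by
    rintro ⟨⟨u, v⟩, huv, hd⟩ ⟨⟨u', v'⟩, huv', hd'⟩ h
    obtain ⟨e, h1, h2, z, hz1, hz2⟩ := A.inter _ _ _ _ h
    have e1 := subset_of_chartIncl_eq_fixedPoint huv h1 z hz1
    have e2 := subset_of_chartIncl_eq_fixedPoint huv' h2 z hz2
    have e3 : ({u, v} : Finset (ℤ × ℤ)) = {u', v'} :=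
      (Finset.Subset.antisymm e1 h1).trans (Finset.Subset.antisymm e2 h2).symm
    have hu : u = u' ∨ u = v' := by
      have : u ∈ ({u', v'} : Finset (ℤ × ℤ)) := e3 ▸ by simp
      simpa using this
    have hv : v = u' ∨ v = v' := by
      have : v ∈ ({u', v'} : Finset (ℤ × ℤ)) := e3 ▸ by simp
      simpa using this
    have p1 : 0 < det u v := huv.2.2.1
    have p2 : 0 < det u' v' := huv'.2.2.1
    simp only [Subtype.mk.injEq, Prod.mk.injEq]
    simp only [det] at p1 p2
    rcases hu with rfl | rfl <;> rcases hv with rfl | rfl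
    · exfalso; linarith
    · exact ⟨rfl, rfl⟩
    · exfalso; linarith
    · exfalso; linarith
  rw [hrange, ← Set.image_univ, hinj.injOn.encard_image, Set.encard_univ]
  rfl

end Atlas
end ToricSurface

namespace ToricSurface

/-! ### Local equations over unique factorization domains -/

/-- A principal divisor can be recovered from local equations on a finite cover of the spectrum of
a unique factorization domain by basic open sets. -/
theorem exists_global_equation {R : Type u} [CommRing R] [IsDomain R]
    [UniqueFactorizationMonoid R] {ι : Type*} [Fintype ι] (g : ι → R) (a : ι → R)
    (ha : ∀ i, a i ≠ 0)
    (hag : ∀ (q : Ideal R), q.IsPrime → ∀ i j, g i ∉ q → g j ∉ q →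
      ∃ s t, s ∉ q ∧ t ∉ q ∧ s * a i = t * a j) :
    ∃ f : R, f ≠ 0 ∧ ∀ (q : Ideal R), q.IsPrime → ∀ i, g i ∉ q →
      ∃ s t, s ∉ q ∧ t ∉ q ∧ s * f = t * a i := by
  classical
  -- The induction is on the product of the local equations with respect to strict divisibility.
  suffices H : ∀ P : R, ∀ a : ι → R, (∀ i, a i ≠ 0) → ∏ i, a i = P →
      (∀ (q : Ideal R), q.IsPrime → ∀ i j, g i ∉ q → g j ∉ q →
        ∃ s t, s ∉ q ∧ t ∉ q ∧ s * a i = t * a j) →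
      ∃ f : R, f ≠ 0 ∧ ∀ (q : Ideal R), q.IsPrime → ∀ i, g i ∉ q →
        ∃ s t, s ∉ q ∧ t ∉ q ∧ s * f = t * a i from H _ a ha rfl hag
  clear hag ha a
  intro P
  induction P using (IsWellFounded.wf (r := DvdNotUnit (α := R))).induction with
  | _ P ih =>
  intro a ha hP hag
  by_cases hex : ∃ i₀ p, Prime p ∧ p ∣ a i₀ ∧ ¬ p ∣ g i₀
  · obtain ⟨i₀, p, hp, hpa, hpg⟩ := hex
    have hspan : ∀ x, x ∈ Ideal.span {p} ↔ p ∣ x := fun x => Ideal.mem_span_singleton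
    have hpp : (Ideal.span {p}).IsPrime := (Ideal.span_singleton_prime hp.ne_zero).mpr hp
    have hclaim : ∀ j, ¬ p ∣ a j → p ∣ g j := by
      intro j hj
      by_contra hg
      obtain ⟨s, t, hs, ht, hst⟩ := hag _ hpp i₀ j (by rwa [hspan]) (by rwa [hspan])
      rw [hspan] at hs ht
      have : p ∣ t * a j := hst ▸ hpa.mul_left s
      exact (hp.dvd_or_dvd this).elim ht hj
    -- The prime is removed from exactly those equations that it divides. On the other open sets it
    -- is a unit, so the compatibility is kept, and `p` is put back into `f` at the end.
    let d : ι → R := fun i => if p ∣ a i then p else 1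
    have hd : ∀ i, ∃ b, a i = b * d i := by
      intro i
      by_cases h : p ∣ a i
      · obtain ⟨b, hb⟩ := h
        refine ⟨b, ?_⟩
        simp only [d]
        rw [if_pos ⟨b, hb⟩, hb, mul_comm]
      · exact ⟨a i, by simp [d, h]⟩
    choose b hb using hd
    have hb0 : ∀ i, b i ≠ 0 := by
      intro i h
      have := hb i
      rw [h, zero_mul] at this
      exact ha i this
    have hdq : ∀ (q : Ideal R), q.IsPrime → ∀ i, g i ∉ q → ¬ p ∣ a i → p ∉ q := fun q _ i hi h hpq =>
      hi (q.mem_of_dvd (hclaim i h) hpq)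
    obtain ⟨f, hf0, hf⟩ := ih (∏ i, b i) ⟨Finset.prod_ne_zero_iff.mpr fun i _ => hb0 i, ∏ i, d i, by
        intro hu
        have h1 : p ∣ ∏ i, d i := by
          refine dvd_trans ?_ (Finset.dvd_prod_of_mem d (Finset.mem_univ i₀))
          simp [d, hpa]
        exact hp.not_isUnit (isUnit_of_dvd_unit h1 hu), by
        rw [← hP, ← Finset.prod_mul_distrib]
        exact Finset.prod_congr rfl fun i _ => hb i⟩ b hb0 rfl (by
      intro q hq i j hi hj
      obtain ⟨s, t, hs, ht, hst⟩ := hag q hq i j hi hj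
      rw [hb i, hb j] at hst
      by_cases h1 : p ∣ a i <;> by_cases h2 : p ∣ a j
      · simp only [d, h1, h2, if_true] at hst
        exact ⟨s, t, hs, ht, mul_right_cancel₀ hp.ne_zero (by linear_combination hst)⟩
      · simp only [d, h1, h2, if_true, if_false] at hst
        exact ⟨s * p, t, fun h => (hq.mem_or_mem h).elim hs (hdq q hq j hj h2), ht,
          by linear_combination hst⟩
      · simp only [d, h1, h2, if_true, if_false] at hst
        exact ⟨s, t * p, hs, fun h => (hq.mem_or_mem h).elim ht (hdq q hq i hi h1),
          by linear_combination hst⟩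
      · simp only [d, h1, h2, if_false, mul_one] at hst
        exact ⟨s, t, hs, ht, hst⟩)
    refine ⟨p * f, mul_ne_zero hp.ne_zero hf0, fun q hq i hi => ?_⟩
    obtain ⟨s, t, hs, ht, hst⟩ := hf q hq i hi
    by_cases h1 : p ∣ a i
    · refine ⟨s, t, hs, ht, ?_⟩
      rw [hb i]
      simp only [d, h1, if_true]
      linear_combination p * hst
    · refine ⟨s, p * t, hs, fun h => (hq.mem_or_mem h).elim (hdq q hq i hi h1) ht, ?_⟩
      rw [hb i]
      simp only [d, h1, if_false]
      linear_combination p * hst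
  · push Not at hex
    -- Here every prime factor of `a i` divides `g i`, so each `a i` is a unit on its open set and
    -- the divisor is trivial.
    refine ⟨1, one_ne_zero, fun q hq i hi => ⟨a i, 1, ?_, q.ne_top_iff_one.mp hq.ne_top, by ring⟩⟩
    intro haq
    obtain ⟨p, hpq, hp, hpa⟩ : ∃ p ∈ q, Prime p ∧ p ∣ a i := by
      have h1 := UniqueFactorizationMonoid.factors_prod (ha i)
      have h2 : (UniqueFactorizationMonoid.factors (a i)).prod ∈ q :=
        q.mem_of_dvd h1.symm.dvd haq
      obtain ⟨p, hp, hpq⟩ := (hq.multiset_prod_mem_iff_exists_mem _).mp h2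
      exact ⟨p, hpq, UniqueFactorizationMonoid.prime_of_factor p hp,
        UniqueFactorizationMonoid.dvd_of_mem_factors hp⟩
    exact hi (q.mem_of_dvd (hex i p hp hpa) hpq)

/-- A fraction that is defined at all points of a basic open set has a power of the equation of its
complement as a denominator. -/
theorem exists_pow_denominator {R K : Type*} [CommRing R] [Field K] (κ : R →+* K) (f : K) (g : R)
    (h : ∀ q : Ideal R, q.IsPrime → g ∉ q → ∃ a b, b ∉ q ∧ f * κ b = κ a) :
    ∃ (n : ℕ) (a : R), f * κ (g ^ n) = κ a := by
  -- This is the ideal of denominators of `f`. Every prime containing it contains `g`, so `g` lies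
  -- in its radical.
  let I : Ideal R :=
    { carrier := {r | ∃ a, f * κ r = κ a}
      zero_mem' := ⟨0, by simp⟩
      add_mem' := by
        rintro r r' ⟨a, ha⟩ ⟨a', ha'⟩
        exact ⟨a + a', by rw [map_add, map_add, mul_add, ha, ha']⟩
      smul_mem' := by
        rintro s r ⟨a, ha⟩
        exact ⟨s * a, by rw [smul_eq_mul, map_mul, map_mul, ← ha]; ring⟩ }
  have : g ∈ I.radical := by
    rw [Ideal.radical_eq_sInf, Ideal.mem_sInf]
    rintro q ⟨hIq, hq⟩
    by_contra hg
    obtain ⟨a, b, hb, hab⟩ := h q hq hg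
    exact hb (hIq ⟨a, hab⟩)
  exact this

/-! ### Weights on the coordinate ring of the torus -/

section weights

variable {k : Type u} [Field k]

/-- The coordinate ring of the torus has unique factorization. -/
instance uniqueFactorizationMonoid_torus : UniqueFactorizationMonoid (ChartRing k ∅) := by
  have h : det ((1, 0) : ℤ × ℤ) (0, 1) = 1 := by simp [det]
  have h1 : UniqueFactorizationMonoid (ChartRing k {((1, 0) : ℤ × ℤ), (0, 1)}) :=
    (AddMonoidAlgebra.domCongr k k (dualMonoidEquiv h).symm).toMulEquiv.uniqueFactorizationMonoid
      (inferInstanceAs (UniqueFactorizationMonoid (MvPolynomial (Fin 2) k)))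
  let i := (chartMap k (Finset.empty_subset {((1, 0) : ℤ × ℤ), (0, 1)})).toAlgebra
  have hm : ((1, 1) : ℤ × ℤ) ∈ dualMonoid {((1, 0) : ℤ × ℤ), (0, 1)} := by
    rw [mem_dualMonoid_pair]; simp [pairing]
  have := isLocalization_chartMap k (Finset.empty_subset {((1, 0) : ℤ × ℤ), (0, 1)}) ⟨_, hm⟩
    (by simp [pairing])
  exact UniqueFactorizationMonoid.of_isLocalization
    (Submonoid.powers (AddMonoidAlgebra.single (⟨_, hm⟩ : dualMonoid {((1, 0) : ℤ × ℤ), (0, 1)})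
      (1 : k))) _

/-- A character as a character of the torus. -/
def torusChar (m : ℤ × ℤ) : dualMonoid ∅ := ⟨m, fun _ h => absurd h (Finset.notMem_empty _)⟩

/-- The Laurent monomial of a character. -/
noncomputable def monomial (k : Type u) [Field k] (m : ℤ × ℤ) : ChartRing k ∅ :=
  AddMonoidAlgebra.single (torusChar m) 1

theorem monomial_add (m m' : ℤ × ℤ) : monomial k (m + m') = monomial k m * monomial k m' := by
  simp only [monomial, AddMonoidAlgebra.single_mul_single, mul_one]
  rfl

theorem monomial_zero : monomial k 0 = 1 := rfl

theorem monomial_ne_zero (m : ℤ × ℤ) : monomial k m ≠ 0 := by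
  simp [monomial]

/-- `a` is the smallest value at `v` of the characters in a Laurent polynomial. -/
def IsMinWeight (v : ℤ × ℤ) (h : ChartRing k ∅) (a : ℤ) : Prop :=
  (∀ m ∈ h.coeff.support, a ≤ pairing m v) ∧ ∃ m ∈ h.coeff.support, pairing m v = a

theorem exists_isMinWeight (v : ℤ × ℤ) {h : ChartRing k ∅} (hh : h ≠ 0) :
    ∃ a, IsMinWeight v h a := by
  have hs : h.coeff.support.Nonempty := by
    rw [Finsupp.support_nonempty_iff]
    simpa using hh
  obtain ⟨m, hm, hmin⟩ := Finset.exists_min_image h.coeff.support (fun m => pairing m v) hs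
  exact ⟨_, hmin, m, hm, rfl⟩

theorem exists_of_mem_support_mul {c : Finset (ℤ × ℤ)} {h h' : ChartRing k c} {m : dualMonoid c}
    (hm : m ∈ (h * h').coeff.support) :
    ∃ m₁ ∈ h.coeff.support, ∃ m₂ ∈ h'.coeff.support, m₁ + m₂ = m := by
  classical
  have := AddMonoidAlgebra.support_coeff_mul_subset h h' hm
  rwa [Finset.mem_add] at this

/-- The lowest-weight parts have a nonzero product: the lattice has unique sums, so some sum of
extremal exponents arises in only one way and its coefficient cannot cancel. Hence the minimal
weight at `v` is a valuation. -/
theorem IsMinWeight.mul {v : ℤ × ℤ} {h h' : ChartRing k ∅} {a b : ℤ} (H : IsMinWeight v h a)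
    (H' : IsMinWeight v h' b) : IsMinWeight v (h * h') (a + b) := by
  classical
  have hadd : ∀ m m' : dualMonoid ∅, pairing (m + m' : dualMonoid ∅) v =
      pairing m v + pairing m' v := fun m m' => pairing_add _ _ _
  constructor
  · intro m hm
    obtain ⟨m₁, h1, m₂, h2, rfl⟩ := exists_of_mem_support_mul hm
    rw [hadd]
    exact add_le_add (H.1 _ h1) (H'.1 _ h2)
  · have : UniqueSums (dualMonoid ∅) :=
      UniqueSums.of_injective_addHom (dualMonoid ∅).subtype.toAddHom Subtype.val_injective
        inferInstance
    let S := h.coeff.support.filter fun m : dualMonoid ∅ => pairing (m : ℤ × ℤ) v = a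
    let S' := h'.coeff.support.filter fun m : dualMonoid ∅ => pairing (m : ℤ × ℤ) v = b
    obtain ⟨m, hm, m', hm', hu⟩ := UniqueSums.uniqueAdd_of_nonempty (A := S) (B := S')
      (by obtain ⟨m, hm, h1⟩ := H.2; exact ⟨m, by simp only [S, Finset.mem_filter]; exact ⟨hm, h1⟩⟩)
      (by obtain ⟨m, hm, h1⟩ := H'.2
          exact ⟨m, by simp only [S', Finset.mem_filter]; exact ⟨hm, h1⟩⟩)
    simp only [S, S', Finset.mem_filter] at hm hm'
    have hu' : UniqueAdd h.coeff.support h'.coeff.support m m' := by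
      intro x y hx hy hxy
      have e1 := congrArg (fun z : dualMonoid ∅ => pairing z v) hxy
      simp only [hadd] at e1
      have e2 := H.1 x hx
      have e3 := H'.1 y hy
      exact hu (by simp only [S, Finset.mem_filter]; exact ⟨hx, by omega⟩)
        (by simp only [S', Finset.mem_filter]; exact ⟨hy, by omega⟩) hxy
    refine ⟨m + m', ?_, ?_⟩
    · rw [Finsupp.mem_support_iff, AddMonoidAlgebra.coeff_mul_add_of_uniqueAdd hu']
      exact mul_ne_zero (Finsupp.mem_support_iff.mp hm.1) (Finsupp.mem_support_iff.mp hm'.1)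
    · rw [hadd, hm.2, hm'.2]

/-- The restriction of a function on a chart to the torus. -/
noncomputable abbrev toTorus (k : Type u) [Field k] (c : Finset (ℤ × ℤ)) :
    ChartRing k c →+* ChartRing k ∅ :=
  chartMap k (Finset.empty_subset c)

theorem toTorus_injective (c : Finset (ℤ × ℤ)) : Function.Injective (toTorus k c) :=
  AddMonoidAlgebra.mapDomain_injective (AddSubmonoid.inclusion_injective _)

theorem toTorus_single {c : Finset (ℤ × ℤ)} (m : dualMonoid c) :
    toTorus k c (AddMonoidAlgebra.single m 1) = monomial k m :=
  chartMap_single k _ m 1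

theorem exists_toTorus_eq {c : Finset (ℤ × ℤ)} {h : ChartRing k ∅}
    (hh : ∀ m ∈ h.coeff.support, (m : ℤ × ℤ) ∈ dualMonoid c) : ∃ h₀, toTorus k c h₀ = h := by
  change h ∈ (toTorus k c).range
  rw [← AddMonoidAlgebra.sum_coeff_single h]
  refine sum_mem fun m hm => ?_
  exact ⟨AddMonoidAlgebra.single ⟨m, hh m hm⟩ (h.coeff m), chartMap_single k _ _ _⟩

theorem mem_dualMonoid_of_mem_support {c : Finset (ℤ × ℤ)} {h₀ : ChartRing k c} {m : dualMonoid ∅}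
    (hm : m ∈ (toTorus k c h₀).coeff.support) :
    ∃ m₀ ∈ h₀.coeff.support, (m₀ : ℤ × ℤ) = m := by
  have := Finsupp.mapDomain_support (show m ∈ (Finsupp.mapDomain
    (AddSubmonoid.inclusion (dualMonoid_anti (Finset.empty_subset c))) h₀.coeff).support from hm)
  simp only [Finset.mem_image] at this
  obtain ⟨m₀, h1, rfl⟩ := this
  exact ⟨m₀, h1, rfl⟩

theorem mem_support_toTorus {c : Finset (ℤ × ℤ)} {h₀ : ChartRing k c} {m₀ : dualMonoid c}
    (hm : m₀ ∈ h₀.coeff.support) : torusChar m₀ ∈ (toTorus k c h₀).coeff.support := by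
  rw [Finsupp.mem_support_iff] at hm ⊢
  have : (toTorus k c h₀).coeff (torusChar m₀) = h₀.coeff m₀ :=
    Finsupp.mapDomain_apply (AddSubmonoid.inclusion_injective _) h₀.coeff m₀
  rwa [this]

theorem exists_monomial_mul {c : Finset (ℤ × ℤ)} {h : ChartRing k ∅} (m : ℤ × ℤ)
    (hm : ∀ v ∈ c, ∀ n ∈ h.coeff.support, pairing m v ≤ pairing n v) :
    ∃ h₀, h = monomial k m * toTorus k c h₀ := by
  obtain ⟨h₀, h1⟩ := exists_toTorus_eq (c := c) (h := monomial k (-m) * h) (by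
    intro n hn v hv
    obtain ⟨m₁, h1, m₂, h2, rfl⟩ := exists_of_mem_support_mul hn
    have : m₁ = torusChar (-m) := by
      have := Finsupp.support_single_subset h1
      simpa using this
    subst this
    have h3 := hm v hv m₂ h2
    change 0 ≤ pairing (-m + (m₂ : ℤ × ℤ)) v
    rw [pairing_add, pairing_neg]
    omega)
  refine ⟨h₀, ?_⟩
  rw [h1, ← mul_assoc, ← monomial_add, add_neg_cancel, monomial_zero, one_mul]

/-- A function that does not vanish at a point of the open orbit stratum of a chart has a monomial
that is invertible on the chart. -/
theorem exists_mem_support_of_notMem {c : Finset (ℤ × ℤ)} {p : Ideal (ChartRing k c)}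
    (hp : ∀ m : dualMonoid c, (∃ v ∈ c, pairing m v ≠ 0) → AddMonoidAlgebra.single m 1 ∈ p)
    {G : ChartRing k c} (hG : G ∉ p) : ∃ m ∈ G.coeff.support, ∀ v ∈ c, pairing m v = 0 := by
  by_contra! hc
  apply hG
  rw [← AddMonoidAlgebra.sum_coeff_single G]
  refine Ideal.sum_mem _ fun m hm => ?_
  have : (AddMonoidAlgebra.single m (G.coeff m) : ChartRing k c) =
      AddMonoidAlgebra.single 0 (G.coeff m) * AddMonoidAlgebra.single m 1 := by
    rw [AddMonoidAlgebra.single_mul_single]; simp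
  rw [this]
  exact Ideal.mul_mem_left _ _ (hp m (hc m hm))

/-- A divisor of a function that does not vanish at a point of the open orbit stratum of a chart is,
up to a monomial, a function that does not vanish there. -/
theorem exists_eq_monomial_mul {c : Finset (ℤ × ℤ)} {p : Ideal (ChartRing k c)} [p.IsPrime]
    (hp : ∀ m : dualMonoid c, (∃ v ∈ c, pairing m v ≠ 0) → AddMonoidAlgebra.single m 1 ∈ p)
    {h h' : ChartRing k ∅} {G : ChartRing k c} (hG : G ∉ p) (hh : h * h' = toTorus k c G) :
    ∃ m h₀, h₀ ∉ p ∧ h = monomial k m * toTorus k c h₀ := by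
  -- The exponent `m₀` vanishes on the cone and splits as `m + m'` with `m`, `m'` in the supports of
  -- `h`, `h'`. The minimal weights of `h` and `h'` at each ray add up to a nonnegative number,
  -- since `G` is regular on the chart. So `m` and `m'` attain these minima at all rays of the cone
  -- at once and can be factored out.
  obtain ⟨m₀, hm₀, hm₀c⟩ := exists_mem_support_of_notMem hp hG
  have hG0 : toTorus k c G ≠ 0 := fun h0 => hG (by
    rw [toTorus_injective c (h0.trans (map_zero _).symm)]
    exact zero_mem _)
  have hh0 : h ≠ 0 := fun h0 => hG0 (by rw [← hh, h0, zero_mul])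
  have hh0' : h' ≠ 0 := fun h0 => hG0 (by rw [← hh, h0, mul_zero])
  have hmem := mem_support_toTorus hm₀
  rw [← hh] at hmem
  obtain ⟨m, hm, m', hm', hmm⟩ := exists_of_mem_support_mul hmem
  have hmm' : (m : ℤ × ℤ) + m' = m₀ := congrArg Subtype.val hmm
  have hmin : ∀ v ∈ c, (∀ n ∈ h.coeff.support, pairing m v ≤ pairing n v) ∧
      (∀ n ∈ h'.coeff.support, pairing m' v ≤ pairing n v) := by
    intro v hv
    obtain ⟨a, ha⟩ := exists_isMinWeight v hh0
    obtain ⟨b, hb⟩ := exists_isMinWeight v hh0'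
    have hab := ha.mul hb
    rw [hh] at hab
    obtain ⟨n, hn, hn'⟩ := hab.2
    obtain ⟨n₀, -, hn₀⟩ := mem_dualMonoid_of_mem_support hn
    have h1 : 0 ≤ pairing n v := hn₀ ▸ n₀.2 v hv
    have h2 := hm₀c v hv
    rw [← hmm', pairing_add] at h2
    have h3 := ha.1 m hm
    have h4 := hb.1 m' hm'
    exact ⟨fun n hn => by have := ha.1 n hn; omega, fun n hn => by have := hb.1 n hn; omega⟩
  obtain ⟨h₀, e₀⟩ := exists_monomial_mul (c := c) (m : ℤ × ℤ) fun v hv => (hmin v hv).1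
  obtain ⟨h₁, e₁⟩ := exists_monomial_mul (c := c) (m' : ℤ × ℤ) fun v hv => (hmin v hv).2
  refine ⟨m, h₀, fun hmem => hG ?_, e₀⟩
  have : G = AddMonoidAlgebra.single m₀ 1 * (h₀ * h₁) := by
    apply toTorus_injective c
    rw [← hh, map_mul, map_mul, toTorus_single, ← hmm', monomial_add, e₀, e₁]
    ring
  rw [this]
  exact Ideal.mul_mem_left _ _ (Ideal.mul_mem_right _ _ hmem)

/-- The units of the coordinate ring of the torus are the Laurent monomials. -/
theorem exists_eq_monomial_of_mul_eq_one {h h' : ChartRing k ∅} (hh : h * h' = 1) :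
    ∃ (m : ℤ × ℤ) (r : k), r ≠ 0 ∧ h = monomial k m * algebraMap k (ChartRing k ∅) r := by
  -- The four vectors positively span the plane, so the only character that is nonnegative on them
  -- is zero: the ring of `c` is just `k`, and the factorization applies to its zero ideal.
  let c : Finset (ℤ × ℤ) := {(1, 0), (0, 1), (-1, 0), (0, -1)}
  have hc : ∀ m : dualMonoid c, m = 0 := by
    rintro ⟨m, hm⟩
    have h1 := hm (1, 0) (by simp [c])
    have h2 := hm (0, 1) (by simp [c])
    have h3 := hm (-1, 0) (by simp [c])
    have h4 := hm (0, -1) (by simp [c])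
    simp only [pairing] at h1 h2 h3 h4
    refine Subtype.ext (Prod.ext ?_ ?_)
    · change m.1 = 0; omega
    · change m.2 = 0; omega
  obtain ⟨m, h₀, h1, h2⟩ := exists_eq_monomial_mul (c := c) (p := (⊥ : Ideal (ChartRing k c)))
    (by
      rintro m ⟨v, hv, hne⟩
      rw [hc m] at hne
      exact absurd (by simp [pairing]) hne) (G := 1) (by simp) (by rw [hh, map_one])
  have h3 : h₀ = AddMonoidAlgebra.single 0 (h₀.coeff 0) := by
    ext n
    rw [hc n]
    simp [AddMonoidAlgebra.coeff_single]
  refine ⟨m, h₀.coeff 0, ?_, ?_⟩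
  · intro h0
    rw [h0, AddMonoidAlgebra.single_zero] at h3
    exact h1 h3
  · rw [h2, h3]
    congr 1
    rw [chartMap_single]
    simp [AddMonoidAlgebra.coeff_single]

end weights

end ToricSurface

/-! ### Cartier divisors given by characters -/

namespace ToricSurface

theorem localDivisor_eq_iff {X : Scheme.{u}} [IsIntegral X] (x : X) (f g : (X.functionField)ˣ) :
    localDivisor X x f = localDivisor X x g ↔ f⁻¹ * g ∈ localUnits X x :=
  QuotientGroup.eq

theorem picard_mk_eq_one_iff {X : Scheme.{u}} [IsIntegral X] (D : cartierDivisors X) :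
    (QuotientGroup.mk D : PicardGroup X) = 1 ↔ ∃ f, ∀ x, D.1 x = localDivisor X x f := by
  rw [QuotientGroup.eq_one_iff]
  constructor
  · rintro ⟨f, rfl⟩
    exact ⟨f, fun _ => rfl⟩
  · rintro ⟨f, hf⟩
    exact ⟨f, Subtype.ext (funext fun x => (hf x).symm)⟩

namespace Atlas

variable {k : Type u} [Field k] {F : CompleteFan} {X : Scheme.{u}} [IsIntegral X]
  (A : Atlas k F X)

/-- Functions on the torus as rational functions. -/
noncomputable def rat : ChartRing k ∅ →+* X.functionField :=
  chartRational (R := ChartRing k F.zeroCone.1) (A.map F.zeroCone)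

theorem rat_injective : Function.Injective A.rat :=
  chartRational_injective (R := ChartRing k F.zeroCone.1) (A.map F.zeroCone)

theorem chartRational_map (c : F.Cone) (a : ChartRing k c.1) :
    chartRational (A.map c) a = A.rat (toTorus k c.1 a) :=
  (chartRational_comp (R' := ChartRing k F.zeroCone.1) (A.map c) (toTorus k c.1)
    (A.map F.zeroCone) (A.incl_map F.zeroCone c (Finset.empty_subset _)) a).symm

theorem mem_localUnits_map_iff (c : F.Cone) (p : PrimeSpectrum (ChartRing k c.1))
    (f : (X.functionField)ˣ) :
    f ∈ localUnits X (A.map c p) ↔ ∃ a b, a ∉ p.asIdeal ∧ b ∉ p.asIdeal ∧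
      f * A.rat (toTorus k c.1 b) = A.rat (toTorus k c.1 a) := by
  simp only [mem_localUnits_iff, chartRational_map]

/-- A character as a rational function. -/
noncomputable def char (m : ℤ × ℤ) : (X.functionField)ˣ :=
  Units.mk0 (A.rat (monomial k m)) ((map_ne_zero_iff _ A.rat_injective).mpr (monomial_ne_zero m))

theorem coe_char (m : ℤ × ℤ) : (A.char m : X.functionField) = A.rat (monomial k m) := rfl

theorem char_add (m m' : ℤ × ℤ) : A.char (m + m') = A.char m * A.char m' := by
  ext
  simp only [coe_char, monomial_add, map_mul, Units.val_mul]

theorem char_zero : A.char 0 = 1 := by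
  ext
  rw [coe_char, monomial_zero, map_one]; rfl

theorem char_neg (m : ℤ × ℤ) : A.char (-m) = (A.char m)⁻¹ := by
  rw [eq_inv_iff_mul_eq_one, ← char_add, neg_add_cancel, char_zero]

theorem char_nsmul (n : ℕ) (m : ℤ × ℤ) : A.char (n • m) = A.char m ^ n := by
  induction n with
  | zero => rw [zero_smul, char_zero, pow_zero]
  | succ n ih => rw [succ_nsmul, char_add, ih, pow_succ]

theorem char_mem_localUnits (c : F.Cone) (x : chart k c.1) (m : ℤ × ℤ)
    (hm : ∀ v ∈ c.1, pairing m v = 0) : A.char m ∈ localUnits X (A.map c x) := by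
  let p : PrimeSpectrum (ChartRing k c.1) := x
  refine (A.mem_localUnits_map_iff c p _).mpr ?_
  have h1 : m ∈ dualMonoid c.1 := fun v hv => (hm v hv).ge
  have h2 : -m ∈ dualMonoid c.1 := fun v hv => by rw [pairing_neg, hm v hv, neg_zero]
  refine ⟨AddMonoidAlgebra.single ⟨m, h1⟩ 1, 1, ?_, p.asIdeal.ne_top_iff_one.mp p.isPrime.ne_top, ?_⟩
  · intro h
    have h3 := p.asIdeal.mul_mem_left (AddMonoidAlgebra.single ⟨-m, h2⟩ 1) h
    rw [AddMonoidAlgebra.single_mul_single, mul_one] at h3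
    have h4 : (⟨-m, h2⟩ : dualMonoid c.1) + ⟨m, h1⟩ = 0 := Subtype.ext (neg_add_cancel m)
    rw [h4] at h3
    exact p.isPrime.ne_top ((Ideal.eq_top_iff_one _).mpr h3)
  · rw [map_one, map_one, mul_one, coe_char, toTorus_single]

theorem localDivisor_char_eq (c : F.Cone) (x : chart k c.1) (m m' : ℤ × ℤ)
    (hm : ∀ v ∈ c.1, pairing m v = pairing m' v) :
    localDivisor X (A.map c x) (A.char m) = localDivisor X (A.map c x) (A.char m') := by
  rw [localDivisor_eq_iff, ← char_neg, ← char_add]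
  refine A.char_mem_localUnits c x _ fun v hv => ?_
  rw [pairing_add, pairing_neg, hm v hv, neg_add_cancel]

/-- A rational function that is invertible on a chart. -/
theorem exists_of_forall_mem_localUnits (c : F.Cone) (f : (X.functionField)ˣ)
    (hf : ∀ p : chart k c.1, f ∈ localUnits X (A.map c p)) :
    ∃ b b' : ChartRing k c.1, b * b' = 1 ∧ (f : X.functionField) = A.rat (toTorus k c.1 b) := by
  have key : ∀ f : (X.functionField)ˣ, (∀ p : chart k c.1, f ∈ localUnits X (A.map c p)) →
      ∃ b, (f : X.functionField) = A.rat (toTorus k c.1 b) := by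
    intro f hf
    -- With `g = 1` the denominator is a power of `1`, so a function regular at all points of the
    -- chart is regular.
    obtain ⟨n, b, hb⟩ := exists_pow_denominator (A.rat.comp (toTorus k c.1)) (f : X.functionField) 1
      (fun q hq _ => by
        obtain ⟨a, b, -, hb, hab⟩ := (A.mem_localUnits_map_iff c ⟨q, hq⟩ f).mp (hf _)
        exact ⟨a, b, hb, hab⟩)
    rw [one_pow, map_one, mul_one] at hb
    exact ⟨b, hb⟩
  obtain ⟨b, hb⟩ := key f hf
  obtain ⟨b', hb'⟩ := key f⁻¹ fun p => inv_mem (hf p)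
  refine ⟨b, b', ?_, hb⟩
  apply toTorus_injective c.1
  apply A.rat_injective
  rw [map_mul, map_mul, ← hb, ← hb', map_one, map_one, Units.mul_inv]

/-! ### Torus-invariant Cartier divisors -/

/-- Dual characters of the cones, up to a common multiple. -/
theorem _root_.ToricSurface.CompleteFan.exists_dual (F : CompleteFan) :
    ∃ (N : ℕ) (dual : F.Cone → ℤ × ℤ → ℤ × ℤ), 0 < N ∧
      ∀ c, ∀ v ∈ c.1, ∀ w ∈ c.1, pairing (dual c v) w = if v = w then (N : ℤ) else 0 := by
  classical
  have hfin : Finite F.Cone := by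
    have hsub : ∀ c : F.Cone, c.1 ∈ F.rays.powerset := by
      rintro ⟨c, rfl | ⟨v, hv, rfl⟩ | ⟨u, v, huv, rfl⟩⟩ <;> rw [Finset.mem_powerset]
      · exact Finset.empty_subset _
      · simpa using hv
      · intro x hx
        simp only [Finset.mem_insert, Finset.mem_singleton] at hx
        rcases hx with rfl | rfl
        exacts [huv.1, huv.2.1]
    exact Finite.of_injective (fun c : F.Cone => (⟨c.1, hsub c⟩ : F.rays.powerset))
      fun c d h => Subtype.ext (congrArg (fun t : F.rays.powerset => t.1) h)
  have := Fintype.ofFinite F.Cone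
  have hex : ∀ (c : F.Cone) (v : ℤ × ℤ), ∃ (n : ℕ) (m : ℤ × ℤ), 0 < n ∧ (v ∈ c.1 → ∀ w ∈ c.1,
      pairing m w = if v = w then (n : ℤ) else 0) := by
    intro c v
    by_cases hv : v ∈ c.1
    · obtain ⟨m, hm⟩ := CompleteFan.exists_character c.2 (Finset.erase_subset v c.1)
      have hpos : 0 < pairing m v := by
        have h1 := hm v hv
        have h2 : pairing m v ≠ 0 := fun h => by simpa using h1.2.mp h
        omega
      refine ⟨(pairing m v).toNat, m, by omega, fun _ w hw => ?_⟩
      split_ifs with h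
      · subst h; omega
      · exact (hm w hw).2.mpr (Finset.mem_erase.mpr ⟨Ne.symm h, hw⟩)
    · exact ⟨1, 0, one_pos, fun h => absurd h hv⟩
  choose n m hn hm using hex
  -- The product of all the individual multiples serves as the common `N`, and each character is
  -- scaled by the complementary factor.
  refine ⟨∏ c : F.Cone, ∏ v ∈ c.1, n c v, fun c v =>
    ((∏ c : F.Cone, ∏ v ∈ c.1, n c v) / n c v) • m c v,
    Finset.prod_pos fun c _ => Finset.prod_pos fun v _ => hn c v, fun c v hv w hw => ?_⟩
  have hdvd : n c v ∣ ∏ c : F.Cone, ∏ v ∈ c.1, n c v :=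
    (Finset.dvd_prod_of_mem (fun v => n c v) hv).trans
      (Finset.dvd_prod_of_mem (fun c : F.Cone => ∏ v ∈ c.1, n c v) (Finset.mem_univ c))
  beta_reduce
  rw [← natCast_zsmul, pairing_smul, hm c v hv w hw]
  split_ifs
  · exact_mod_cast Nat.div_mul_cancel hdvd
  · simp

theorem localDivisor_char_eq_of_map_eq {m : F.Cone → ℤ × ℤ}
    (hm : ∀ (c d : F.Cone), ∀ v ∈ c.1, v ∈ d.1 → pairing (m c) v = pairing (m d) v)
    {c d : F.Cone} {z : chart k c.1} {w : chart k d.1} (h : A.map d w = A.map c z) :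
    localDivisor X (A.map c z) (A.char (m d)) = localDivisor X (A.map c z) (A.char (m c)) := by
  obtain ⟨e, hd, hc, t, -, ht⟩ := A.inter d c w z h
  have h1 := A.localDivisor_char_eq e t (m d) (m c) fun v hv => hm d c v (hd hv) (hc hv)
  rw [← A.map_incl e c hc t, ht] at h1
  exact h1

/-- The Cartier divisor that is given by a character on each chart. -/
noncomputable def charDivisor (m : F.Cone → ℤ × ℤ)
    (hm : ∀ (c d : F.Cone), ∀ v ∈ c.1, v ∈ d.1 → pairing (m c) v = pairing (m d) v) :
    cartierDivisors X := by
  refine ⟨fun x => localDivisor X x (A.char (m (A.surjective x).choose)), fun x => ?_⟩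
  obtain ⟨c, y, hy⟩ := A.surjective x
  refine ⟨A.char (m c), (A.map c).opensRange, ⟨y, hy⟩, ?_⟩
  rintro _ ⟨z, rfl⟩
  exact A.localDivisor_char_eq_of_map_eq hm (A.surjective (A.map c z)).choose_spec.choose_spec

theorem charDivisor_map (m : F.Cone → ℤ × ℤ)
    (hm : ∀ (c d : F.Cone), ∀ v ∈ c.1, v ∈ d.1 → pairing (m c) v = pairing (m d) v)
    (c : F.Cone) (z : chart k c.1) :
    (A.charDivisor m hm).1 (A.map c z) = localDivisor X (A.map c z) (A.char (m c)) :=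
  A.localDivisor_char_eq_of_map_eq hm (A.surjective (A.map c z)).choose_spec.choose_spec

end Atlas
end ToricSurface

/-! ### The Picard number -/

namespace ToricSurface

theorem isMinWeight_toTorus {k : Type u} [Field k] {v : ℤ × ℤ} {h : ChartRing k {v}}
    (hh : ∃ m ∈ h.coeff.support, pairing m v ≤ 0) : IsMinWeight v (toTorus k {v} h) 0 := by
  constructor
  · intro m hm
    obtain ⟨m₀, -, h2⟩ := mem_dualMonoid_of_mem_support hm
    exact h2 ▸ m₀.2 v (Finset.mem_singleton_self v)
  · obtain ⟨m, hm, h1⟩ := hh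
    exact ⟨torusChar m, mem_support_toTorus hm,
      le_antisymm h1 (m.2 v (Finset.mem_singleton_self v))⟩

theorem IsMinWeight.eq {k : Type u} [Field k] {v : ℤ × ℤ} {h : ChartRing k ∅} {a b : ℤ}
    (ha : IsMinWeight v h a) (hb : IsMinWeight v h b) : a = b := by
  obtain ⟨m, hm, rfl⟩ := ha.2
  obtain ⟨n, hn, rfl⟩ := hb.2
  exact le_antisymm (ha.1 n hn) (hb.1 m hm)

theorem isMinWeight_monomial {k : Type u} [Field k] (v m : ℤ × ℤ) :
    IsMinWeight v (monomial k m) (pairing m v) := by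
  have h : ∀ n, n ∈ (monomial k m).coeff.support ↔ n = torusChar m := by
    intro n
    rw [monomial]
    simp [AddMonoidAlgebra.coeff_single, eq_comm]
  exact ⟨fun n hn => by rw [(h n).mp hn]; exact le_rfl, torusChar m, (h _).mpr rfl, rfl⟩

/-- The generic point of the torus-invariant curve of a ray. -/
def curvePoint (k : Type u) [Field k] (v : ℤ × ℤ) : PrimeSpectrum (ChartRing k {v}) where
  asIdeal :=
    { carrier := {h | ∀ m ∈ h.coeff.support, 0 < pairing m v}
      zero_mem' := by simp
      add_mem' := by
        classical
        intro a b ha hb m hm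
        rw [AddMonoidAlgebra.coeff_add] at hm
        rcases Finset.mem_union.mp (Finsupp.support_add hm) with h | h
        exacts [ha m h, hb m h]
      smul_mem' := by
        intro a b hb m hm
        obtain ⟨m₁, h1, m₂, h2, rfl⟩ := exists_of_mem_support_mul hm
        have h3 : 0 ≤ pairing m₁ v := m₁.2 v (Finset.mem_singleton_self v)
        have h4 := hb m₂ h2
        change 0 < pairing ((m₁ : ℤ × ℤ) + m₂) v
        rw [pairing_add]
        omega }
  isPrime := by
    constructor
    · rw [Ideal.ne_top_iff_one]
      intro h
      have := h 0 (by simp [AddMonoidAlgebra.one_def, AddMonoidAlgebra.coeff_single])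
      simp [pairing] at this
    · intro a b hab
      by_contra! hc
      have ha : ∃ m ∈ a.coeff.support, pairing m v ≤ 0 := by
        by_contra! h; exact hc.1 h
      have hb : ∃ m ∈ b.coeff.support, pairing m v ≤ 0 := by
        by_contra! h; exact hc.2 h
      have h := (isMinWeight_toTorus ha).mul (isMinWeight_toTorus hb)
      rw [← map_mul] at h
      obtain ⟨m, hm, h1⟩ := h.2
      obtain ⟨m₀, h2, h3⟩ := mem_dualMonoid_of_mem_support hm
      have h4 := hab m₀ h2
      rw [h3, h1] at h4
      exact lt_irrefl _ h4

theorem CompleteFan.Cone.subset_rays {F : CompleteFan} (c : F.Cone) : c.1 ⊆ F.rays := by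
  intro v hv
  obtain ⟨c, rfl | ⟨u, hu, rfl⟩ | ⟨u, w, huw, rfl⟩⟩ := c
  · simp at hv
  · rw [Finset.mem_singleton] at hv; rwa [hv]
  · simp only [Finset.mem_insert, Finset.mem_singleton] at hv
    rcases hv with rfl | rfl
    exacts [huw.1, huw.2.1]

namespace Atlas

variable {k : Type u} [Field k] {F : CompleteFan} {X : Scheme.{u}} [IsIntegral X]
  (A : Atlas k F X)

/-- A character that is invertible on a chart. -/
theorem pairing_nonneg_of_char_mem (c : F.Cone) (m : ℤ × ℤ)
    (hm : ∀ p : chart k c.1, A.char m ∈ localUnits X (A.map c p)) :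
    ∀ v ∈ c.1, 0 ≤ pairing m v := by
  obtain ⟨b, -, -, hb⟩ := A.exists_of_forall_mem_localUnits c _ hm
  rw [coe_char] at hb
  have h1 := A.rat_injective hb
  have h2 : torusChar m ∈ (toTorus k c.1 b).coeff.support := by
    rw [← h1, monomial]
    simp [AddMonoidAlgebra.coeff_single]
  obtain ⟨m₀, -, h3⟩ := mem_dualMonoid_of_mem_support h2
  intro v hv
  have := m₀.2 v hv
  rw [h3] at this
  exact this

theorem pairing_eq_zero_of_char_mem (c : F.Cone) (m : ℤ × ℤ)
    (hm : ∀ p : chart k c.1, A.char m ∈ localUnits X (A.map c p)) :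
    ∀ v ∈ c.1, pairing m v = 0 := by
  intro v hv
  have h1 := A.pairing_nonneg_of_char_mem c m hm v hv
  have h2 := A.pairing_nonneg_of_char_mem c (-m)
    (fun p => by rw [char_neg]; exact inv_mem (hm p)) v hv
  rw [pairing_neg] at h2
  omega

/-- A rational function that is invertible on the torus is a character up to a constant. -/
theorem exists_localDivisor_eq_char (f : (X.functionField)ˣ)
    (hf : ∀ p : chart k F.zeroCone.1, f ∈ localUnits X (A.map F.zeroCone p)) :
    ∃ m, ∀ x, localDivisor X x f = localDivisor X x (A.char m) := by
  obtain ⟨b, b', hb, hfb⟩ := A.exists_of_forall_mem_localUnits F.zeroCone f hf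
  obtain ⟨m, r, hr, hm⟩ := exists_eq_monomial_of_mul_eq_one
    (h := toTorus k F.zeroCone.1 b) (h' := toTorus k F.zeroCone.1 b')
    (by rw [← map_mul, hb, map_one])
  refine ⟨m, fun x => ?_⟩
  obtain ⟨c, y, rfl⟩ := A.surjective x
  let p : PrimeSpectrum (ChartRing k c.1) := y
  rw [localDivisor_eq_iff]
  refine (A.mem_localUnits_map_iff c p _).mpr
    ⟨1, algebraMap k _ r, p.asIdeal.ne_top_iff_one.mp p.isPrime.ne_top, ?_, ?_⟩
  · intro h
    refine p.isPrime.ne_top (Ideal.eq_top_of_isUnit_mem _ h ?_)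
    exact (IsUnit.mk0 r hr).map (algebraMap k (ChartRing k c.1))
  · have h1 : toTorus k c.1 (algebraMap k _ r) = algebraMap k _ r := chartMap_single k _ 0 r
    rw [h1, map_one, map_one, Units.val_mul, mul_assoc, Units.inv_mul_eq_iff_eq_mul, mul_one, hfb,
      hm, map_mul, coe_char]

/-- The generic point of the torus-invariant curve of a ray. -/
noncomputable def raypoint {v : ℤ × ℤ} (hv : v ∈ F.rays) : X :=
  A.map ⟨{v}, Or.inr (Or.inl ⟨v, hv, rfl⟩)⟩ (curvePoint k v)

/-- Functions outside the ideal of the curve have minimal weight `0` at `v`. Hence a character that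
is a unit at the generic point of the curve has value `0` on `v`: the order of a character along the
curve is well defined. -/
theorem pairing_eq_of_localDivisor_raypoint {v : ℤ × ℤ} (hv : v ∈ F.rays) {m m' : ℤ × ℤ}
    (h : localDivisor X (A.raypoint hv) (A.char m) = localDivisor X (A.raypoint hv) (A.char m')) :
    pairing m v = pairing m' v := by
  rw [localDivisor_eq_iff, ← char_neg, ← char_add] at h
  obtain ⟨a, b, ha, hb, hab⟩ := (A.mem_localUnits_map_iff ⟨{v}, _⟩ (curvePoint k v) _).mp h
  rw [coe_char, ← map_mul] at hab
  have ha' := isMinWeight_toTorus (by by_contra! h; exact ha h)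
  have hb' := isMinWeight_toTorus (by by_contra! h; exact hb h)
  have h1 := ((isMinWeight_monomial v (-m + m')).mul hb').eq (A.rat_injective hab ▸ ha')
  rw [pairing_add, pairing_neg] at h1
  omega

/-- A Cartier divisor is given near a point of a chart by one rational function. -/
theorem exists_local_equation (D : cartierDivisors X) (c : F.Cone)
    (p : PrimeSpectrum (ChartRing k c.1)) : ∃ (f : (X.functionField)ˣ) (G : ChartRing k c.1),
      G ∉ p.asIdeal ∧ ∀ q : PrimeSpectrum (ChartRing k c.1), G ∉ q.asIdeal →
        D.1 (A.map c q) = localDivisor X (A.map c q) f := by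
  obtain ⟨f, U, hU, hf⟩ := D.2 (A.map c p)
  have ho : IsOpen ((A.map c) ⁻¹' U : Set (PrimeSpectrum (ChartRing k c.1))) :=
    U.2.preimage (A.map c).continuous
  obtain ⟨_, ⟨G, rfl⟩, hp, hG⟩ :=
    PrimeSpectrum.isTopologicalBasis_basic_opens.exists_subset_of_mem_open hU ho
  exact ⟨f, G, hp, fun q hq => hf _ (hG hq)⟩

/-- Every Cartier divisor is principal on the torus. -/
theorem exists_equation_on_torus (D : cartierDivisors X) : ∃ f : (X.functionField)ˣ,
    ∀ q : chart k F.zeroCone.1, D.1 (A.map F.zeroCone q) =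
      localDivisor X (A.map F.zeroCone q) f := by
  classical
  choose f G hG hD using A.exists_local_equation D F.zeroCone
  have hR : IsDomain (ChartRing k F.zeroCone.1) := isDomain_chartRing _
  have hU : UniqueFactorizationMonoid (ChartRing k F.zeroCone.1) := uniqueFactorizationMonoid_torus
  choose a b hb hab using fun p =>
    exists_fraction (R := ChartRing k F.zeroCone.1) (A.map F.zeroCone) hR (f p : X.functionField)
  let κ := chartRational (R := ChartRing k F.zeroCone.1) (A.map F.zeroCone)
  have hκ : Function.Injective κ := chartRational_injective _
  -- The spectrum is quasi-compact, so finitely many local equations suffice, and a common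
  -- denominator `B` makes all of them regular.
  obtain ⟨t, ht⟩ := isCompact_univ.elim_finite_subcover
    (fun p => (PrimeSpectrum.basicOpen (G p) : Set (PrimeSpectrum (ChartRing k F.zeroCone.1))))
    (fun p => (PrimeSpectrum.basicOpen (G p)).2) (fun p _ => Set.mem_iUnion.mpr ⟨p, hG p⟩)
  let B := ∏ p ∈ t, b p
  have hB : B ≠ 0 := Finset.prod_ne_zero_iff.mpr fun p _ => hb p
  have hdvd : ∀ i : t, ∃ e, (f i : X.functionField) * κ B = κ e := fun i => by
    obtain ⟨e, he⟩ := Finset.dvd_prod_of_mem b i.2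
    exact ⟨a i * e, by rw [show B = b i * e from he, map_mul, ← mul_assoc, hab, ← map_mul]⟩
  choose e he using hdvd
  have hκ0 : ∀ r, r ≠ 0 → κ r ≠ 0 := fun r hr => (map_ne_zero_iff κ hκ).mpr hr
  have he0 : ∀ i, e i ≠ 0 := fun i h => by
    have h1 := he i
    rw [h, map_zero] at h1
    exact mul_ne_zero (f i).ne_zero (hκ0 B hB) h1
  obtain ⟨g, hg0, hg⟩ := exists_global_equation (fun i : t => G i) e he0 (by
    intro q hq i j hi hj
    have h1 := (hD i ⟨q, hq⟩ hi).symm.trans (hD j ⟨q, hq⟩ hj)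
    rw [localDivisor_eq_iff] at h1
    obtain ⟨s, r, hs, hr, hsr⟩ := (mem_localUnits_iff (R := ChartRing k F.zeroCone.1)
      (A.map F.zeroCone) ⟨q, hq⟩ _).mp h1
    refine ⟨s, r, hs, hr, hκ ?_⟩
    rw [Units.val_mul, mul_assoc, Units.inv_mul_eq_iff_eq_mul] at hsr
    rw [map_mul, map_mul, ← he, ← he]
    linear_combination -κ B * hsr)
  refine ⟨Units.mk0 (κ g / κ B) (div_ne_zero (hκ0 g hg0) (hκ0 B hB)), fun x => ?_⟩
  let p : PrimeSpectrum (ChartRing k F.zeroCone.1) := x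
  obtain ⟨i, hi⟩ := Set.mem_iUnion.mp (ht (Set.mem_univ p))
  obtain ⟨hit, hip⟩ := Set.mem_iUnion.mp hi
  refine (hD i p hip).trans ?_
  rw [localDivisor_eq_iff]
  obtain ⟨s, r, hs, hr, hsr⟩ := hg p.asIdeal p.isPrime ⟨i, hit⟩ hip
  refine (mem_localUnits_iff (R := ChartRing k F.zeroCone.1) (A.map F.zeroCone) p _).mpr
    ⟨r, s, hr, hs, ?_⟩
  rw [Units.val_mul, mul_assoc, Units.inv_mul_eq_iff_eq_mul, Units.val_mk0]
  have h1 := congrArg κ hsr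
  rw [map_mul, map_mul, ← he] at h1
  change κ g / κ B * κ s = _ * κ r
  rw [div_mul_eq_mul_div, div_eq_iff (hκ0 B hB)]
  linear_combination h1

/-- A Cartier divisor that is trivial on the torus is given by characters. -/
theorem exists_char_of_trivial_on_torus (D : cartierDivisors X)
    (hD : ∀ q : chart k F.zeroCone.1, D.1 (A.map F.zeroCone q) = 1) (x : X) :
    ∃ (c : F.Cone) (m : ℤ × ℤ), (∃ y, A.map c y = x) ∧ D.1 x = localDivisor X x (A.char m) ∧
      ∀ v ∈ c.1, ∀ hv : v ∈ F.rays,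
        D.1 (A.raypoint hv) = localDivisor X (A.raypoint hv) (A.char m) := by
  obtain ⟨c, p, rfl, hp⟩ := A.exists_minimal_chart x
  obtain ⟨f, G, hG, hf⟩ := A.exists_local_equation D c p
  have hpp := p.isPrime
  have hunit : ∀ q : Ideal (ChartRing k ∅), ∀ hq : q.IsPrime, toTorus k c.1 G ∉ q →
      f ∈ localUnits X (A.map F.zeroCone (⟨q, hq⟩ : PrimeSpectrum (ChartRing k F.zeroCone.1))) := by
    intro q hq hGq
    let z : chart k F.zeroCone.1 := (⟨q, hq⟩ : PrimeSpectrum (ChartRing k F.zeroCone.1))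
    have h1 : A.map c (chartIncl k (Finset.empty_subset c.1) z) = A.map F.zeroCone z :=
      A.map_incl F.zeroCone c (Finset.empty_subset c.1) z
    have h2 := hf (chartIncl k (Finset.empty_subset c.1) z) hGq
    rw [h1] at h2
    have h3 := (hD z).symm.trans h2
    rw [← map_one (localDivisor X _), localDivisor_eq_iff, inv_one, one_mul] at h3
    exact h3
  have hden : ∀ f : (X.functionField)ˣ, (∀ q : Ideal (ChartRing k ∅), ∀ hq : q.IsPrime,
      toTorus k c.1 G ∉ q → f ∈ localUnits X (A.map F.zeroCone
        (⟨q, hq⟩ : PrimeSpectrum (ChartRing k F.zeroCone.1)))) →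
      ∃ n h, (f : X.functionField) * A.rat (toTorus k c.1 G ^ n) = A.rat h := by
    intro f hf
    refine exists_pow_denominator A.rat (f : X.functionField) (toTorus k c.1 G) fun q hq hGq => ?_
    obtain ⟨a, b, -, hb, hab⟩ := (mem_localUnits_iff (R := ChartRing k F.zeroCone.1)
      (A.map F.zeroCone) ⟨q, hq⟩ f).mp (hf q hq hGq)
    exact ⟨a, b, hb, hab⟩
  -- On the torus both `f` and its inverse have poles only along `G = 0`. After clearing
  -- denominators the two numerators multiply to a power of `G`, so up to units near the point `f`
  -- is a character.
  obtain ⟨n, h, hh⟩ := hden f hunit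
  obtain ⟨n', h', hh'⟩ := hden f⁻¹ fun q hq hq' => inv_mem (hunit q hq hq')
  obtain ⟨m, h₀, hh₀, rfl⟩ := exists_eq_monomial_mul hp (h := h) (h' := h') (G := G ^ (n + n'))
    (fun hmem => hG (hpp.mem_of_pow_mem _ hmem)) (by
      apply A.rat_injective
      rw [map_mul, ← hh, ← hh', map_pow (toTorus k c.1), pow_add, map_mul A.rat]
      linear_combination A.rat (toTorus k c.1 G ^ n) * A.rat (toTorus k c.1 G ^ n') *
        f.mul_inv)
  have hchar : ∀ q : PrimeSpectrum (ChartRing k c.1), G * h₀ ∉ q.asIdeal →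
      D.1 (A.map c q) = localDivisor X (A.map c q) (A.char m) := by
    intro q hq
    have hq1 : G ∉ q.asIdeal := fun h => hq (Ideal.mul_mem_right _ _ h)
    refine (hf q hq1).trans ?_
    rw [localDivisor_eq_iff]
    refine (A.mem_localUnits_map_iff c q _).mpr ⟨G ^ n, h₀,
      fun h => hq1 (q.isPrime.mem_of_pow_mem _ h), fun h => hq (Ideal.mul_mem_left _ _ h), ?_⟩
    rw [Units.val_mul, mul_assoc, Units.inv_mul_eq_iff_eq_mul, coe_char, ← map_mul, ← hh,
      map_pow (toTorus k c.1)]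
  have hGh : G * h₀ ∉ p.asIdeal := fun h => (hpp.mem_or_mem h).elim hG hh₀
  refine ⟨c, m, ⟨p, rfl⟩, hchar p hGh, fun v hvc hv => ?_⟩
  have hsub : ({v} : Finset (ℤ × ℤ)) ⊆ c.1 := Finset.singleton_subset_iff.mpr hvc
  have h1 : A.map c (chartIncl k hsub (curvePoint k v)) = A.raypoint hv :=
    A.map_incl ⟨{v}, Or.inr (Or.inl ⟨v, hv, rfl⟩)⟩ c hsub (curvePoint k v)
  rw [← h1]
  refine hchar (chartIncl k hsub (curvePoint k v)) fun hmem => ?_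
  -- The equation must also hold at the generic points of the curves through the point. There `G *
  -- h₀` does not vanish, because it contains a monomial with value zero on all rays of the cone.
  obtain ⟨m', hm', h2⟩ := exists_mem_support_of_notMem hp hGh
  have h3 : chartMap k hsub (G * h₀) ∈ (curvePoint k v).asIdeal := hmem
  have h4 := h3 (AddSubmonoid.inclusion (dualMonoid_anti hsub) m') (by
    rw [Finsupp.mem_support_iff] at hm' ⊢
    have : (chartMap k hsub (G * h₀)).coeff (AddSubmonoid.inclusion (dualMonoid_anti hsub) m') =
        (G * h₀).coeff m' :=
      Finsupp.mapDomain_apply (AddSubmonoid.inclusion_injective _) (G * h₀).coeff m'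
    rwa [this])
  exact h4.ne' (h2 v hvc)

/-- The class of a Cartier divisor is, up to a multiple, the class of a divisor that is given by
characters. -/
theorem exists_charDivisor_eq_pow (N : ℕ) (μ : ((ℤ × ℤ) → ℤ) → F.Cone → ℤ × ℤ)
    (hμ : ∀ a c, ∀ v ∈ c.1, pairing (μ a c) v = N * a v)
    (hμ' : ∀ (a) (c d : F.Cone), ∀ v ∈ c.1, v ∈ d.1 → pairing (μ a c) v = pairing (μ a d) v)
    (D : cartierDivisors X) : ∃ a,
      (QuotientGroup.mk D : PicardGroup X) ^ N = QuotientGroup.mk (A.charDivisor (μ a) (hμ' a)) := by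
  classical
  obtain ⟨f, hf⟩ := A.exists_equation_on_torus D
  -- Subtracting the divisor of `f` leaves the class unchanged and makes the divisor trivial on the
  -- torus.
  let E : cartierDivisors X := (principalDivisor X f)⁻¹ * D
  have hE : ∀ q : chart k F.zeroCone.1, E.1 (A.map F.zeroCone q) = 1 := by
    intro q
    change (localDivisor X (A.map F.zeroCone q) f)⁻¹ * D.1 (A.map F.zeroCone q) = 1
    rw [hf, inv_mul_cancel]
  have hED : (QuotientGroup.mk D : PicardGroup X) = QuotientGroup.mk E := by
    rw [QuotientGroup.eq]
    refine ⟨f⁻¹, ?_⟩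
    rw [map_inv]
    simp only [E]
    rw [mul_comm _ D, inv_mul_cancel_left]
  -- The number `a v` is the order of `E` along the curve of `v`, read off from any local character.
  -- The value `0` is a filler for vectors that do not occur in the fan.
  let a : ℤ × ℤ → ℤ := fun v => if h : ∃ (hv : v ∈ F.rays) (m : ℤ × ℤ),
    E.1 (A.raypoint hv) = localDivisor X (A.raypoint hv) (A.char m) then
      pairing h.choose_spec.choose v else 0
  refine ⟨a, ?_⟩
  rw [hED, ← QuotientGroup.mk_pow]
  congr 1
  refine Subtype.ext (funext fun x => ?_)
  obtain ⟨c, m, ⟨y, rfl⟩, h1, h2⟩ := A.exists_char_of_trivial_on_torus E hE x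
  rw [charDivisor_map]
  change E.1 (A.map c y) ^ N = _
  rw [h1, ← map_pow, ← char_nsmul]
  refine A.localDivisor_char_eq c y _ _ fun v hvc => ?_
  have hv : v ∈ F.rays := c.subset_rays hvc
  have hex : ∃ (hv : v ∈ F.rays) (m : ℤ × ℤ),
    E.1 (A.raypoint hv) = localDivisor X (A.raypoint hv) (A.char m) := ⟨hv, m, h2 v hvc hv⟩
  rw [hμ a c v hvc, ← natCast_zsmul, pairing_smul]
  congr 1
  simp only [a]
  rw [dif_pos hex]
  exact A.pairing_eq_of_localDivisor_raypoint hv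
    ((h2 v hvc hv).symm.trans hex.choose_spec.choose_spec)

/-- The class of a torus-invariant Weil divisor, multiplied so that it becomes a Cartier divisor. -/
noncomputable def invariantClass (μ : (F.rays → ℤ) →ₗ[ℤ] F.Cone → ℤ × ℤ)
    (hμ : ∀ a, ∀ (c d : F.Cone), ∀ v ∈ c.1, v ∈ d.1 → pairing (μ a c) v = pairing (μ a d) v) :
    (F.rays → ℤ) →ₗ[ℤ] Additive (PicardGroup X) :=
  AddMonoidHom.toIntLinearMap
    { toFun := fun a => Additive.ofMul (QuotientGroup.mk (A.charDivisor (μ a) (hμ a)))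
      map_zero' := by
        refine congrArg Additive.ofMul ((picard_mk_eq_one_iff _).mpr ⟨1, fun x => ?_⟩)
        obtain ⟨c, y, rfl⟩ := A.surjective x
        rw [charDivisor_map, map_zero, Pi.zero_apply, char_zero]
      map_add' := by
        intro a b
        refine congrArg Additive.ofMul (congrArg QuotientGroup.mk (Subtype.ext (funext fun x => ?_)))
        obtain ⟨c, y, rfl⟩ := A.surjective x
        change _ = (A.charDivisor (μ a) (hμ a)).1 (A.map c y) *
          (A.charDivisor (μ b) (hμ b)).1 (A.map c y)
        rw [charDivisor_map, charDivisor_map, charDivisor_map, map_add, Pi.add_apply, char_add,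
          map_mul] }

/-- An equation of a principal divisor supported on the boundary is invertible on the torus, hence a
character up to a constant; comparison on the chart of each ray gives its values. -/
theorem invariantClass_eq_zero_iff (μ : (F.rays → ℤ) →ₗ[ℤ] F.Cone → ℤ × ℤ)
    (hμ : ∀ a, ∀ (c d : F.Cone), ∀ v ∈ c.1, v ∈ d.1 → pairing (μ a c) v = pairing (μ a d) v)
    (N : ℕ) (hN : ∀ a c (v : F.rays), v.1 ∈ c.1 → pairing (μ a c) v = N * a v) (a : F.rays → ℤ) :
    A.invariantClass μ hμ a = 0 ↔ ∃ m, ∀ v : F.rays, N * a v = pairing m v := by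
  have h0 : A.invariantClass μ hμ a = 0 ↔
      (QuotientGroup.mk (A.charDivisor (μ a) (hμ a)) : PicardGroup X) = 1 := Iff.rfl
  rw [h0, picard_mk_eq_one_iff]
  constructor
  · rintro ⟨f, hf⟩
    have hfT : ∀ p : chart k F.zeroCone.1, f ∈ localUnits X (A.map F.zeroCone p) := by
      intro p
      have h1 := hf (A.map F.zeroCone p)
      rw [charDivisor_map, A.localDivisor_char_eq F.zeroCone p _ 0
        fun v hv => absurd hv (Finset.notMem_empty v), char_zero, localDivisor_eq_iff, inv_one,
        one_mul] at h1
      exact h1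
    obtain ⟨m, hm⟩ := A.exists_localDivisor_eq_char f hfT
    refine ⟨m, fun v => ?_⟩
    let c : F.Cone := ⟨{v.1}, Or.inr (Or.inl ⟨v, v.2, rfl⟩)⟩
    have hvc : v.1 ∈ c.1 := Finset.mem_singleton_self _
    rw [← hN a c v hvc]
    have h1 := A.pairing_eq_zero_of_char_mem c (-(μ a c) + m) (fun p => by
      have h2 := (hf (A.map c p)).trans (hm _)
      rwa [charDivisor_map, localDivisor_eq_iff, ← char_neg, ← char_add] at h2) v hvc
    rw [pairing_add, pairing_neg] at h1
    omega
  · rintro ⟨m, hm⟩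
    refine ⟨A.char m, fun x => ?_⟩
    obtain ⟨c, y, rfl⟩ := A.surjective x
    rw [charDivisor_map]
    refine A.localDivisor_char_eq c y _ _ fun v hv => ?_
    have hvF : v ∈ F.rays := c.subset_rays hv
    rw [hN a c ⟨v, hvF⟩ hv, hm ⟨v, hvF⟩]

end Atlas

theorem CompleteFan.exists_det_ne_zero (F : CompleteFan) :
    ∃ u ∈ F.rays, ∃ v ∈ F.rays, det u v ≠ 0 := by
  obtain ⟨u, hu, h1⟩ := F.complete (1, 0) (by simp)
  obtain ⟨v, hv, h2⟩ := F.complete (-u.2, u.1) (by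
    intro h
    simp only [Prod.mk_eq_zero] at h
    simp [pairing, h.2] at h1)
  refine ⟨u, hu, v, hv, ?_⟩
  simp only [pairing, det] at h2 ⊢
  intro h
  linarith

/-- The relations between the classes of the torus-invariant curves form a group of rank two. -/
theorem CompleteFan.finrank_eq_two (F : CompleteFan) {N : ℕ} (hN : 0 < N)
    (K : Submodule ℤ (F.rays → ℤ))
    (hK : ∀ a, a ∈ K ↔ ∃ m, ∀ v : F.rays, N * a v = pairing m v) : Module.finrank ℤ K = 2 := by
  obtain ⟨u, hu, v, hv, huv⟩ := F.exists_det_ne_zero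
  have h2 : Module.finrank ℤ (ℤ × ℤ) = 2 := by simp
  apply le_antisymm
  -- Upper bound: the values at two linearly independent rays determine the character and therefore
  -- the relation.
  · let g : K →ₗ[ℤ] ℤ × ℤ := ((LinearMap.proj (⟨u, hu⟩ : F.rays)).prod
      (LinearMap.proj (⟨v, hv⟩ : F.rays))).comp K.subtype
    have hg : Function.Injective g := by
      rw [injective_iff_map_eq_zero]
      rintro ⟨a, ha⟩ h
      obtain ⟨m, hm⟩ := (hK a).mp ha
      have e1 : a ⟨u, hu⟩ = 0 := congrArg Prod.fst h
      have e2 : a ⟨v, hv⟩ = 0 := congrArg Prod.snd h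
      have hm0 : m = 0 := by
        refine ext_of_pairing huv (m' := 0) ?_ ?_
        · rw [← hm ⟨u, hu⟩, e1]; simp [pairing]
        · rw [← hm ⟨v, hv⟩, e2]; simp [pairing]
      refine Subtype.ext (funext fun w => ?_)
      have h1 := hm w
      rw [hm0] at h1
      have h3 : (N : ℤ) * a w = 0 := by rw [h1]; simp [pairing]
      exact (mul_eq_zero.mp h3).resolve_left (by exact_mod_cast hN.ne')
    rw [← h2]
    exact LinearMap.finrank_le_finrank_of_injective hg
  -- Lower bound: the character lattice embeds by its values on the rays, since these span the
  -- plane.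
  · let g : ℤ × ℤ →ₗ[ℤ] K :=
      { toFun := fun m => ⟨fun w => pairing m w, (hK _).mpr ⟨(N : ℤ) • m, fun w => by
          rw [pairing_smul]⟩⟩
        map_add' := fun m m' => Subtype.ext (funext fun w => pairing_add m m' w)
        map_smul' := fun r m => Subtype.ext (funext fun w => pairing_smul r m w) }
    have hg : Function.Injective g := by
      intro m m' h
      have h1 := congrArg Subtype.val h
      exact ext_of_pairing huv (congrFun h1 ⟨u, hu⟩) (congrFun h1 ⟨v, hv⟩)
    rw [← h2]
    exact LinearMap.finrank_le_finrank_of_injective hg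

/-- The Picard number of a complete toric surface is the number of rays minus two. -/
theorem Atlas.rank_picardGroup {k : Type u} [Field k] {F : CompleteFan} {X : Scheme.{u}}
    [IsIntegral X] (A : Atlas k F X) :
    Module.rank ℤ (Additive (PicardGroup X)) + 2 = F.rays.card := by
  classical
  obtain ⟨N, dual, hN, hdual⟩ := F.exists_dual
  let ext (a : F.rays → ℤ) (v : ℤ × ℤ) : ℤ := if h : v ∈ F.rays then a ⟨v, h⟩ else 0
  let ν (a : ℤ × ℤ → ℤ) (c : F.Cone) : ℤ × ℤ := ∑ v ∈ c.1, a v • dual c v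
  have hν : ∀ a (c : F.Cone), ∀ w ∈ c.1, pairing (ν a c) w = N * a w := by
    intro a c w hw
    have h1 : pairing (ν a c) w = ∑ v ∈ c.1, pairing (a v • dual c v) w :=
      map_sum (AddMonoidHom.mk' (fun m => pairing m w) fun m m' => pairing_add m m' w) _ _
    rw [h1, Finset.sum_eq_single w]
    · rw [pairing_smul, hdual c w hw w hw, if_pos rfl, mul_comm]
    · intro v hv hvw
      rw [pairing_smul, hdual c v hv w hw, if_neg hvw, mul_zero]
    · exact fun h => absurd hw h
  let μ : (F.rays → ℤ) →ₗ[ℤ] F.Cone → ℤ × ℤ :=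
    { toFun := fun a c => ν (ext a) c
      map_add' := by
        intro a b
        funext c
        simp only [ν, Pi.add_apply, ← Finset.sum_add_distrib, ← add_smul]
        refine Finset.sum_congr rfl fun v hv => ?_
        simp [ext, c.subset_rays hv]
      map_smul' := by
        intro r a
        funext c
        simp only [ν, Pi.smul_apply, Finset.smul_sum, smul_smul, RingHom.id_apply]
        refine Finset.sum_congr rfl fun v hv => ?_
        simp [ext, c.subset_rays hv] }
  have hμN : ∀ a c (v : F.rays), v.1 ∈ c.1 → pairing (μ a c) v = N * a v := by
    intro a c v hv
    refine (hν (ext a) c v hv).trans ?_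
    simp [ext]
  have hμ : ∀ a, ∀ (c d : F.Cone), ∀ v ∈ c.1, v ∈ d.1 →
      pairing (μ a c) v = pairing (μ a d) v := by
    intro a c d v hc hd
    have hv := c.subset_rays hc
    exact (hμN a c ⟨v, hv⟩ hc).trans (hμN a d ⟨v, hv⟩ hd).symm
  -- The map `φ` sends a Weil divisor supported on the boundary to the class of its `N`-th multiple.
  -- Its kernel has rank two and its cokernel is killed by `N`, so the rank of the Picard group is
  -- the number of rays minus two.
  let φ := A.invariantClass μ hμ
  have hker : Module.finrank ℤ φ.ker = 2 := F.finrank_eq_two hN _ fun a => by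
    rw [LinearMap.mem_ker]
    exact A.invariantClass_eq_zero_iff μ hμ N hμN a
  have htors : Module.rank ℤ (Additive (PicardGroup X) ⧸ φ.range) = 0 := by
    rw [rank_eq_zero_iff]
    intro x
    obtain ⟨y, rfl⟩ := Submodule.mkQ_surjective _ x
    obtain ⟨D, hD⟩ := QuotientGroup.mk_surjective (Additive.toMul y)
    refine ⟨N, by exact_mod_cast hN.ne', ?_⟩
    rw [← map_smul, Submodule.mkQ_apply, Submodule.Quotient.mk_eq_zero]
    obtain ⟨a, ha⟩ := A.exists_charDivisor_eq_pow N ν hν (fun a c d v hc hd =>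
      (hν a c v hc).trans (hν a d v hd).symm) D
    refine ⟨fun v => a v, ?_⟩
    have h1 : (μ fun v => a v) = ν a := by
      funext c
      refine Finset.sum_congr rfl fun v hv => ?_
      simp [ext, c.subset_rays hv]
    rw [natCast_zsmul]
    change QuotientGroup.mk (A.charDivisor (μ fun v => a v) _) = (Additive.toMul y) ^ N
    rw [← hD, ha]
    congr 2
  have h1 := rank_quotient_add_rank_of_isDomain φ.range
  rw [htors, zero_add] at h1
  rw [← h1, ← Module.finrank_eq_rank]
  have h2 := φ.ker.finrank_quotient_add_finrank
  rw [φ.quotKerEquivRange.finrank_eq, hker, Module.finrank_fintype_fun_eq_card, Fintype.card_coe] at h2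
  exact_mod_cast h2

theorem Atlas.hasPicardNumberOne_iff {k : Type u} [Field k] {F : CompleteFan} {X : Scheme.{u}}
    (A : Atlas k F X) : HasPicardNumberOne X ↔ F.rays.card = 3 := by
  have key : ∀ _ : IsIntegral X,
      (Module.rank ℤ (Additive (PicardGroup X)) = 1 ↔ F.rays.card = 3) := by
    intro _
    have h := A.rank_picardGroup
    constructor
    · intro h1
      rw [h1] at h
      have h3 : ((1 + 2 : ℕ) : Cardinal.{u}) = F.rays.card := by exact_mod_cast h
      exact_mod_cast h3.symm
    · intro h1
      rw [h1] at h
      have h3 : Module.rank ℤ (Additive (PicardGroup X)) + (2 : ℕ) = (1 : Cardinal) + (2 : ℕ) := by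
        rw [Nat.cast_ofNat, h]; norm_num
      exact Cardinal.add_nat_inj 2 |>.mp h3
  constructor
  · rintro ⟨h, h1⟩
    exact (key h).mp h1
  · exact fun h => ⟨A.isIntegral, (key A.isIntegral).mpr h⟩

end ToricSurface

namespace ToricSurface

/-! ### The cyclic order of the rays of a fan -/

theorem det_swap (u v : ℤ × ℤ) : det v u = -det u v := by
  simp only [det]; ring

theorem det_self (u : ℤ × ℤ) : det u u = 0 := by
  simp only [det]; ring

theorem det_add_left (u v w : ℤ × ℤ) : det (u + v) w = det u w + det v w := by
  simp only [det, Prod.fst_add, Prod.snd_add]; ring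

theorem det_add_right (u v w : ℤ × ℤ) : det u (v + w) = det u v + det u w := by
  simp only [det, Prod.fst_add, Prod.snd_add]; ring

theorem det_smul_left (a : ℤ) (u v : ℤ × ℤ) : det (a • u) v = a * det u v := by
  simp only [det, Prod.smul_fst, Prod.smul_snd, smul_eq_mul]; ring

theorem det_smul_right (a : ℤ) (u v : ℤ × ℤ) : det u (a • v) = a * det u v := by
  simp only [det, Prod.smul_fst, Prod.smul_snd, smul_eq_mul]; ring

/-- The Plücker relation. -/
theorem det_mul_det (a b c d : ℤ × ℤ) :
    det a c * det b d = det a b * det c d + det a d * det b c := by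
  simp only [det]; ring

theorem eq_or_eq_neg_of_det_eq_zero {u v : ℤ × ℤ} (hu : Int.gcd u.1 u.2 = 1)
    (hv : Int.gcd v.1 v.2 = 1) (h : det u v = 0) : v = u ∨ v = -u := by
  obtain ⟨e, he⟩ := exists_det_eq_one hu
  have h1 : v = (det v e) • u := by
    simp only [det] at h he ⊢
    ext
    · simp only [Prod.smul_fst, smul_eq_mul]
      linear_combination (-v.1) * he + e.1 * h
    · simp only [Prod.smul_snd, smul_eq_mul]
      linear_combination (-v.2) * he + e.2 * h
  have h2 : Int.gcd v.1 v.2 = (det v e).natAbs := by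
    conv_lhs => rw [h1]
    simp only [Prod.smul_fst, Prod.smul_snd, smul_eq_mul, Int.gcd_mul_left, hu, mul_one]
  rw [hv] at h2
  rcases Int.natAbs_eq (det v e) with h3 | h3 <;> rw [← h2] at h3 <;> rw [h1, h3]
  · left; simp
  · right; simp

/-- For vectors `w` with `det w x > 0`, the quotient `pairing x w / det w x` is the cotangent of the
angle from `w` to `x`, so its maximum is attained at the smallest angle. This replaces an angular
ordering of the rays. -/
theorem exists_nearest_right {s : Finset (ℤ × ℤ)} {x : ℤ × ℤ} (hs : ∃ w ∈ s, 0 < det w x) :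
    ∃ u ∈ s, 0 < det u x ∧ ∀ w ∈ s, 0 < det w x → 0 ≤ det w u := by
  obtain ⟨w₀, hw₀, h₀⟩ := hs
  obtain ⟨u, hu, hmax⟩ := Finset.exists_max_image (s.filter fun w => 0 < det w x)
    (fun w => (pairing x w / det w x : ℚ)) ⟨w₀, Finset.mem_filter.mpr ⟨hw₀, h₀⟩⟩
  rw [Finset.mem_filter] at hu
  refine ⟨u, hu.1, hu.2, fun w hw hwx => ?_⟩
  have h1 := hmax w (Finset.mem_filter.mpr ⟨hw, hwx⟩)
  rw [div_le_div_iff₀ (by exact_mod_cast hwx) (by exact_mod_cast hu.2)] at h1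
  have h2 : pairing x w * det u x ≤ pairing x u * det w x := by exact_mod_cast h1
  have h3 : pairing x u * det w x - pairing x w * det u x = det w u * (x.1 ^ 2 + x.2 ^ 2) := by
    simp only [pairing, det]; ring
  have h4 : 0 < x.1 ^ 2 + x.2 ^ 2 := by
    have : x.1 ≠ 0 ∨ x.2 ≠ 0 := by
      by_contra! hc
      simp [det, hc.1, hc.2] at hwx
    rcases this with h | h <;> positivity
  exact nonneg_of_mul_nonneg_left (by linarith) h4

theorem exists_nearest_left {s : Finset (ℤ × ℤ)} {x : ℤ × ℤ} (hs : ∃ w ∈ s, 0 < det x w) :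
    ∃ v ∈ s, 0 < det x v ∧ ∀ w ∈ s, 0 < det x w → 0 ≤ det v w := by
  obtain ⟨w₀, hw₀, h₀⟩ := hs
  obtain ⟨v, hv, hmax⟩ := Finset.exists_max_image (s.filter fun w => 0 < det x w)
    (fun w => (pairing x w / det x w : ℚ)) ⟨w₀, Finset.mem_filter.mpr ⟨hw₀, h₀⟩⟩
  rw [Finset.mem_filter] at hv
  refine ⟨v, hv.1, hv.2, fun w hw hwx => ?_⟩
  have h1 := hmax w (Finset.mem_filter.mpr ⟨hw, hwx⟩)
  rw [div_le_div_iff₀ (by exact_mod_cast hwx) (by exact_mod_cast hv.2)] at h1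
  have h2 : pairing x w * det x v ≤ pairing x v * det x w := by exact_mod_cast h1
  have h3 : pairing x v * det x w - pairing x w * det x v = det v w * (x.1 ^ 2 + x.2 ^ 2) := by
    simp only [pairing, det]; ring
  have h4 : 0 < x.1 ^ 2 + x.2 ^ 2 := by
    have : x.1 ≠ 0 ∨ x.2 ≠ 0 := by
      by_contra! hc
      simp [det, hc.1, hc.2] at hwx
    rcases this with h | h <;> positivity
  exact nonneg_of_mul_nonneg_left (by linarith) h4

namespace CompleteFan

variable {F : CompleteFan}

theorem exists_det_pos (F : CompleteFan) {x : ℤ × ℤ} (hx : x ≠ 0) :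
    (∃ w ∈ F.rays, 0 < det w x) ∧ ∃ w ∈ F.rays, 0 < det x w := by
  have hx' : x.1 ≠ 0 ∨ x.2 ≠ 0 := by
    by_contra! hc
    exact hx (Prod.ext hc.1 hc.2)
  constructor
  · obtain ⟨w, hw, h⟩ := F.complete (-x.2, x.1) (by
      simp only [ne_eq, Prod.mk_eq_zero, neg_eq_zero]; tauto)
    exact ⟨w, hw, by simp only [pairing, det] at h ⊢; linarith⟩
  · obtain ⟨w, hw, h⟩ := F.complete (x.2, -x.1) (by
      simp only [ne_eq, Prod.mk_eq_zero, neg_eq_zero]; tauto)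
    exact ⟨w, hw, by simp only [pairing, det] at h ⊢; linarith⟩

theorem ne_zero {v : ℤ × ℤ} (hv : v ∈ F.rays) : v ≠ 0 := by
  rintro rfl
  simpa using F.primitive _ hv

theorem exists_next {u : ℤ × ℤ} (hu : u ∈ F.rays) : ∃ v, F.Adj u v := by
  obtain ⟨v, hv, h1, h2⟩ := exists_nearest_left (F.exists_det_pos (ne_zero hu)).2
  refine ⟨v, hu, hv, h1, fun w hw h => ?_⟩
  have h3 := h2 w hw h.1
  rw [det_swap] at h3
  linarith [h.2]

theorem exists_prev {u : ℤ × ℤ} (hu : u ∈ F.rays) : ∃ v, F.Adj v u := by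
  obtain ⟨v, hv, h1, h2⟩ := exists_nearest_right (F.exists_det_pos (ne_zero hu)).1
  refine ⟨v, hv, hu, h1, fun w hw h => ?_⟩
  have h3 := h2 w hw h.2
  rw [det_swap] at h3
  linarith [h.1]

/-- Parallel primitive vectors are equal or opposite; the common side relative to `x` excludes
opposite ones. -/
theorem eq_of_det_eq_zero {u v x : ℤ × ℤ} (hu : u ∈ F.rays) (hv : v ∈ F.rays) (h : det u v = 0)
    (hux : 0 < det u x) (hvx : 0 ≤ det v x) : u = v := by
  rcases eq_or_eq_neg_of_det_eq_zero (F.primitive u hu) (F.primitive v hv) h with rfl | rfl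
  · rfl
  · have : det (-u) x = -det u x := by simp only [det, Prod.fst_neg, Prod.snd_neg]; ring
    omega

theorem eq_of_det_eq_zero' {u v x : ℤ × ℤ} (hu : u ∈ F.rays) (hv : v ∈ F.rays) (h : det u v = 0)
    (hux : 0 < det x u) (hvx : 0 ≤ det x v) : u = v := by
  rcases eq_or_eq_neg_of_det_eq_zero (F.primitive u hu) (F.primitive v hv) h with rfl | rfl
  · rfl
  · have : det x (-u) = -det x u := by simp only [det, Prod.fst_neg, Prod.snd_neg]; ring
    omega

theorem Adj.det_nonneg_right {u v w : ℤ × ℤ} (h : F.Adj u v) (hw : w ∈ F.rays)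
    (huw : 0 < det u w) : 0 ≤ det v w := by
  have := h.2.2.2 w hw
  rw [det_swap]
  by_contra hc
  exact this ⟨huw, by linarith⟩

theorem Adj.det_nonneg_left {u v w : ℤ × ℤ} (h : F.Adj u v) (hw : w ∈ F.rays)
    (hwv : 0 < det w v) : 0 ≤ det w u := by
  have := h.2.2.2 w hw
  rw [det_swap]
  by_contra hc
  exact this ⟨by linarith, hwv⟩

theorem Adj.right_unique {u v w : ℤ × ℤ} (h : F.Adj u v) (h' : F.Adj u w) : v = w := by
  have h1 := h.det_nonneg_right h'.2.1 h'.2.2.1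
  have h2 := h'.det_nonneg_right h.2.1 h.2.2.1
  rw [det_swap] at h2
  exact eq_of_det_eq_zero' h.2.1 h'.2.1 (by omega) h.2.2.1 h'.2.2.1.le

theorem Adj.left_unique {u v w : ℤ × ℤ} (h : F.Adj u w) (h' : F.Adj v w) : u = v := by
  have h1 := h.det_nonneg_left h'.1 h'.2.2.1
  have h2 := h'.det_nonneg_left h.1 h.2.2.1
  rw [det_swap] at h1
  exact eq_of_det_eq_zero h.1 h'.1 (by omega) h.2.2.1 h'.2.2.1.le

/-- A vector lies on a ray or in the interior of a two-dimensional cone. -/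
theorem exists_location (F : CompleteFan) {x : ℤ × ℤ} (hx : x ≠ 0) :
    (∃ w ∈ F.rays, det w x = 0 ∧ 0 < pairing w x) ∨
      ∃ u v, F.Adj u v ∧ 0 < det u x ∧ 0 < det x v := by
  by_cases hray : ∃ w ∈ F.rays, det w x = 0 ∧ 0 < pairing w x
  · exact Or.inl hray
  right
  -- The cone containing `x` is spanned by the ray `u` that precedes `x` most closely and the
  -- successor of `u`. If that successor did not lie beyond `x`, it would be closer to `x` or be the
  -- ray of `x`.
  obtain ⟨u, hu, hux, hu'⟩ := exists_nearest_right (F.exists_det_pos hx).1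
  obtain ⟨v, hv⟩ := exists_next hu
  refine ⟨u, v, hv, hux, ?_⟩
  by_contra hc
  have h1 : 0 ≤ det v x := by rw [det_swap]; omega
  rcases h1.lt_or_eq with h2 | h2
  · have h3 := hu' v hv.2.1 h2
    rw [det_swap] at h3
    linarith [hv.2.2.1]
  · refine hray ⟨v, hv.2.1, h2.symm, ?_⟩
    have h3 : pairing v x * det u v = det u x * (v.1 ^ 2 + v.2 ^ 2) - pairing v u * det v x := by
      simp only [pairing, det]; ring
    rw [← h2, mul_zero, sub_zero] at h3
    have h4 : 0 < v.1 ^ 2 + v.2 ^ 2 := by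
      have : v.1 ≠ 0 ∨ v.2 ≠ 0 := by
        by_contra! hc
        exact ne_zero hv.2.1 (Prod.ext hc.1 hc.2)
      rcases this with h | h <;> positivity
    exact pos_of_mul_pos_left (by rw [h3]; positivity) hv.2.2.1.le

/-- `c` is the cone of the fan whose relative interior contains `x`. -/
def IsCarrier (F : CompleteFan) (c : Finset (ℤ × ℤ)) (x : ℤ × ℤ) : Prop :=
  (c = ∅ ∧ x = 0) ∨ (∃ w ∈ F.rays, c = {w} ∧ det w x = 0 ∧ 0 < pairing w x) ∨
    ∃ u v, F.Adj u v ∧ c = {u, v} ∧ 0 < det u x ∧ 0 < det x v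

theorem IsCarrier.isCone {c : Finset (ℤ × ℤ)} {x : ℤ × ℤ} (h : F.IsCarrier c x) : F.IsCone c := by
  rcases h with ⟨rfl, -⟩ | ⟨w, hw, rfl, -⟩ | ⟨u, v, huv, rfl, -⟩
  exacts [Or.inl rfl, Or.inr (Or.inl ⟨w, hw, rfl⟩), Or.inr (Or.inr ⟨u, v, huv, rfl⟩)]

theorem exists_isCarrier (F : CompleteFan) (x : ℤ × ℤ) : ∃ c, F.IsCarrier c x := by
  by_cases hx : x = 0
  · exact ⟨∅, Or.inl ⟨rfl, hx⟩⟩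
  rcases F.exists_location hx with ⟨w, hw, h⟩ | ⟨u, v, huv, h⟩
  · exact ⟨{w}, Or.inr (Or.inl ⟨w, hw, rfl, h⟩)⟩
  · exact ⟨{u, v}, Or.inr (Or.inr ⟨u, v, huv, rfl, h⟩)⟩

end CompleteFan

/-- `x` lies in the cone generated by `c`. -/
def InCone (c : Finset (ℤ × ℤ)) (x : ℤ × ℤ) : Prop := ∀ m ∈ dualMonoid c, 0 ≤ pairing m x

/-- The two inequalities are the values of the inner normals of the edges, and these normals
generate the dual cone over the rationals. -/
theorem inCone_pair_iff {u v x : ℤ × ℤ} (huv : 0 < det u v) :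
    InCone {u, v} x ↔ 0 ≤ det u x ∧ 0 ≤ det x v := by
  constructor
  · intro h
    have h1 := h (-u.2, u.1) (by
      rw [mem_dualMonoid_pair]
      simp only [pairing, det] at huv ⊢
      constructor <;> linarith)
    have h2 := h (v.2, -v.1) (by
      rw [mem_dualMonoid_pair]
      simp only [pairing, det] at huv ⊢
      constructor <;> linarith)
    simp only [pairing, det] at h1 h2 ⊢
    constructor <;> linarith
  · rintro ⟨h1, h2⟩ m hm
    rw [mem_dualMonoid_pair] at hm
    have h3 : pairing m x * det u v = det x v * pairing m u + det u x * pairing m v := by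
      simp only [pairing, det]; ring
    refine nonneg_of_mul_nonneg_left ?_ huv
    rw [h3]
    exact add_nonneg (mul_nonneg h2 hm.1) (mul_nonneg h1 hm.2)

theorem inCone_singleton {w x : ℤ × ℤ} (hw : w ≠ 0) :
    InCone {w} x ↔ det w x = 0 ∧ 0 ≤ pairing w x := by
  have hmem : ∀ m, m ∈ dualMonoid {w} ↔ 0 ≤ pairing m w := fun m => by
    change (∀ v ∈ ({w} : Finset (ℤ × ℤ)), _) ↔ _
    simp
  have h4 : 0 < w.1 ^ 2 + w.2 ^ 2 := by
    have : w.1 ≠ 0 ∨ w.2 ≠ 0 := by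
      by_contra! hc
      exact hw (Prod.ext hc.1 hc.2)
    rcases this with h | h <;> positivity
  constructor
  · intro h
    have h1 := h (-w.2, w.1) ((hmem _).mpr (by simp only [pairing]; linarith))
    have h2 := h (w.2, -w.1) ((hmem _).mpr (by simp only [pairing]; linarith))
    have h3 := h w ((hmem _).mpr (by simp only [pairing]; linarith))
    refine ⟨?_, h3⟩
    simp only [pairing, det] at h1 h2 ⊢
    linarith
  · rintro ⟨h1, h2⟩ m hm
    rw [hmem] at hm
    have h3 : pairing m x * (w.1 ^ 2 + w.2 ^ 2) =
        pairing m w * pairing w x + det w m * det w x := by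
      simp only [pairing, det]; ring
    rw [h1, mul_zero, add_zero] at h3
    refine nonneg_of_mul_nonneg_left ?_ h4
    rw [h3]
    exact mul_nonneg hm h2

theorem inCone_empty {x : ℤ × ℤ} : InCone ∅ x ↔ x = 0 := by
  constructor
  · intro h
    have hm : ∀ m, m ∈ dualMonoid ∅ := fun m v hv => absurd hv (Finset.notMem_empty v)
    have h1 := h (1, 0) (hm _)
    have h2 := h (-1, 0) (hm _)
    have h3 := h (0, 1) (hm _)
    have h4 := h (0, -1) (hm _)
    simp only [pairing] at h1 h2 h3 h4
    exact Prod.ext (by change x.1 = 0; linarith) (by change x.2 = 0; linarith)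
  · rintro rfl m -
    simp [pairing]

namespace CompleteFan

variable {F : CompleteFan}

theorem IsCarrier.inCone {c : Finset (ℤ × ℤ)} {x : ℤ × ℤ} (h : F.IsCarrier c x) : InCone c x := by
  rcases h with ⟨rfl, h⟩ | ⟨w, hw, rfl, h⟩ | ⟨u, v, huv, rfl, h⟩
  · exact inCone_empty.mpr h
  · exact (inCone_singleton (ne_zero hw)).mpr ⟨h.1, h.2.le⟩
  · exact (inCone_pair_iff huv.2.2.1).mpr ⟨h.1.le, h.2.le⟩

theorem eq_of_inCone_ray {w v x : ℤ × ℤ} (hw : w ∈ F.rays) (hv : v ∈ F.rays) (h1 : det w x = 0)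
    (h2 : 0 < pairing w x) (h3 : det v x = 0) (h4 : 0 ≤ pairing v x) : w = v := by
  have e1 : det w v * (pairing w x) = pairing w w * det v x * -1 + pairing w v * det w x := by
    simp only [pairing, det]; ring
  rw [h1, h3, mul_zero, zero_mul, mul_zero, add_zero] at e1
  have e2 := (mul_eq_zero.mp e1).resolve_right h2.ne'
  rcases eq_or_eq_neg_of_det_eq_zero (F.primitive w hw) (F.primitive v hv) e2 with rfl | rfl
  · rfl
  · rw [pairing_neg] at h4
    linarith

/-- No ray meets the interior of a two-dimensional cone. -/
theorem Adj.false_of_ray {u v w x : ℤ × ℤ} (huv : F.Adj u v) (h1 : 0 < det u x) (h2 : 0 < det x v)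
    (hw : w ∈ F.rays) (h3 : det w x = 0) (h4 : 0 ≤ pairing w x) : False := by
  have hxx : x ≠ 0 := by
    rintro rfl
    simp [det] at h1
  have hxx' : 0 < pairing x x := by
    have : x.1 ≠ 0 ∨ x.2 ≠ 0 := by
      by_contra! hc
      exact hxx (Prod.ext hc.1 hc.2)
    simp only [pairing]
    rcases this with h | h
    · nlinarith [mul_self_pos.mpr h, mul_self_nonneg x.2]
    · nlinarith [mul_self_pos.mpr h, mul_self_nonneg x.1]
  have hpos : 0 < pairing w x := by
    rcases h4.lt_or_eq with h | h
    · exact h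
    · exfalso
      have e : pairing w w * pairing x x = pairing w x ^ 2 + det w x ^ 2 := by
        simp only [pairing, det]; ring
      rw [← h, h3] at e
      have : pairing w w = 0 := by
        rcases mul_eq_zero.mp (e.trans (by ring)) with h | h
        · exact h
        · exact absurd h hxx'.ne'
      simp only [pairing] at this
      refine ne_zero hw (Prod.ext ?_ ?_)
      · change w.1 = 0; nlinarith
      · change w.2 = 0; nlinarith
  have e1 : det u w * pairing x x = det u x * pairing w x - pairing u x * det w x := by
    simp only [pairing, det]; ring
  have e2 : det w v * pairing x x = det x v * pairing w x + pairing v x * det w x := by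
    simp only [pairing, det]; ring
  rw [h3, mul_zero, sub_zero] at e1
  rw [h3, mul_zero, add_zero] at e2
  exact huv.2.2.2 w hw ⟨pos_of_mul_pos_left (by rw [e1]; positivity) hxx'.le,
    pos_of_mul_pos_left (by rw [e2]; positivity) hxx'.le⟩

/-- The carrier of a vector is the smallest cone that contains the vector. -/
theorem IsCarrier.subset {c d : Finset (ℤ × ℤ)} {x : ℤ × ℤ} (h : F.IsCarrier c x)
    (hd : F.IsCone d) (hx : InCone d x) : c ⊆ d := by
  rcases h with ⟨rfl, h⟩ | ⟨w, hw, rfl, h1, h2⟩ | ⟨u, v, huv, rfl, h1, h2⟩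
  · exact Finset.empty_subset _
  · rw [Finset.singleton_subset_iff]
    rcases hd with rfl | ⟨v, hv, rfl⟩ | ⟨a, b, hab, rfl⟩
    · rw [inCone_empty] at hx
      subst hx
      simp [pairing] at h2
    · rw [inCone_singleton (ne_zero hv)] at hx
      rw [Finset.mem_singleton]
      exact eq_of_inCone_ray hw hv h1 h2 hx.1 hx.2
    · rw [inCone_pair_iff hab.2.2.1] at hx
      have hww : 0 < pairing w w := by
        have : w.1 ≠ 0 ∨ w.2 ≠ 0 := by
          by_contra! hc
          exact ne_zero hw (Prod.ext hc.1 hc.2)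
        simp only [pairing]
        rcases this with h | h
        · nlinarith [mul_self_pos.mpr h, mul_self_nonneg w.2]
        · nlinarith [mul_self_pos.mpr h, mul_self_nonneg w.1]
      have e1 : det a x * pairing w w = det a w * pairing w x + pairing a w * det w x := by
        simp only [pairing, det]; ring
      have e2 : det x b * pairing w w = det w b * pairing w x - pairing b w * det w x := by
        simp only [pairing, det]; ring
      rw [h1, mul_zero, add_zero] at e1
      rw [h1, mul_zero, sub_zero] at e2
      have h3 : 0 ≤ det a w :=
        nonneg_of_mul_nonneg_left (by rw [← e1]; exact mul_nonneg hx.1 hww.le) h2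
      have h4 : 0 ≤ det w b :=
        nonneg_of_mul_nonneg_left (by rw [← e2]; exact mul_nonneg hx.2 hww.le) h2
      have h5 := hab.2.2.2 w hw
      simp only [Finset.mem_insert, Finset.mem_singleton]
      rcases h3.lt_or_eq with h6 | h6
      · right
        exact (eq_of_det_eq_zero' (x := a) hab.2.1 hw (by
          rw [det_swap, neg_eq_zero]
          by_contra hc
          exact h5 ⟨h6, by omega⟩) hab.2.2.1 h3).symm
      · left
        exact (eq_of_det_eq_zero hab.1 hw h6.symm hab.2.2.1 h4).symm
  · rcases hd with rfl | ⟨w, hw, rfl⟩ | ⟨a, b, hab, rfl⟩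
    · rw [inCone_empty] at hx
      subst hx
      simp [det] at h1
    · rw [inCone_singleton (ne_zero hw)] at hx
      exact (huv.false_of_ray h1 h2 hw hx.1 hx.2).elim
    · rw [inCone_pair_iff hab.2.2.1] at hx
      have hu : u = a := by
        have hua : det u a ≤ 0 := by
          by_contra hc
          refine huv.2.2.2 a hab.1 ⟨by omega, ?_⟩
          have := det_mul_det u a x v
          exact pos_of_mul_pos_right (a := det u x) (by
            have h3 := mul_pos (show 0 < det u a by omega) h2
            have h4 := mul_nonneg huv.2.2.1.le hx.1
            linarith) h1.le
        have hau : det a u ≤ 0 := by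
          by_contra hc
          refine hab.2.2.2 u huv.1 ⟨by omega, ?_⟩
          have := det_mul_det a u x b
          exact pos_of_mul_pos_right (a := det a x) (by
            have h3 := mul_nonneg (show 0 ≤ det a u by omega) hx.2
            have h4 := mul_pos hab.2.2.1 h1
            linarith) hx.1
        rw [det_swap] at hau
        exact eq_of_det_eq_zero huv.1 hab.1 (by omega) h1 hx.1
      have hv : v = b := by
        subst hu
        exact huv.right_unique hab
      rw [hu, hv]

end CompleteFan
end ToricSurface

/-! ### Toric morphisms of refinements -/

namespace ToricSurface

theorem pairing_add_right (m v w : ℤ × ℤ) : pairing m (v + w) = pairing m v + pairing m w := by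
  simp only [pairing, Prod.fst_add, Prod.snd_add]; ring

theorem InCone.sum {c d : Finset (ℤ × ℤ)} (h : ∀ v ∈ d, InCone c v) : InCone c (∑ v ∈ d, v) := by
  intro m hm
  have h1 : pairing m (∑ v ∈ d, v) = ∑ v ∈ d, pairing m v :=
    map_sum (AddMonoidHom.mk' (fun v => pairing m v) (pairing_add_right m)) _ _
  rw [h1]
  exact Finset.sum_nonneg fun v hv => h v hv m hm

namespace CompleteFan

/-- The cone of `F` that contains the interior of a cone of a refinement contains the cone. -/
theorem IsCarrier.inCone_of_mem {F F' : CompleteFan} (hF : F.rays ⊆ F'.rays) (c : F'.Cone)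
    {d : Finset (ℤ × ℤ)} (hd : F.IsCarrier d (∑ v ∈ c.1, v)) : ∀ v ∈ c.1, InCone d v := by
  obtain ⟨c, rfl | ⟨v, hv, rfl⟩ | ⟨u, v, huv, rfl⟩⟩ := c
  · simp
  · intro w hw
    rw [Finset.mem_singleton] at hw
    subst hw
    have := hd.inCone
    rwa [Finset.sum_singleton] at this
  · have huv' : u ≠ v := by
      rintro rfl
      have := huv.2.2.1
      rw [det_self] at this
      exact lt_irrefl _ this
    rw [Finset.sum_pair huv'] at hd
    have h1 : 0 < det u (u + v) := by
      rw [det_add_right, det_self, zero_add]; exact huv.2.2.1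
    have h2 : 0 < det (u + v) v := by
      rw [det_add_left, det_self, add_zero]; exact huv.2.2.1
    rcases hd with ⟨-, h⟩ | ⟨w, hw, -, h3, h4⟩ | ⟨a, b, hab, rfl, h3, h4⟩
    · rw [h] at h1
      simp [det] at h1
    · exact (huv.false_of_ray h1 h2 (hF hw) h3 h4.le).elim
    · have hau : 0 ≤ det a u := by
        by_contra hc
        have hc' : 0 < det u a := by rw [det_swap]; omega
        refine huv.2.2.2 a (hF hab.1) ⟨hc', ?_⟩
        have := det_mul_det u a (u + v) v
        exact pos_of_mul_pos_right (a := det u (u + v)) (by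
          have h5 := mul_pos hc' h2
          have h6 := mul_pos huv.2.2.1 h3
          linarith) h1.le
      have hvb : 0 ≤ det v b := by
        by_contra hc
        have hc' : 0 < det b v := by rw [det_swap]; omega
        refine huv.2.2.2 b (hF hab.2.1) ⟨?_, hc'⟩
        have := det_mul_det u (u + v) b v
        exact pos_of_mul_pos_left (b := det (u + v) v) (by
          have h5 := mul_pos h1 hc'
          have h6 := mul_pos huv.2.2.1 h4
          linarith) h2.le
      have hav : 0 ≤ det a v := by
        have h5 := det_mul_det a (u + v) v b
        have h6 := mul_nonneg h3.le hvb
        have h7 := mul_pos hab.2.2.1 h2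
        exact (pos_of_mul_pos_left (b := det (u + v) b) (by linarith) h4.le).le
      have hub : 0 ≤ det u b := by
        have h5 := det_mul_det a u (u + v) b
        have h6 := mul_nonneg hau h4.le
        have h7 := mul_pos hab.2.2.1 h1
        exact (pos_of_mul_pos_right (a := det a (u + v)) (by linarith) h3.le).le
      intro w hw
      simp only [Finset.mem_insert, Finset.mem_singleton] at hw
      rw [inCone_pair_iff hab.2.2.1]
      rcases hw with rfl | rfl
      exacts [⟨hau, hub⟩, ⟨hav, hvb⟩]

end CompleteFan

section refinement

variable (k : Type u) [Field k]

/-- The morphism of affine toric surfaces of an inclusion of cones. -/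
noncomputable def coneMap {c d : Finset (ℤ × ℤ)} (h : dualMonoid d ≤ dualMonoid c) :
    chart k c ⟶ chart k d :=
  Spec.map (CommRingCat.ofHom (AddMonoidAlgebra.mapDomainRingHom k (AddSubmonoid.inclusion h)))

theorem chartIncl_eq_coneMap {c d : Finset (ℤ × ℤ)} (h : c ⊆ d) :
    chartIncl k h = coneMap k (dualMonoid_anti h) := rfl

theorem coneMap_comp {c d e : Finset (ℤ × ℤ)} (h₁ : dualMonoid d ≤ dualMonoid c)
    (h₂ : dualMonoid e ≤ dualMonoid d) :
    coneMap k h₁ ≫ coneMap k h₂ = coneMap k (h₂.trans h₁) := by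
  have : (AddMonoidAlgebra.mapDomainRingHom k (AddSubmonoid.inclusion h₁)).comp
      (AddMonoidAlgebra.mapDomainRingHom k (AddSubmonoid.inclusion h₂)) =
      AddMonoidAlgebra.mapDomainRingHom k (AddSubmonoid.inclusion (h₂.trans h₁)) :=
    (AddMonoidAlgebra.mapDomainRingHom_comp _ _).symm
  rw [coneMap, coneMap, ← Spec.map_comp, ← CommRingCat.ofHom_comp, this]
  rfl

theorem coneMap_str {c d : Finset (ℤ × ℤ)} (h : dualMonoid d ≤ dualMonoid c) :
    coneMap k h ≫ chartStr k d = chartStr k c := by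
  have : (AddMonoidAlgebra.mapDomainRingHom k (AddSubmonoid.inclusion h)).comp
      (algebraMap k (ChartRing k d)) = algebraMap k (ChartRing k c) :=
    AddMonoidAlgebra.mapDomainRingHom_comp_algebraMap _
  rw [coneMap, chartStr, ← Spec.map_comp, ← CommRingCat.ofHom_comp, this]
  rfl

/-- A refinement of fans induces a toric morphism. -/
theorem exists_isToric {F F' : CompleteFan} (hF : F.rays ⊆ F'.rays) :
    ∃ π : toricSurface k F' ⟶ toricSurface k F, IsToric k π := by
  -- A cone of the refinement is sent to the cone of `F` whose interior contains the sum of its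
  -- generators.
  choose τ hτ using fun c : F'.Cone => F.exists_isCarrier (∑ v ∈ c.1, v)
  have hmem := fun c => (hτ c).inCone_of_mem hF c
  have hle : ∀ c : F'.Cone, dualMonoid (τ c) ≤ dualMonoid c.1 :=
    fun c m hm v hv => hmem c v hv m hm
  -- Minimality of the carrier makes the assignment monotone, so the maps on charts glue.
  have hmono : ∀ c d : F'.Cone, c.1 ⊆ d.1 → τ c ⊆ τ d := fun c d h =>
    (hτ c).subset (hτ d).isCone (InCone.sum fun v hv => hmem d v (h hv))
  have hι : ∀ (c d : F.Cone) (h : c.1 ⊆ d.1), chartIncl k h ≫ chartι k F d = chartι k F c :=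
    (toricAtlas k F).incl_map
  have hnat : ∀ (c d : F'.Cone) (h : c.1 ⊆ d.1),
      chartIncl k h ≫ coneMap k (hle d) ≫ chartι k F ⟨τ d, (hτ d).isCone⟩ =
        coneMap k (hle c) ≫ chartι k F ⟨τ c, (hτ c).isCone⟩ := by
    intro c d h
    rw [← hι ⟨τ c, (hτ c).isCone⟩ ⟨τ d, (hτ d).isCone⟩ (hmono c d h), chartIncl_eq_coneMap,
      chartIncl_eq_coneMap, ← Category.assoc, coneMap_comp, ← Category.assoc, coneMap_comp]
  obtain ⟨g, hg⟩ : ∃ g : (toricSurface k F').left ⟶ (toricSurface k F).left,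
      ∀ c, chartι k F' c ≫ g = coneMap k (hle c) ≫ chartι k F ⟨τ c, (hτ c).isCone⟩ :=
    ⟨colimit.desc (chartFunctor k F')
      { pt := (toricSurface k F).left
        ι :=
          { app := fun c => coneMap k (hle c) ≫ chartι k F ⟨τ c, (hτ c).isCone⟩
            naturality := fun c d f =>
              (hnat c d (leOfHom f)).trans (Category.comp_id _).symm } },
      fun c => colimit.ι_desc _ _⟩
  refine ⟨Over.homMk g ?_, ?_⟩
  · refine colimit.hom_ext fun c => ?_
    change chartι k F' c ≫ g ≫ (toricSurface k F).hom = chartι k F' c ≫ (toricSurface k F').hom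
    rw [← Category.assoc, hg, Category.assoc, chartι_str, chartι_str, coneMap_str]
  · change chartι k F' F'.zeroCone ≫ g = chartι k F F.zeroCone
    rw [hg]
    exact hι F.zeroCone ⟨τ F'.zeroCone, (hτ _).isCone⟩ (Finset.empty_subset _)

end refinement
end ToricSurface

namespace ToricSurface

/-! ### Weighted projective planes as toric surfaces -/

/-- The rings of functions on the charts of `Proj` and of the toric surface are identified as the
same subring of the coordinate ring of the torus. -/
theorem exists_ringEquiv_of_range_eq {A B C : Type*} [CommRing A] [CommRing B] [CommRing C]
    {f : A →+* C} {g : B →+* C} (hf : Function.Injective f) (hg : Function.Injective g)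
    (h : f.range = g.range) : ∃ e : A ≃+* B, ∀ a, g (e a) = f a := by
  have hf' : Function.Bijective f.rangeRestrict :=
    ⟨fun a b hab => hf (congrArg Subtype.val hab), f.rangeRestrict_surjective⟩
  have hg' : Function.Bijective g.rangeRestrict :=
    ⟨fun a b hab => hg (congrArg Subtype.val hab), g.rangeRestrict_surjective⟩
  refine ⟨((RingEquiv.ofBijective _ hf').trans (RingEquiv.subringCongr h)).trans
    (RingEquiv.ofBijective _ hg').symm, fun a => ?_⟩
  have h1 := (RingEquiv.ofBijective _ hg').apply_symm_apply
    (RingEquiv.subringCongr h (RingEquiv.ofBijective _ hf' a))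
  exact congrArg Subtype.val h1

/-- Ray generators `u i` with a relation with coefficients `w i`, and characters `χ i` which define
a section of the map from characters to their values on the `u i`. -/
structure CoxData (w : Fin 3 → ℕ) (u χ : Fin 3 → ℤ × ℤ) : Prop where
  pos : ∀ i, 0 < w i
  rel : ∀ m, ∑ i, pairing m (u i) * w i = 0
  sec : ∀ e : Fin 3 → ℤ, ∑ i, e i * w i = 0 → ∀ i, pairing (∑ j, e j • χ j) (u i) = e i
  ext : ∀ m m', (∀ i, pairing m (u i) = pairing m' (u i)) → m = m'

theorem chartMap_comp (k : Type u) [Field k] {c d e : Finset (ℤ × ℤ)} (h₁ : c ⊆ d) (h₂ : d ⊆ e) :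
    (chartMap k h₁).comp (chartMap k h₂) = chartMap k (h₁.trans h₂) :=
  (AddMonoidAlgebra.mapDomainRingHom_comp _ _).symm

section cox

variable (k : Type u) [Field k] (w : Fin 3 → ℕ) (u χ : Fin 3 → ℤ × ℤ)

theorem monomial_nsmul (n : ℕ) (m : ℤ × ℤ) : monomial k (n • m) = monomial k m ^ n := by
  induction n with
  | zero => rw [zero_smul, monomial_zero, pow_zero]
  | succ n ih => rw [succ_nsmul, monomial_add, ih, pow_succ]

/-- The exponents of the product of the variables of the rays that do not belong to a cone. -/
noncomputable def coxExponent (c : Finset (ℤ × ℤ)) : Fin 3 →₀ ℕ :=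
  Finsupp.equivFunOnFinite.symm fun i => if u i ∈ c then 0 else 1

theorem coxExponent_apply (c : Finset (ℤ × ℤ)) (i : Fin 3) :
    coxExponent u c i = if u i ∈ c then 0 else 1 := rfl

/-- The product of the variables of the rays that do not belong to a cone. -/
noncomputable def coxMonomial (c : Finset (ℤ × ℤ)) : MvPolynomial (Fin 3) k :=
  MvPolynomial.monomial (coxExponent u c) 1

/-- The degree of a monomial. -/
noncomputable abbrev coxDegree (e : Fin 3 →₀ ℕ) : ℕ := Finsupp.weight w e

theorem monomial_mem_weightedGrading (e : Fin 3 →₀ ℕ) (r : k) :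
    MvPolynomial.monomial e r ∈ weightedGrading k w (coxDegree w e) :=
  MvPolynomial.isWeightedHomogeneous_monomial w e r rfl

/-- The character of an exponent vector. -/
def coxChar (e : Fin 3 → ℤ) : ℤ × ℤ := ∑ j, e j • χ j

theorem coxChar_sub (e e' : Fin 3 → ℤ) : coxChar χ (e - e') = coxChar χ e - coxChar χ e' := by
  simp only [coxChar, Pi.sub_apply, sub_smul, Finset.sum_sub_distrib]

/-- The integer exponents of a monomial. -/
def intExponent (e : Fin 3 →₀ ℕ) : Fin 3 → ℤ := fun i => e i

/-- The substitution of Laurent monomials for the variables. -/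
noncomputable def dehomogenize : MvPolynomial (Fin 3) k →ₐ[k] ChartRing k ∅ :=
  MvPolynomial.aeval fun i => monomial k (χ i)

theorem dehomogenize_monomial (e : Fin 3 →₀ ℕ) (r : k) :
    dehomogenize k χ (MvPolynomial.monomial e r) =
      algebraMap k _ r * monomial k (coxChar χ (intExponent e)) := by
  rw [dehomogenize, MvPolynomial.aeval_monomial]
  congr 1
  rw [Finsupp.prod_fintype _ _ fun i => pow_zero _, Fin.prod_univ_three]
  simp only [coxChar, intExponent, Fin.sum_univ_three, natCast_zsmul, monomial_add, monomial_nsmul]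

theorem isUnit_monomial (m : ℤ × ℤ) : IsUnit (monomial k m) :=
  IsUnit.of_mul_eq_one (monomial k (-m)) (by rw [← monomial_add, add_neg_cancel, monomial_zero])

theorem dehomogenize_coxMonomial (c : Finset (ℤ × ℤ)) :
    dehomogenize k χ (coxMonomial k u c) = monomial k (coxChar χ (intExponent (coxExponent u c))) := by
  rw [coxMonomial, dehomogenize_monomial, map_one, one_mul]

theorem isUnit_dehomogenize (c : Finset (ℤ × ℤ)) :
    IsUnit ((dehomogenize k χ : MvPolynomial (Fin 3) k →+* ChartRing k ∅) (coxMonomial k u c)) := by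
  change IsUnit (dehomogenize k χ (coxMonomial k u c))
  rw [dehomogenize_coxMonomial]
  exact isUnit_monomial k _

/-- The ring of functions on the basic open set of a cone. -/
noncomputable abbrev CoxAway (c : Finset (ℤ × ℤ)) : Type u :=
  HomogeneousLocalization.Away (weightedGrading k w) (coxMonomial k u c)

/-- Functions on a basic open set as functions on the torus. -/
noncomputable def coxToTorus (c : Finset (ℤ × ℤ)) : CoxAway k w u c →+* ChartRing k ∅ :=
  (Localization.awayLift (dehomogenize k χ : MvPolynomial (Fin 3) k →+* ChartRing k ∅) _
    (isUnit_dehomogenize k u χ c)).comp (algebraMap _ (Localization.Away (coxMonomial k u c)))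

theorem coxMonomial_mem (c : Finset (ℤ × ℤ)) :
    coxMonomial k u c ∈ weightedGrading k w (coxDegree w (coxExponent u c)) :=
  monomial_mem_weightedGrading k w _ _

theorem coxToTorus_mk (c : Finset (ℤ × ℤ)) (n : ℕ) (a : MvPolynomial (Fin 3) k)
    (ha : a ∈ weightedGrading k w (n • coxDegree w (coxExponent u c))) :
    coxToTorus k w u χ c (HomogeneousLocalization.Away.mk _ (coxMonomial_mem k w u c) n a ha) =
      dehomogenize k χ a * monomial k (-(n • coxChar χ (intExponent (coxExponent u c)))) := by
  have hv : (dehomogenize k χ : MvPolynomial (Fin 3) k →+* ChartRing k ∅) (coxMonomial k u c) *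
      monomial k (-coxChar χ (intExponent (coxExponent u c))) = 1 := by
    change dehomogenize k χ (coxMonomial k u c) * _ = 1
    rw [dehomogenize_coxMonomial, ← monomial_add, add_neg_cancel, monomial_zero]
  rw [← smul_neg, monomial_nsmul]
  exact Localization.awayLift_mk _ _ a _ hv n

variable {w u χ}

theorem CoxData.coxDegree_pos (H : CoxData w u χ) {c : Finset (ℤ × ℤ)} (hc : ∃ i, u i ∉ c) :
    0 < coxDegree w (coxExponent u c) := by
  obtain ⟨i, hi⟩ := hc
  rw [coxDegree, Finsupp.weight_eq_sum]
  refine Finset.sum_pos' (fun _ _ => Nat.zero_le _) ⟨i, Finset.mem_univ i, ?_⟩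
  rw [coxExponent_apply, if_neg hi, one_smul]
  exact H.pos i

/-- The difference of the exponents has degree zero, which is the case in which `sec` recovers the
exponents from the character. Dehomogenizing thus loses no information on fractions of degree zero.
-/
theorem CoxData.pairing_coxChar (H : CoxData w u χ) {e e' : Fin 3 →₀ ℕ} {n : ℕ}
    (h : coxDegree w e = n • coxDegree w e') (i : Fin 3) :
    pairing (coxChar χ (intExponent e) - n • coxChar χ (intExponent e')) (u i) = e i - n * e' i := by
  have h1 : coxChar χ (intExponent e) - n • coxChar χ (intExponent e') =
      coxChar χ (intExponent e - n • intExponent e') := by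
    rw [coxChar_sub]
    congr 1
    simp only [coxChar, Finset.smul_sum, Pi.smul_apply, smul_assoc]
  rw [h1]
  refine (H.sec _ ?_ i).trans ?_
  · rw [coxDegree, coxDegree, Finsupp.weight_eq_sum, Finsupp.weight_eq_sum] at h
    simp only [Fin.sum_univ_three, smul_eq_mul] at h
    have h2 := congrArg (Nat.cast : ℕ → ℤ) h
    push_cast at h2
    simp only [Fin.sum_univ_three, intExponent, Pi.sub_apply, Pi.smul_apply]
    simp only [nsmul_eq_mul]
    linear_combination h2
  · simp [intExponent]

theorem dehomogenize_eq_sum (a : MvPolynomial (Fin 3) k) : dehomogenize k χ a =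
    ∑ e ∈ a.support, AddMonoidAlgebra.single (torusChar (coxChar χ (intExponent e))) (a.coeff e) := by
  conv_lhs => rw [a.as_sum, map_sum]
  refine Finset.sum_congr rfl fun e _ => ?_
  rw [dehomogenize_monomial, ← Algebra.smul_def, monomial, AddMonoidAlgebra.smul_single,
    smul_eq_mul, mul_one]

/-- Distinct monomials of the same degree have distinct characters, so no cancellation can occur in
the image of a homogeneous numerator. -/
theorem CoxData.coxToTorus_injective (H : CoxData w u χ) (c : Finset (ℤ × ℤ)) :
    Function.Injective (coxToTorus k w u χ c) := by
  rw [injective_iff_map_eq_zero]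
  intro z hz
  obtain ⟨n, a, ha, rfl⟩ := HomogeneousLocalization.Away.mk_surjective _ (coxMonomial_mem k w u c) z
  have h1 := coxToTorus_mk k w u χ c n a ha
  rw [hz] at h1
  replace h1 := ((isUnit_monomial k _).mul_left_eq_zero.mp h1.symm)
  have ha0 : a = 0 := by
    by_contra hne
    obtain ⟨e, he⟩ := MvPolynomial.support_nonempty.mpr hne
    refine MvPolynomial.mem_support_iff.mp he ?_
    rw [dehomogenize_eq_sum] at h1
    have h2 := congrArg
      (fun f : ChartRing k ∅ => f.coeff (torusChar (coxChar χ (intExponent e)))) h1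
    simp only [AddMonoidAlgebra.coeff_sum, Finsupp.finsetSum_apply,
      AddMonoidAlgebra.coeff_single] at h2
    rw [Finset.sum_eq_single e] at h2
    · simpa using h2
    · intro e' he' hne'
      rw [Finsupp.single_apply, if_neg]
      intro h
      have h3 : coxChar χ (intExponent e') = coxChar χ (intExponent e) := congrArg Subtype.val h
      refine hne' (Finsupp.ext fun i => ?_)
      have d1 := H.pairing_coxChar (ha (MvPolynomial.mem_support_iff.mp he)) i
      have d2 := H.pairing_coxChar (ha (MvPolynomial.mem_support_iff.mp he')) i
      rw [h3, d1] at d2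
      omega
    · exact fun h => absurd he h
  subst ha0
  apply HomogeneousLocalization.val_injective
  rw [HomogeneousLocalization.Away.val_mk, Localization.mk_zero, HomogeneousLocalization.val_zero]

/-- A character `m` corresponds to the Laurent monomial with exponents `pairing m (u i)`, of degree
zero by `rel`. It is a fraction with a power of `coxMonomial` as denominator exactly if the
exponents at the rays of the cone are nonnegative. -/
theorem CoxData.range_coxToTorus (H : CoxData w u χ) {c : Finset (ℤ × ℤ)}
    (hc : ∀ v ∈ c, ∃ i, u i = v) : (coxToTorus k w u χ c).range = (toTorus k c).range := by
  have hsingle : ∀ m r, AddMonoidAlgebra.single (torusChar m) r =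
      algebraMap k (ChartRing k ∅) r * monomial k m := fun m r => by
    rw [← Algebra.smul_def, monomial, AddMonoidAlgebra.smul_single, smul_eq_mul, mul_one]
  apply le_antisymm
  · rintro _ ⟨z, rfl⟩
    obtain ⟨n, a, ha, rfl⟩ :=
      HomogeneousLocalization.Away.mk_surjective _ (coxMonomial_mem k w u c) z
    rw [coxToTorus_mk, dehomogenize_eq_sum, Finset.sum_mul]
    refine sum_mem fun e he => ?_
    have hm : coxChar χ (intExponent e) - n • coxChar χ (intExponent (coxExponent u c)) ∈
        dualMonoid c := by
      intro v hv
      obtain ⟨i, rfl⟩ := hc v hv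
      rw [H.pairing_coxChar (ha (MvPolynomial.mem_support_iff.mp he)) i, coxExponent_apply,
        if_pos hv]
      simp
    refine ⟨AddMonoidAlgebra.single ⟨_, hm⟩ (a.coeff e), ?_⟩
    rw [chartMap_single, hsingle, mul_assoc, ← monomial_add, ← sub_eq_add_neg, ← hsingle]
    rfl
  · rintro _ ⟨g, rfl⟩
    rw [← AddMonoidAlgebra.sum_coeff_single g, Finsupp.sum, map_sum]
    refine sum_mem fun m _ => ?_
    -- This power of the denominator is large enough to make all exponents at the rays outside the
    -- cone nonnegative.
    let n : ℕ := ∑ j, (pairing m (u j)).natAbs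
    let e : Fin 3 →₀ ℕ := Finsupp.equivFunOnFinite.symm fun i =>
      (pairing m (u i) + n * coxExponent u c i).toNat
    have he : ∀ i, (e i : ℤ) = pairing m (u i) + n * coxExponent u c i := by
      intro i
      refine Int.toNat_of_nonneg ?_
      rw [coxExponent_apply]
      split_ifs with h
      · have : 0 ≤ pairing m (u i) := m.2 _ h
        simpa using this
      · have h1 : (pairing m (u i)).natAbs ≤ n :=
          Finset.single_le_sum (f := fun j => (pairing m (u j)).natAbs)
            (fun _ _ => Nat.zero_le _) (Finset.mem_univ i)
        push_cast
        omega
    have hdeg : coxDegree w e = n • coxDegree w (coxExponent u c) := by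
      rw [coxDegree, coxDegree, Finsupp.weight_eq_sum, Finsupp.weight_eq_sum]
      have h1 := H.rel m
      simp only [Fin.sum_univ_three, smul_eq_mul] at h1 ⊢
      zify
      rw [he, he, he]
      linear_combination h1
    refine ⟨HomogeneousLocalization.Away.mk _ (coxMonomial_mem k w u c) n
      (MvPolynomial.monomial e (g.coeff m)) (hdeg ▸ monomial_mem_weightedGrading k w e _), ?_⟩
    have hm : coxChar χ (intExponent e) - n • coxChar χ (intExponent (coxExponent u c)) = m := by
      refine H.ext _ _ fun i => ?_
      rw [H.pairing_coxChar hdeg, he]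
      ring
    rw [coxToTorus_mk, dehomogenize_monomial, mul_assoc, ← monomial_add, ← sub_eq_add_neg, hm,
      ← hsingle, chartMap_single]
    rfl

theorem CoxData.exists_equiv (H : CoxData w u χ) {c : Finset (ℤ × ℤ)}
    (hc : ∀ v ∈ c, ∃ i, u i = v) :
    ∃ e : CoxAway k w u c ≃+* ChartRing k c, ∀ z, toTorus k c (e z) = coxToTorus k w u χ c z :=
  exists_ringEquiv_of_range_eq (H.coxToTorus_injective k c) (toTorus_injective c)
    (H.range_coxToTorus k hc)

theorem coxMonomial_eq_mul {c d : Finset (ℤ × ℤ)} (h : c ⊆ d) :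
    coxMonomial k u c = coxMonomial k u d *
      MvPolynomial.monomial (coxExponent u c - coxExponent u d) 1 := by
  rw [coxMonomial, coxMonomial, MvPolynomial.monomial_mul, one_mul]
  congr 2
  refine Finsupp.ext fun i => ?_
  rw [Finsupp.add_apply, Finsupp.tsub_apply, coxExponent_apply, coxExponent_apply]
  by_cases h1 : u i ∈ c
  · simp [h1, h h1]
  · by_cases h2 : u i ∈ d <;> simp [h1, h2]

/-- This places the intersection of the basic open sets of `c` and `d` inside that of their common
face. -/
theorem coxMonomial_inter_dvd (c d : Finset (ℤ × ℤ)) :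
    coxMonomial k u (c ∩ d) ∣ coxMonomial k u c * coxMonomial k u d := by
  refine ⟨MvPolynomial.monomial (coxExponent u c + coxExponent u d - coxExponent u (c ∩ d)) 1, ?_⟩
  rw [coxMonomial, coxMonomial, coxMonomial, MvPolynomial.monomial_mul, MvPolynomial.monomial_mul]
  congr 2
  refine Finsupp.ext fun i => ?_
  rw [Finsupp.add_apply, Finsupp.add_apply, Finsupp.tsub_apply, Finsupp.add_apply,
    coxExponent_apply, coxExponent_apply, coxExponent_apply]
  by_cases h1 : u i ∈ c <;> by_cases h2 : u i ∈ d <;> simp [h1, h2]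

/-- Both sides are lifts of the same substitution on polynomials to a localization, so they agree by
uniqueness of lifts. -/
theorem coxToTorus_awayMap {c d : Finset (ℤ × ℤ)} (h : c ⊆ d) (z : CoxAway k w u d) :
    coxToTorus k w u χ c (HomogeneousLocalization.awayMap (weightedGrading k w)
      (monomial_mem_weightedGrading k w (coxExponent u c - coxExponent u d) 1)
      (coxMonomial_eq_mul k h) z) = coxToTorus k w u χ d z := by
  obtain ⟨n, a, ha, rfl⟩ :=
    HomogeneousLocalization.Away.mk_surjective _ (coxMonomial_mem k w u d) z
  have hval : ∀ (c : Finset (ℤ × ℤ)) (z : CoxAway k w u c),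
      coxToTorus k w u χ c z = Localization.awayLift
        (dehomogenize k χ : MvPolynomial (Fin 3) k →+* ChartRing k ∅) _
        (isUnit_dehomogenize k u χ c) z.val := fun _ _ => rfl
  rw [hval, hval, HomogeneousLocalization.val_awayMap]
  generalize (HomogeneousLocalization.Away.mk (weightedGrading k w) _ n a ha).val = y
  have h1 : (Localization.awayLift
        (dehomogenize k χ : MvPolynomial (Fin 3) k →+* ChartRing k ∅) _
        (isUnit_dehomogenize k u χ c)).comp
      (Localization.awayLift (algebraMap _ (Localization.Away (coxMonomial k u c)))
        (coxMonomial k u d) (isUnit_of_dvd_unit (map_dvd _ ⟨_, coxMonomial_eq_mul k h⟩)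
          (IsLocalization.Away.algebraMap_isUnit (coxMonomial k u c)))) =
      Localization.awayLift
        (dehomogenize k χ : MvPolynomial (Fin 3) k →+* ChartRing k ∅) _
        (isUnit_dehomogenize k u χ d) := by
    refine IsLocalization.ringHom_ext (Submonoid.powers (coxMonomial k u d)) ?_
    ext x <;> simp [Localization.awayLift]
  exact DFunLike.congr_fun h1 y

/-- The standard charts of a weighted projective plane. -/
theorem CoxData.nonempty_iso (H : CoxData w u χ) (hu : Function.Injective u) (F : CompleteFan)
    (hF : ∀ c, F.IsCone c ↔ (∀ v ∈ c, ∃ i, u i = v) ∧ ∃ i, u i ∉ c) :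
    Nonempty (toricSurface k F ≅ weightedProjectivePlane k w) := by
  choose e he using fun c : F.Cone => H.exists_equiv k (c := c.1) ((hF c.1).mp c.2).1
  have hpos := fun c : F.Cone => H.coxDegree_pos ((hF c.1).mp c.2).2
  let ι (c : F.Cone) : Spec (.of (CoxAway k w u c.1)) ⟶ Proj (weightedGrading k w) :=
    Proj.awayι _ _ (coxMonomial_mem k w u c.1) (hpos c)
  let E (c : F.Cone) : chart k c.1 ⟶ Spec (.of (CoxAway k w u c.1)) :=
    Spec.map (CommRingCat.ofHom (e c).toRingHom)
  have hE : ∀ c, IsIso (E c) := fun c => by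
    have : IsIso (CommRingCat.ofHom (e c).toRingHom) := (e c).toCommRingCatIso.isIso_hom
    infer_instance
  have hrange : ∀ c, Set.range (E c ≫ ι c) =
      (Proj.basicOpen (weightedGrading k w) (coxMonomial k u c.1) : Set (Proj _)) := by
    intro c
    have h1 := Proj.opensRange_awayι _ _ (coxMonomial_mem k w u c.1) (hpos c)
    rw [← h1, ← Scheme.Hom.opensRange_comp_of_isIso (E c)]
    rfl
  have hincl : ∀ (c d : F.Cone) (h : c.1 ⊆ d.1), chartIncl k h ≫ E d ≫ ι d = E c ≫ ι c := by
    intro c d h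
    have h1 : Spec.map (CommRingCat.ofHom (HomogeneousLocalization.awayMap (weightedGrading k w)
        (monomial_mem_weightedGrading k w (coxExponent u c.1 - coxExponent u d.1) 1)
        (coxMonomial_eq_mul k h))) ≫ ι d = ι c :=
      Proj.SpecMap_awayMap_awayι _ _ _ _ _
    rw [← h1, ← Category.assoc, ← Category.assoc]
    congr 1
    simp only [E, chartIncl]
    rw [← Spec.map_comp, ← Spec.map_comp, ← CommRingCat.ofHom_comp, ← CommRingCat.ofHom_comp]
    congr 2
    refine RingHom.ext fun z => toTorus_injective c.1 ?_
    change toTorus k c.1 (chartMap k h (e d z)) = toTorus k c.1 (e c _)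
    rw [he, coxToTorus_awayMap k h, ← he]
    exact DFunLike.congr_fun (chartMap_comp k (Finset.empty_subset c.1) h) (e d z)
  have hopen : ∀ c, IsOpenImmersion (E c ≫ ι c) := fun c => by
    have : IsOpenImmersion (ι c) := inferInstanceAs (IsOpenImmersion (Proj.awayι _ _ _ _))
    infer_instance
  let A : Atlas k F (weightedProjectivePlane k w).left :=
    { map := fun c => E c ≫ ι c
      isOpenImmersion := hopen
      incl_map := hincl
      surjective := by
        intro x
        -- The variables generate the ring over degree zero, so their basic open sets cover `Proj`;
        -- the variable `X i` is the monomial of the cone spanned by the other two rays.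
        have hadj : Algebra.adjoin (weightedGrading k w 0)
            (Set.range (MvPolynomial.X : Fin 3 → MvPolynomial (Fin 3) k)) = ⊤ := by
          rw [eq_top_iff]
          rintro p -
          induction p using MvPolynomial.induction_on with
          | C r => exact Subalgebra.algebraMap_mem _ (algebraMap k (weightedGrading k w 0) r)
          | add p q hp hq => exact add_mem hp hq
          | mul_X p i hp => exact mul_mem hp (Algebra.subset_adjoin ⟨i, rfl⟩)
        have htop := Proj.iSup_basicOpen_eq_top' (weightedGrading k w) _
          (fun i => ⟨w i, MvPolynomial.isWeightedHomogeneous_X k w i⟩) hadj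
        have hx : x ∈ ⨆ i, Proj.basicOpen (weightedGrading k w) (MvPolynomial.X i) :=
          htop ▸ trivial
        obtain ⟨i, hi⟩ := TopologicalSpace.Opens.mem_iSup.mp hx
        have hc : F.IsCone ((Finset.univ.image u).erase (u i)) := by
          refine (hF _).mpr ⟨fun v hv => ?_, i, Finset.notMem_erase _ _⟩
          simpa using Finset.mem_of_mem_erase hv
        have hX : coxMonomial k u ((Finset.univ.image u).erase (u i)) = MvPolynomial.X i := by
          rw [coxMonomial, MvPolynomial.X]
          congr 2
          refine Finsupp.ext fun j => ?_
          rw [coxExponent_apply, Finsupp.single_apply]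
          simp [hu.eq_iff, eq_comm]
        rw [← hX] at hi
        have h1 : x ∈ Set.range (E ⟨_, hc⟩ ≫ ι ⟨_, hc⟩) := by
          rw [hrange]
          exact hi
        obtain ⟨y, hy⟩ := h1
        exact ⟨⟨_, hc⟩, y, hy⟩
      inter := by
        intro c d x y hxy
        have hcd : F.IsCone (c.1 ∩ d.1) := CompleteFan.isCone_subset c.2 Finset.inter_subset_left
        let z : F.Cone := ⟨c.1 ∩ d.1, hcd⟩
        have h1 : (E c ≫ ι c) x ∈ Set.range (E z ≫ ι z) := by
          have r1 : (E c ≫ ι c) x ∈ Set.range (E c ≫ ι c) := ⟨x, rfl⟩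
          have r2 : (E c ≫ ι c) x ∈ Set.range (E d ≫ ι d) := ⟨y, hxy.symm⟩
          rw [hrange] at r1 r2 ⊢
          refine Proj.basicOpen_mono _ _ _ (coxMonomial_inter_dvd k c.1 d.1) ?_
          rw [Proj.basicOpen_mul]
          exact ⟨r1, r2⟩
        obtain ⟨t, ht⟩ := h1
        refine ⟨z, Finset.inter_subset_left, Finset.inter_subset_right, t, ?_, ?_⟩
        · apply (E c ≫ ι c).isOpenEmbedding.injective
          rw [← Scheme.Hom.comp_apply, hincl z c, ht]
        · apply (E d ≫ ι d).isOpenEmbedding.injective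
          rw [← Scheme.Hom.comp_apply, hincl z d]
          exact ht.trans hxy }
  refine A.nonempty_iso _ fun c => ?_
  change (E c ≫ ι c) ≫ Proj.toSpecZero (weightedGrading k w) ≫ _ = _
  have h1 : ι c ≫ Proj.toSpecZero (weightedGrading k w) = _ := Proj.awayι_toSpecZero _ _ _ _
  rw [Category.assoc, reassoc_of% h1]
  simp only [E, chartStr]
  rw [← Spec.map_comp, ← Spec.map_comp, ← CommRingCat.ofHom_comp, ← CommRingCat.ofHom_comp]
  congr 2
  refine RingHom.ext fun r => toTorus_injective c.1 ?_
  change toTorus k c.1 (e c _) = _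
  rw [he]
  have h2 : coxToTorus k w u χ c.1 (HomogeneousLocalization.fromZeroRingHom (weightedGrading k w)
      (Submonoid.powers (coxMonomial k u c.1)) (algebraMap k (weightedGrading k w 0) r)) =
      dehomogenize k χ (algebraMap k _ r) :=
    (congrArg (Localization.awayLift (dehomogenize k χ : MvPolynomial (Fin 3) k →+* ChartRing k ∅)
      _ (isUnit_dehomogenize k u χ c.1)) (Localization.mk_one_eq_algebraMap _)).trans
      (IsLocalization.Away.lift_eq _ _ _)
  refine h2.trans ?_
  rw [AlgHom.commutes]
  exact (chartMap_single k _ 0 r).symm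

end cox
end ToricSurface

namespace ToricSurface
namespace CompleteFan

variable {F : CompleteFan}

/-! ### Fans with three rays -/

/-- The rays of the fan are `u₀`, `u₁`, `u₂`, in counterclockwise order. -/
structure IsTriangle (F : CompleteFan) (u₀ u₁ u₂ : ℤ × ℤ) : Prop where
  rays_eq : F.rays = {u₀, u₁, u₂}
  det₀ : 0 < det u₀ u₁
  det₁ : 0 < det u₁ u₂
  det₂ : 0 < det u₂ u₀

theorem Adj.ne {u v : ℤ × ℤ} (h : F.Adj u v) : u ≠ v := by
  rintro rfl
  have := h.2.2.1
  rw [det_self] at this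
  exact lt_irrefl _ this

theorem ne_of_det_pos {u v : ℤ × ℤ} (h : 0 < det u v) : u ≠ v := by
  rintro rfl
  rw [det_self] at h
  exact lt_irrefl _ h

theorem exists_isTriangle (h : F.rays.card = 3) : ∃ u₀ u₁ u₂, F.IsTriangle u₀ u₁ u₂ := by
  obtain ⟨u₀, hu₀⟩ : F.rays.Nonempty := Finset.card_pos.mp (by omega)
  obtain ⟨u₁, h01⟩ := exists_next hu₀
  obtain ⟨u₂, h12⟩ := exists_next h01.2.1
  have d01 := h01.2.2.1
  have d12 := h12.2.2.1
  have hne : u₂ ≠ u₀ := by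
    rintro rfl
    rw [det_swap] at d12
    omega
  have hrays : F.rays = {u₀, u₁, u₂} := by
    refine (Finset.eq_of_subset_of_card_le ?_ ?_).symm
    · intro x hx
      simp only [Finset.mem_insert, Finset.mem_singleton] at hx
      rcases hx with rfl | rfl | rfl
      exacts [hu₀, h01.2.1, h12.2.1]
    · rw [h, Finset.card_eq_three.mpr ⟨u₀, u₁, u₂, h01.ne, hne.symm, h12.ne, rfl⟩]
  obtain ⟨w, hw⟩ := exists_next h12.2.1
  have hw' := hw.2.1
  have d2 := hw.2.2.1
  rw [hrays] at hw'
  simp only [Finset.mem_insert, Finset.mem_singleton] at hw'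
  rcases hw' with rfl | rfl | rfl
  · exact ⟨_, _, _, hrays, d01, d12, d2⟩
  · rw [det_swap] at d2
    omega
  · exact absurd rfl hw.ne

/-- A vector with nonnegative values on the rays of a triangle is zero. -/
theorem exists_pairing_neg_of_det_pos {u₀ u₁ u₂ m : ℤ × ℤ} (h₀ : 0 < det u₀ u₁)
    (h₁ : 0 < det u₁ u₂) (h₂ : 0 < det u₂ u₀) (hm : m ≠ 0) :
    pairing m u₀ < 0 ∨ pairing m u₁ < 0 ∨ pairing m u₂ < 0 := by
  by_contra! hc
  have h : det u₁ u₂ * pairing m u₀ + det u₂ u₀ * pairing m u₁ + det u₀ u₁ * pairing m u₂ = 0 := by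
    simp only [det, pairing]; ring
  have e0 := mul_nonneg h₁.le hc.1
  have e1 := mul_nonneg h₂.le hc.2.1
  have e2 := mul_nonneg h₀.le hc.2.2
  refine hm (ext_of_pairing h₀.ne' (m' := 0) ?_ ?_)
  · have := (mul_eq_zero.mp (show det u₁ u₂ * pairing m u₀ = 0 by linarith)).resolve_left h₁.ne'
    rw [this]; simp [pairing]
  · have := (mul_eq_zero.mp (show det u₂ u₀ * pairing m u₁ = 0 by linarith)).resolve_left h₂.ne'
    rw [this]; simp [pairing]

theorem exists_triangle {u₀ u₁ u₂ : ℤ × ℤ} (p₀ : Int.gcd u₀.1 u₀.2 = 1)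
    (p₁ : Int.gcd u₁.1 u₁.2 = 1) (p₂ : Int.gcd u₂.1 u₂.2 = 1) (h₀ : 0 < det u₀ u₁)
    (h₁ : 0 < det u₁ u₂) (h₂ : 0 < det u₂ u₀) : ∃ G : CompleteFan, G.IsTriangle u₀ u₁ u₂ :=
  ⟨{ rays := {u₀, u₁, u₂}
     primitive := by
      intro v hv
      simp only [Finset.mem_insert, Finset.mem_singleton] at hv
      rcases hv with rfl | rfl | rfl <;> assumption
     complete := by
      intro m hm
      rcases exists_pairing_neg_of_det_pos h₀ h₁ h₂ hm with h | h | h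
      exacts [⟨u₀, by simp, h⟩, ⟨u₁, by simp, h⟩, ⟨u₂, by simp, h⟩] },
    rfl, h₀, h₁, h₂⟩

namespace IsTriangle

variable {u₀ u₁ u₂ : ℤ × ℤ} (T : F.IsTriangle u₀ u₁ u₂)

theorem rotate (T : F.IsTriangle u₀ u₁ u₂) : F.IsTriangle u₁ u₂ u₀ := by
  refine ⟨?_, T.det₁, T.det₂, T.det₀⟩
  rw [T.rays_eq]
  ext x
  simp only [Finset.mem_insert, Finset.mem_singleton]
  tauto

theorem mem₀ (T : F.IsTriangle u₀ u₁ u₂) : u₀ ∈ F.rays := by rw [T.rays_eq]; simp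

theorem card (T : F.IsTriangle u₀ u₁ u₂) : F.rays.card = 3 := by
  rw [T.rays_eq]
  exact Finset.card_eq_three.mpr ⟨u₀, u₁, u₂, ne_of_det_pos T.det₀, (ne_of_det_pos T.det₂).symm,
    ne_of_det_pos T.det₁, rfl⟩

theorem adj₀ (T : F.IsTriangle u₀ u₁ u₂) : F.Adj u₀ u₁ := by
  refine ⟨T.mem₀, T.rotate.mem₀, T.det₀, fun w hw => ?_⟩
  rw [T.rays_eq] at hw
  simp only [Finset.mem_insert, Finset.mem_singleton] at hw
  have h0 := T.det₀
  have h1 := T.det₁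
  have h2 := T.det₂
  rintro ⟨d1, d2⟩
  rcases hw with rfl | rfl | rfl
  · rw [det_self] at d1; omega
  · rw [det_self] at d2; omega
  · rw [det_swap] at d1; omega

theorem adj_iff (T : F.IsTriangle u₀ u₁ u₂) (a b : ℤ × ℤ) :
    F.Adj a b ↔ (a = u₀ ∧ b = u₁) ∨ (a = u₁ ∧ b = u₂) ∨ (a = u₂ ∧ b = u₀) := by
  constructor
  · intro h
    have ha := h.1
    rw [T.rays_eq] at ha
    simp only [Finset.mem_insert, Finset.mem_singleton] at ha
    rcases ha with rfl | rfl | rfl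
    · exact Or.inl ⟨rfl, h.right_unique T.adj₀⟩
    · exact Or.inr (Or.inl ⟨rfl, h.right_unique T.rotate.adj₀⟩)
    · exact Or.inr (Or.inr ⟨rfl, h.right_unique T.rotate.rotate.adj₀⟩)
  · rintro (⟨rfl, rfl⟩ | ⟨rfl, rfl⟩ | ⟨rfl, rfl⟩)
    exacts [T.adj₀, T.rotate.adj₀, T.rotate.rotate.adj₀]

/-- Twice the area of the triangle of the generators is the sum of the three positive determinants
of the cones. -/
theorem isLogDelPezzo (T : F.IsTriangle u₀ u₁ u₂) : F.IsLogDelPezzo := by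
  have key : ∀ a b c : ℤ × ℤ, det (b - a) (c - a) = det a b + det b c + det c a := by
    intro a b c
    simp only [det, Prod.fst_sub, Prod.snd_sub]; ring
  have h0 := T.det₀
  have h1 := T.det₁
  have h2 := T.det₂
  intro u v huv w hw hwu hwv
  rw [T.rays_eq] at hw
  simp only [Finset.mem_insert, Finset.mem_singleton] at hw
  rw [key]
  rcases (T.adj_iff u v).mp huv with ⟨rfl, rfl⟩ | ⟨rfl, rfl⟩ | ⟨rfl, rfl⟩ <;>
    rcases hw with rfl | rfl | rfl <;> first | exact absurd rfl hwu | exact absurd rfl hwv | omega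

/-- The cones are the proper subsets of the three rays, which is the description needed to compare
with the charts of `Proj`. -/
theorem isCone_iff (T : F.IsTriangle u₀ u₁ u₂) (c : Finset (ℤ × ℤ)) :
    F.IsCone c ↔ (∀ v ∈ c, ∃ i, ![u₀, u₁, u₂] i = v) ∧ ∃ i, ![u₀, u₁, u₂] i ∉ c := by
  have n01 := ne_of_det_pos T.det₀
  have n12 := ne_of_det_pos T.det₁
  have n20 := ne_of_det_pos T.det₂
  have hex : ∀ v, (∃ i, ![u₀, u₁, u₂] i = v) ↔ v ∈ F.rays := by
    intro v
    rw [T.rays_eq]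
    simp [Fin.exists_fin_succ, eq_comm]
  simp only [hex]
  constructor
  · intro h
    refine ⟨Cone.subset_rays ⟨c, h⟩, ?_⟩
    by_contra! hc
    have hsub : F.rays ⊆ c := fun v hv => by
      obtain ⟨i, rfl⟩ := (hex v).mpr hv
      exact hc i
    have h1 := Finset.card_le_card hsub
    rw [T.card] at h1
    rcases h with rfl | ⟨v, -, rfl⟩ | ⟨u, v, -, rfl⟩
    · simp at h1
    · simp at h1
    · have := Finset.card_le_two (a := u) (b := v)
      omega
  · rintro ⟨h1, i, hi⟩
    have key : ∀ u v, F.Adj u v → c ⊆ {u, v} → F.IsCone c := fun u v huv h =>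
      isCone_subset (Or.inr (Or.inr ⟨u, v, huv, rfl⟩)) h
    have hmem : ∀ v ∈ c, v = u₀ ∨ v = u₁ ∨ v = u₂ := by
      intro v hv
      have := h1 v hv
      rw [T.rays_eq] at this
      simpa using this
    fin_cases i
    · refine key _ _ T.rotate.adj₀ fun v hv => ?_
      rcases hmem v hv with rfl | rfl | rfl
      exacts [absurd hv hi, by simp, by simp]
    · refine key _ _ T.rotate.rotate.adj₀ fun v hv => ?_
      rcases hmem v hv with rfl | rfl | rfl
      exacts [by simp, absurd hv hi, by simp]
    · refine key _ _ T.adj₀ fun v hv => ?_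
      rcases hmem v hv with rfl | rfl | rfl
      exacts [by simp, by simp, absurd hv hi]

/-- The number of singular points of a toric surface of Picard number one. -/
theorem encard_singularLocus (T : F.IsTriangle u₀ u₁ u₂) {k : Type u} [Field k] {X : Scheme.{u}}
    (A : Atlas k F X) : (singularLocus X).encard =
      ((if det u₀ u₁ = 1 then 0 else 1) + (if det u₁ u₂ = 1 then 0 else 1) +
        (if det u₂ u₀ = 1 then 0 else 1) : ℕ) := by
  classical
  have n01 := ne_of_det_pos T.det₀
  have n12 := ne_of_det_pos T.det₁
  have n20 := ne_of_det_pos T.det₂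
  rw [A.encard_singularLocus]
  have hset : {p : (ℤ × ℤ) × (ℤ × ℤ) | F.Adj p.1 p.2 ∧ det p.1 p.2 ≠ 1} =
      ((({(u₀, u₁), (u₁, u₂), (u₂, u₀)} : Finset ((ℤ × ℤ) × (ℤ × ℤ))).filter
        fun p => det p.1 p.2 ≠ 1) : Finset _) := by
    ext ⟨a, b⟩
    simp [T.adj_iff]
  rw [hset, Set.encard_coe_eq_coe_finsetCard]
  congr 1
  rw [Finset.filter_insert, Finset.filter_insert, Finset.filter_singleton]
  by_cases h0 : det u₀ u₁ = 1 <;> by_cases h1 : det u₁ u₂ = 1 <;> by_cases h2 : det u₂ u₀ = 1 <;>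
    simp [h0, h1, h2, n01, n12, n20, n20.symm, Finset.card_insert_of_notMem]

end IsTriangle

/-! ### Removing a ray -/

/-- Removing a ray `a + b` between its neighbours `b` and `a`. -/
theorem exists_erase {a b : ℤ × ℤ} (hb : F.Adj b (a + b)) (ha : F.Adj (a + b) a) :
    ∃ G : CompleteFan, G.rays = F.rays.erase (a + b) ∧ ∀ x y, G.Adj x y ↔
      (F.Adj x y ∧ x ≠ a + b ∧ y ≠ a + b) ∨ (x = b ∧ y = a) := by
  have hba : 0 < det b a := by
    have := hb.2.2.1
    rwa [det_add_right, det_self, add_zero] at this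
  let G : CompleteFan :=
    { rays := F.rays.erase (a + b)
      primitive := fun v hv => F.primitive v (Finset.mem_of_mem_erase hv)
      complete := by
        intro m hm
        obtain ⟨v, hv, hmv⟩ := F.complete m hm
        by_cases h : v = a + b
        · rw [h, pairing_add_right] at hmv
          rcases lt_or_ge (pairing m a) 0 with h1 | h1
          · exact ⟨a, Finset.mem_erase.mpr ⟨ha.ne.symm, ha.2.1⟩, h1⟩
          · exact ⟨b, Finset.mem_erase.mpr ⟨hb.ne, hb.1⟩, by omega⟩
        · exact ⟨v, Finset.mem_erase.mpr ⟨h, hv⟩, hmv⟩ }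
  have hG : ∀ w, w ∈ G.rays ↔ w ≠ a + b ∧ w ∈ F.rays := fun w => Finset.mem_erase
  refine ⟨G, rfl, fun x y => ⟨fun h => ?_, ?_⟩⟩
  · have hx := (hG x).mp h.1
    have hy := (hG y).mp h.2.1
    -- A cone of the smaller fan either does not contain `a + b` in its interior and was already a
    -- cone, or it contains it. In the latter case its edges cannot lie beyond the former neighbours
    -- `b` and `a`, so they are these.
    by_cases hv : 0 < det x (a + b) ∧ 0 < det (a + b) y
    · right
      have h1 := hb.det_nonneg_left hx.2 hv.1
      have h2 := ha.det_nonneg_right hy.2 hv.2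
      constructor
      · refine eq_of_det_eq_zero hx.2 hb.1 ?_ hv.1 hb.2.2.1.le
        by_contra hne
        refine h.2.2.2 b ((hG b).mpr ⟨hb.ne, hb.1⟩) ⟨by omega, ?_⟩
        have h3 := det_mul_det x b (a + b) y
        have h4 := mul_pos (show 0 < det x b by omega) hv.2
        have h5 := mul_pos h.2.2.1 hb.2.2.1
        exact pos_of_mul_pos_right (a := det x (a + b)) (by linarith) hv.1.le
      · refine (eq_of_det_eq_zero' ha.2.1 hy.2 ?_ ha.2.2.1 hv.2.le).symm
        by_contra hne
        refine h.2.2.2 a ((hG a).mpr ⟨ha.ne.symm, ha.2.1⟩) ⟨?_, by omega⟩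
        have h3 := det_mul_det x (a + b) a y
        have h4 := mul_pos hv.1 (show 0 < det a y by omega)
        have h5 := mul_pos h.2.2.1 ha.2.2.1
        exact pos_of_mul_pos_left (b := det (a + b) y) (by linarith) hv.2.le
    · left
      refine ⟨⟨hx.2, hy.2, h.2.2.1, fun w hw hw' => ?_⟩, hx.1, hy.1⟩
      by_cases hwv : w = a + b
      · exact hv (hwv ▸ hw')
      · exact h.2.2.2 w ((hG w).mpr ⟨hwv, hw⟩) hw'
  · rintro (⟨h, hx, hy⟩ | ⟨rfl, rfl⟩)
    · exact ⟨(hG x).mpr ⟨hx, h.1⟩, (hG y).mpr ⟨hy, h.2.1⟩, h.2.2.1,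
        fun w hw => h.2.2.2 w ((hG w).mp hw).2⟩
    · refine ⟨(hG x).mpr ⟨hb.ne, hb.1⟩, (hG y).mpr ⟨ha.ne.symm, ha.2.1⟩, hba, ?_⟩
      rintro w hw ⟨h1, h2⟩
      rw [hG] at hw
      have h3 : det x (y + x) * det w y = det x w * det (y + x) y + det x y * det w (y + x) := by
        simp only [det, Prod.fst_add, Prod.snd_add]; ring
      rcases lt_trichotomy (det w (y + x)) 0 with h4 | h4 | h4
      · refine ha.2.2.2 w hw.2 ⟨?_, h2⟩
        rw [det_swap]; omega
      · exact hw.1 (eq_of_det_eq_zero' hw.2 ha.1 h4 h1 hb.2.2.1.le)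
      · exact hb.2.2.2 w hw.2 ⟨h1, h4⟩

/-! ### Smooth refinements -/

/-- The cones of the fan are generated by bases of the lattice. -/
def IsSmooth (F : CompleteFan) : Prop := ∀ u v, F.Adj u v → det u v = 1

/-- A lattice vector inside a cone that is not generated by a basis of the lattice. -/
theorem exists_interior_vector {u v : ℤ × ℤ} (hu : Int.gcd u.1 u.2 = 1) (hv : Int.gcd v.1 v.2 = 1)
    (h : 2 ≤ det u v) : ∃ w t : ℤ × ℤ, ∃ a : ℤ, 0 < a ∧ a < det u v ∧
      t = det u v • w ∧ t = v + a • u := by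
  obtain ⟨e, he⟩ := exists_det_eq_one hu
  set d := det u v with hd
  have hdpos : 0 < d := by omega
  have hve : v = det v e • u + d • e := by
    simp only [hd, det] at he ⊢
    ext
    · simp only [Prod.fst_add, Prod.smul_fst, smul_eq_mul]
      linear_combination (-v.1) * he
    · simp only [Prod.snd_add, Prod.smul_snd, smul_eq_mul]
      linear_combination (-v.2) * he
  -- Otherwise `v` is divisible by `d ≥ 2`, contrary to primitivity.
  have hdvd : ¬ d ∣ det v e := by
    rintro ⟨q, hq⟩
    have h1 : v = d • (q • u + e) := by
      rw [smul_add, smul_smul, ← hq]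
      exact hve
    have h2 : Int.gcd v.1 v.2 = d.natAbs * Int.gcd (q • u + e).1 (q • u + e).2 := by
      conv_lhs => rw [h1]
      exact Int.gcd_mul_left _ _ _
    rw [hv] at h2
    have h3 := Nat.eq_one_of_mul_eq_one_right h2.symm
    omega
  have hmod : (-det v e) % d ≠ 0 := fun h0 => hdvd ((dvd_neg).mp (Int.dvd_of_emod_eq_zero h0))
  obtain ⟨r, q, hr, hrd, hrq⟩ : ∃ r q, 0 < r ∧ r < d ∧ det v e = -r - d * q := by
    have h1 := Int.emod_nonneg (-det v e) hdpos.ne'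
    have h3 := Int.emod_add_mul_ediv (-det v e) d
    exact ⟨(-det v e) % d, (-det v e) / d, by omega, Int.emod_lt_of_pos (-det v e) hdpos, by linarith⟩
  rw [hrq] at hve
  refine ⟨e + (-q) • u, _, r, hr, hrd, rfl, ?_⟩
  have e1 := congrArg Prod.fst hve
  have e2 := congrArg Prod.snd hve
  simp only [Prod.fst_add, Prod.snd_add, Prod.smul_fst, Prod.smul_snd, smul_eq_mul] at e1 e2
  ext
  · simp only [Prod.fst_add, Prod.smul_fst, smul_eq_mul]
    linear_combination -e1
  · simp only [Prod.snd_add, Prod.smul_snd, smul_eq_mul]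
    linear_combination -e2

/-- All primitive vectors in a square containing the given generators are taken as rays. A singular
cone of this fan would contain a lattice vector `w = (v + a u) / d` with `0 < a < d`; it is
primitive since `det u w = 1`, and it lies in the square because `1 + a ≤ d`, so it would subdivide
the cone. -/
theorem exists_smooth_refinement (F : CompleteFan) :
    ∃ G : CompleteFan, F.rays ⊆ G.rays ∧ G.IsSmooth := by
  classical
  obtain ⟨B, hB⟩ : ∃ B : ℤ, ∀ v ∈ F.rays, |v.1| ≤ B ∧ |v.2| ≤ B := by
    refine ⟨∑ v ∈ F.rays, (|v.1| + |v.2|), fun v hv => ?_⟩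
    have h1 : |v.1| + |v.2| ≤ ∑ v ∈ F.rays, (|v.1| + |v.2|) :=
      Finset.single_le_sum (f := fun v : ℤ × ℤ => |v.1| + |v.2|) (fun _ _ => by positivity) hv
    have h2 := abs_nonneg v.1
    have h3 := abs_nonneg v.2
    omega
  let s : Finset (ℤ × ℤ) := (Finset.Icc (-B) B ×ˢ Finset.Icc (-B) B).filter
    fun v => Int.gcd v.1 v.2 = 1
  have hs : ∀ v, v ∈ s ↔ (|v.1| ≤ B ∧ |v.2| ≤ B) ∧ Int.gcd v.1 v.2 = 1 := by
    intro v
    simp only [s, Finset.mem_filter, Finset.mem_product, Finset.mem_Icc, abs_le]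
  have hsub : F.rays ⊆ s := fun v hv => (hs v).mpr ⟨hB v hv, F.primitive v hv⟩
  refine ⟨⟨s, fun v hv => ((hs v).mp hv).2, fun m hm => ?_⟩, hsub, ?_⟩
  · obtain ⟨v, hv, h⟩ := F.complete m hm
    exact ⟨v, hsub hv, h⟩
  · intro u v huv
    by_contra hne
    have hpos := huv.2.2.1
    have hu := (hs u).mp huv.1
    have hv := (hs v).mp huv.2.1
    obtain ⟨w, t, a, ha, had, ht1, ht2⟩ := exists_interior_vector hu.2 hv.2 (by omega)
    have hdw : det u w = 1 := by
      have h1 : det u t = det u v * det u w := by rw [ht1, det_smul_right]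
      have h2 : det u t = det u v := by rw [ht2, det_add_right, det_smul_right, det_self]; ring
      have h3 : det u v * (det u w - 1) = 0 := by linarith
      have := (mul_eq_zero.mp h3).resolve_left hpos.ne'
      omega
    have hwv : 0 < det w v := by
      have h1 : det t v = det u v * det w v := by rw [ht1, det_smul_left]
      have h2 : det t v = a * det u v := by rw [ht2, det_add_left, det_smul_left, det_self]; ring
      have h3 := mul_pos ha hpos
      exact pos_of_mul_pos_right (a := det u v) (by rw [← h1, h2]; exact h3) hpos.le
    have habs : ∀ x y z : ℤ, |x| ≤ B → |y| ≤ B → det u v * z = y + a * x → |z| ≤ B := by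
      intro x y z hx hy hz
      rw [abs_le] at hx hy ⊢
      constructor <;> by_contra! hc
      · nlinarith
      · nlinarith
    have hprim : Int.gcd w.1 w.2 = 1 := by
      have h1 : (Int.gcd w.1 w.2 : ℤ) ∣ det u w := by
        simp only [det]
        exact dvd_sub ((Int.gcd_dvd_right _ _).mul_left _) ((Int.gcd_dvd_left _ _).mul_left _)
      rw [hdw] at h1
      exact_mod_cast Int.eq_one_of_dvd_one (by positivity) h1
    have hw : w ∈ s := by
      refine (hs w).mpr ⟨⟨?_, ?_⟩, hprim⟩
      · exact habs u.1 v.1 w.1 hu.1.1 hv.1.1 (congrArg Prod.fst (ht1.symm.trans ht2))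
      · exact habs u.2 v.2 w.2 hu.1.2 hv.1.2 (congrArg Prod.snd (ht1.symm.trans ht2))
    exact huv.2.2.2 w hw ⟨by omega, hwv⟩

/-- The minimal resolution. -/
theorem exists_minimal_refinement (F : CompleteFan) : ∃ G : CompleteFan, F.rays ⊆ G.rays ∧
    G.IsSmooth ∧ ∀ v ∈ G.rays, v ∉ F.rays → ¬ G.SelfInt v (-1) := by
  classical
  -- A smooth refinement with the fewest rays is minimal, for a new `(-1)`-curve could be contracted
  -- without losing smoothness.
  have hex : ∃ n : ℕ, ∃ G : CompleteFan, F.rays ⊆ G.rays ∧ G.IsSmooth ∧ G.rays.card = n := by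
    obtain ⟨G, h1, h2⟩ := F.exists_smooth_refinement
    exact ⟨_, G, h1, h2, rfl⟩
  obtain ⟨G, h1, h2, h3⟩ := Nat.find_spec hex
  refine ⟨G, h1, h2, ?_⟩
  rintro v hv hvF ⟨b, a, hb, ha, hab⟩
  have hv' : v = a + b := by
    rw [add_comm a b, hab]; simp
  subst hv'
  obtain ⟨G', h4, h5⟩ := exists_erase hb ha
  refine Nat.find_min hex (m := G'.rays.card) ?_ ⟨G', ?_, ?_, rfl⟩
  · rw [← h3, h4]
    exact Finset.card_erase_lt_of_mem hv
  · rw [h4]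
    exact Finset.subset_erase.mpr ⟨h1, hvF⟩
  · intro x y hxy
    rcases (h5 x y).mp hxy with h | ⟨rfl, rfl⟩
    · exact h2 x y h.1
    · have := h2 _ _ hb
      rwa [det_add_right, det_self, add_zero] at this

end CompleteFan
end ToricSurface

namespace ToricSurface

/-- The determinant with a fixed first vector. -/
def detHom (u : ℤ × ℤ) : ℤ × ℤ →ₗ[ℤ] ℤ where
  toFun v := det u v
  map_add' := det_add_right u
  map_smul' a v := det_smul_right a u v

theorem detHom_apply (u v : ℤ × ℤ) : detHom u v = det u v := rfl

namespace CompleteFan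

variable {F : CompleteFan}

/-! ### Convex arcs of rays -/

/-- `p` and `n` are the neighbours of `v`, and `p + n = c v`. -/
def Node (F : CompleteFan) (p v n : ℤ × ℤ) (c : ℤ) : Prop :=
  F.Adj p v ∧ F.Adj v n ∧ p + n = c • v

/-- Both `det p v` and `det v n` are `1`, so `p + n` is parallel to `v`, with coefficient `det p n`.
-/
theorem IsSmooth.exists_node (hF : F.IsSmooth) {p v n : ℤ × ℤ} (h : F.Adj p v) (h' : F.Adj v n) :
    ∃ c, F.Node p v n c := by
  have h1 := hF p v h
  have h2 := hF v n h'
  refine ⟨det p n, h, h', ?_⟩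
  simp only [det] at h1 h2 ⊢
  ext
  · simp only [Prod.fst_add, Prod.smul_fst, smul_eq_mul]
    linear_combination (-p.1) * h2 - n.1 * h1
  · simp only [Prod.snd_add, Prod.smul_snd, smul_eq_mul]
    linear_combination (-p.2) * h2 - n.2 * h1

theorem Node.map {p v n : ℤ × ℤ} {c : ℤ} (h : F.Node p v n c) (ψ : ℤ × ℤ →ₗ[ℤ] ℤ) :
    ψ p + ψ n = c * ψ v := by
  rw [← map_add, h.2.2, map_smul, smul_eq_mul]

theorem Adj.det_pos_right {u v w : ℤ × ℤ} (h : F.Adj u v) (hw : w ∈ F.rays) (huw : 0 < det u w)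
    (hne : w ≠ v) : 0 < det v w := by
  refine (h.det_nonneg_right hw huw).lt_of_ne fun h0 => hne ?_
  exact (eq_of_det_eq_zero' h.2.1 hw h0.symm h.2.2.1 huw.le).symm

theorem Adj.det_pos_left {u v w : ℤ × ℤ} (h : F.Adj u v) (hw : w ∈ F.rays) (hwv : 0 < det w v)
    (hne : w ≠ u) : 0 < det w u := by
  refine (h.det_nonneg_left hw hwv).lt_of_ne fun h0 => hne ?_
  exact eq_of_det_eq_zero hw h.1 h0.symm hwv h.2.2.1.le

/-- The next ray after a ray of the half-open arc from `u` to `w` follows `u`. -/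
theorem Adj.det_pos_of_mem_arc {u v w n : ℤ × ℤ} (h : F.Adj v n) (hw : w ∈ F.rays)
    (huw : 0 < det u w) (huv : 0 ≤ det u v) (hvw : 0 < det v w) : 0 < det u n := by
  have h1 := h.det_nonneg_right hw hvw
  have h2 := det_mul_det u v n w
  have h3 := mul_nonneg huv h1
  have h4 := mul_pos huw h.2.2.1
  exact pos_of_mul_pos_left (b := det v w) (by linarith) hvw.le

theorem Adj.det_pos_of_mem_arc' {u v w p : ℤ × ℤ} (h : F.Adj p v) (hu : u ∈ F.rays)
    (huw : 0 < det u w) (huv : 0 < det u v) (hvw : 0 ≤ det v w) : 0 < det p w := by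
  have h1 := h.det_nonneg_left hu huv
  have h2 := det_mul_det u p v w
  have h3 := mul_nonneg h1 hvw
  have h4 := mul_pos huw h.2.2.1
  exact pos_of_mul_pos_right (a := det u v) (by linarith) huv.le

/-- The torus-invariant curves of the rays between `u` and `w` have self-intersection number at
most `-2`. -/
structure ConvexArc (F : CompleteFan) (u w : ℤ × ℤ) : Prop where
  left : u ∈ F.rays
  right : w ∈ F.rays
  pos : 0 < det u w
  two_le : ∀ p v n c, F.Node p v n c → 0 < det u v → 0 < det v w → 2 ≤ c

theorem ConvexArc.subarc_left {u w v : ℤ × ℤ} (h : F.ConvexArc u w) (hv : v ∈ F.rays)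
    (huv : 0 < det u v) (hvw : 0 < det v w) : F.ConvexArc u v := by
  refine ⟨h.left, hv, huv, fun p x n c hn hux hxv => h.two_le p x n c hn hux ?_⟩
  have h2 := det_mul_det u x v w
  have h3 := mul_pos hux hvw
  have h4 := mul_pos h.pos hxv
  exact pos_of_mul_pos_right (a := det u v) (by linarith) huv.le

theorem ConvexArc.subarc_right {u w v : ℤ × ℤ} (h : F.ConvexArc u w) (hv : v ∈ F.rays)
    (huv : 0 < det u v) (hvw : 0 < det v w) : F.ConvexArc v w := by
  refine ⟨hv, h.right, hvw, fun p x n c hn hvx hxw => h.two_le p x n c hn ?_ hxw⟩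
  have h2 := det_mul_det u v x w
  have h3 := mul_pos huv hxw
  have h4 := mul_pos h.pos hvx
  exact pos_of_mul_pos_left (b := det v w) (by linarith) hvw.le

/-- A linear function that increases at the start of a convex arc increases along the arc. -/
theorem ConvexArc.increasing {u w n : ℤ × ℤ} (hF : F.IsSmooth) (h : F.ConvexArc u w)
    (hn : F.Adj u n) (ψ : ℤ × ℤ →ₗ[ℤ] ℤ) (h0 : 0 ≤ ψ n) (h1 : ψ u + 1 ≤ ψ n) {p v : ℤ × ℤ}
    (hpv : F.Adj p v) (huv : 0 < det u v) (hvw : 0 ≤ det v w) :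
    ψ p + 1 ≤ ψ v ∧ (v = n ∨ ψ n + 1 ≤ ψ v) := by
  classical
  by_contra hbad
  -- The first ray after `u` that violates the claim is considered. Its predecessor `q` is good and
  -- has `ψ q ≥ 0`, so the relation at `q` with `c ≥ 2` says that the next increment of `ψ` is at
  -- least the previous one.
  let s := F.rays.filter fun v => 0 ≤ det v w ∧
    ∃ p, F.Adj p v ∧ ¬ (ψ p + 1 ≤ ψ v ∧ (v = n ∨ ψ n + 1 ≤ ψ v))
  have hs : ∀ v, v ∈ s ↔ v ∈ F.rays ∧ 0 ≤ det v w ∧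
      ∃ p, F.Adj p v ∧ ¬ (ψ p + 1 ≤ ψ v ∧ (v = n ∨ ψ n + 1 ≤ ψ v)) := fun v => Finset.mem_filter
  obtain ⟨x, hx, hux, hmin⟩ := exists_nearest_left (s := s) (x := u)
    ⟨v, (hs v).mpr ⟨hpv.2.1, hvw, p, hpv, hbad⟩, huv⟩
  obtain ⟨hxF, hxw, q, hq, hqbad⟩ := (hs x).mp hx
  by_cases hqu : q = u
  · subst hqu
    have := hq.right_unique hn
    subst this
    exact hqbad ⟨h1, Or.inl rfl⟩
  · have huq : 0 < det u q := hq.det_pos_left h.left hux (Ne.symm hqu)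
    have hqw : 0 < det q w := hq.det_pos_of_mem_arc' h.left h.pos hux hxw
    obtain ⟨r, hr⟩ := exists_prev hq.1
    have hgood : ψ r + 1 ≤ ψ q ∧ (q = n ∨ ψ n + 1 ≤ ψ q) := by
      by_contra hc
      have h2 := hmin q ((hs q).mpr ⟨hq.1, hqw.le, r, hr, hc⟩) huq
      rw [det_swap] at h2
      linarith [hq.2.2.1]
    obtain ⟨c, hc⟩ := hF.exists_node hr hq
    have hc2 := h.two_le _ _ _ _ hc huq hqw
    have h3 := hc.map ψ
    have h4 : ψ n ≤ ψ q := by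
      rcases hgood.2 with h | h
      · rw [h]
      · linarith
    have h5 : 2 * ψ q ≤ c * ψ q := by gcongr; linarith
    exact hqbad ⟨by linarith [hgood.1], Or.inr (by linarith [hgood.1])⟩

/-- A linear function that decreases at the end of a convex arc decreases along the arc. -/
theorem ConvexArc.decreasing {u w n : ℤ × ℤ} (hF : F.IsSmooth) (h : F.ConvexArc u w)
    (hn : F.Adj n w) (ψ : ℤ × ℤ →ₗ[ℤ] ℤ) (h0 : 0 ≤ ψ n) (h1 : ψ w + 1 ≤ ψ n) {v p : ℤ × ℤ}
    (hpv : F.Adj v p) (huv : 0 ≤ det u v) (hvw : 0 < det v w) :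
    ψ p + 1 ≤ ψ v ∧ (v = n ∨ ψ n + 1 ≤ ψ v) := by
  classical
  by_contra hbad
  let s := F.rays.filter fun v => 0 ≤ det u v ∧
    ∃ p, F.Adj v p ∧ ¬ (ψ p + 1 ≤ ψ v ∧ (v = n ∨ ψ n + 1 ≤ ψ v))
  have hs : ∀ v, v ∈ s ↔ v ∈ F.rays ∧ 0 ≤ det u v ∧
      ∃ p, F.Adj v p ∧ ¬ (ψ p + 1 ≤ ψ v ∧ (v = n ∨ ψ n + 1 ≤ ψ v)) := fun v => Finset.mem_filter
  obtain ⟨x, hx, hxw, hmin⟩ := exists_nearest_right (s := s) (x := w)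
    ⟨v, (hs v).mpr ⟨hpv.1, huv, p, hpv, hbad⟩, hvw⟩
  obtain ⟨hxF, hux, q, hq, hqbad⟩ := (hs x).mp hx
  by_cases hqu : q = w
  · subst hqu
    have := hq.left_unique hn
    subst this
    exact hqbad ⟨h1, Or.inl rfl⟩
  · have hqw : 0 < det q w := hq.det_pos_right h.right hxw (Ne.symm hqu)
    have huq : 0 < det u q := hq.det_pos_of_mem_arc h.right h.pos hux hxw
    obtain ⟨r, hr⟩ := exists_next hq.2.1
    have hgood : ψ r + 1 ≤ ψ q ∧ (q = n ∨ ψ n + 1 ≤ ψ q) := by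
      by_contra hc
      have h2 := hmin q ((hs q).mpr ⟨hq.2.1, huq.le, r, hr, hc⟩) hqw
      rw [det_swap] at h2
      linarith [hq.2.2.1]
    obtain ⟨c, hc⟩ := hF.exists_node hq hr
    have hc2 := h.two_le _ _ _ _ hc huq hqw
    have h3 := hc.map ψ
    have h4 : ψ n ≤ ψ q := by
      rcases hgood.2 with h | h
      · rw [h]
      · linarith
    have h5 : 2 * ψ q ≤ c * ψ q := by gcongr; linarith
    exact hqbad ⟨by linarith [hgood.1], Or.inr (by linarith [hgood.1])⟩

/-! ### Minimal resolutions of triangles -/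

/-- `F` is the fan of the minimal resolution of the toric surface whose rays are `u₀`, `u₁`, `u₂`,
and that surface has three singular points. -/
structure IsResolution (F : CompleteFan) (u₀ u₁ u₂ : ℤ × ℤ) : Prop where
  smooth : F.IsSmooth
  mem₀ : u₀ ∈ F.rays
  mem₁ : u₁ ∈ F.rays
  mem₂ : u₂ ∈ F.rays
  det₀ : 2 ≤ det u₀ u₁
  det₁ : 2 ≤ det u₁ u₂
  det₂ : 2 ≤ det u₂ u₀
  minimal : ∀ p v n, F.Node p v n 1 → v = u₀ ∨ v = u₁ ∨ v = u₂

namespace IsResolution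

variable {u₀ u₁ u₂ : ℤ × ℤ}

theorem rotate (R : F.IsResolution u₀ u₁ u₂) : F.IsResolution u₁ u₂ u₀ :=
  ⟨R.smooth, R.mem₁, R.mem₂, R.mem₀, R.det₁, R.det₂, R.det₀, fun p v n h => by
    have := R.minimal p v n h
    tauto⟩

/-- At a ray strictly between `u₀` and `u₁`, applying `det u₀` to `p + n = c v` gives `c > 0`, and
minimality of the resolution excludes `c = 1`. -/
theorem convexArc (R : F.IsResolution u₀ u₁ u₂) : F.ConvexArc u₀ u₁ := by
  have h0 := R.det₀
  have h1 := R.det₁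
  have h2 := R.det₂
  refine ⟨R.mem₀, R.mem₁, by omega, fun p v n c hn huv hvw => ?_⟩
  have hp : 0 ≤ det u₀ p := hn.1.det_nonneg_left R.mem₀ huv
  have hn' : 0 < det u₀ n := hn.2.1.det_pos_of_mem_arc R.mem₁ (by omega) huv.le hvw
  have h3 : det u₀ p + det u₀ n = c * det u₀ v := hn.map (detHom u₀)
  have hc : 0 < c := pos_of_mul_pos_left (b := det u₀ v) (by rw [← h3]; omega) huv.le
  have hc1 : c ≠ 1 := by
    rintro rfl
    rcases R.minimal _ _ _ hn with rfl | rfl | rfl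
    · rw [det_self] at huv; omega
    · rw [det_self] at hvw; omega
    · rw [det_swap] at huv; omega
  omega

theorem next_mem_arc (R : F.IsResolution u₀ u₁ u₂) {a : ℤ × ℤ} (ha : F.Adj u₀ a) :
    0 < det a u₁ := by
  have h0 := R.det₀
  refine ha.det_pos_right R.mem₁ (by omega) ?_
  rintro rfl
  rw [R.smooth _ _ ha] at h0
  omega

theorem prev_mem_arc (R : F.IsResolution u₀ u₁ u₂) {b : ℤ × ℤ} (hb : F.Adj b u₁) :
    0 < det u₀ b := by
  have h0 := R.det₀
  refine hb.det_pos_left R.mem₀ (by omega) ?_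
  rintro rfl
  rw [R.smooth _ _ hb] at h0
  omega

/-- The curves of the original rays have self-intersection number at least `-1`. -/
theorem node_le_one (R : F.IsResolution u₀ u₁ u₂) {b a : ℤ × ℤ} {c : ℤ} (h : F.Node b u₁ a c) :
    c ≤ 1 := by
  by_contra hc
  have hd0 := R.det₀
  have hd1 := R.det₁
  have hd2 := R.det₂
  obtain ⟨n, hn⟩ := exists_next R.mem₀
  obtain ⟨q, hq⟩ := exists_prev R.mem₂
  have e0 : detHom u₀ u₀ = 0 := det_self u₀
  have e1 : detHom u₀ n = 1 := R.smooth _ _ hn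
  have e2 : detHom u₀ u₁ = det u₀ u₁ := rfl
  have e3 : detHom u₀ u₂ = -det u₂ u₀ := det_swap _ _
  -- If `c ≥ 2`, the function `det u₀`, which increases from `u₀` to `u₁`, would continue to
  -- increase up to `u₂`. But it is negative at `u₂`.
  have h1 := R.convexArc.increasing R.smooth hn (detHom u₀) (by omega) (by omega) h.1 (by omega)
    (det_self u₁).ge
  have h2 := h.map (detHom u₀)
  have h3 : 2 * det u₀ u₁ ≤ c * det u₀ u₁ := by gcongr; omega
  rw [e2] at h1 h2
  have h4 := R.rotate.convexArc.increasing R.smooth h.2.1 (detHom u₀) (by omega) (by omega) hq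
    (by omega) (det_self u₂).ge
  rcases h4.2 with h5 | h5
  · rw [← h5] at h2; omega
  · omega

/-- At most one of the curves of the original rays has nonnegative self-intersection number. -/
theorem not_node_nonpos (R : F.IsResolution u₀ u₁ u₂) {b₀ a₀ b₁ a₁ : ℤ × ℤ} {c₀ c₁ : ℤ}
    (h₀ : F.Node b₀ u₀ a₀ c₀) (h₁ : F.Node b₁ u₁ a₁ c₁) (hc₀ : c₀ ≤ 0) : 0 < c₁ := by
  by_contra hc₁
  have hd0 := R.det₀
  have hd1 := R.det₁
  have hd2 := R.det₂
  have hb₀ : 0 < det u₂ b₀ := R.rotate.rotate.prev_mem_arc h₀.1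
  have ha₁ : 0 < det a₁ u₂ := R.rotate.next_mem_arc h₁.2.1
  have hb₁ : 0 < det u₀ b₁ := R.prev_mem_arc h₁.1
  have e0 : det u₂ b₀ + det u₂ a₀ = c₀ * det u₂ u₀ := h₀.map (detHom u₂)
  have e1 : det u₂ b₁ + det u₂ a₁ = c₁ * det u₂ u₁ := h₁.map (detHom u₂)
  rw [det_swap a₁ u₂, det_swap u₁ u₂] at e1
  have f0 : c₀ * det u₂ u₀ ≤ 0 := mul_nonpos_of_nonpos_of_nonneg hc₀ (by omega)
  have f1 : 0 ≤ c₁ * -det u₁ u₂ := mul_nonneg_of_nonpos_of_nonpos (by omega) (by omega)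
  -- The relations at `u₀` and `u₁` place `a₀` strictly beyond the direction `-u₂` and `b₁` strictly
  -- before it, whereas `a₀` does not come after `b₁` on the arc from `u₀` to `u₁`. The Plücker
  -- relation expresses the conflict.
  have hab : 0 ≤ det a₀ b₁ := h₀.2.1.det_nonneg_right h₁.1.1 hb₁
  have h1 := det_mul_det u₂ u₀ a₀ b₁
  have h2 : det u₂ a₀ * det u₀ b₁ < 0 := mul_neg_of_neg_of_pos (by omega) hb₁
  have h3 := mul_nonneg (show 0 ≤ det u₂ u₀ by omega) hab
  have h4 := mul_pos (show 0 < det u₂ b₁ by omega) h₀.2.1.2.2.1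
  linarith

/-- After a rotation, the curves of the first two original rays are `(-1)`-curves. -/
theorem exists_two_nodes (R : F.IsResolution u₀ u₁ u₂) : ∃ v₀ v₁ v₂ b₀ a₀ b₁ a₁,
    (v₀ = u₀ ∧ v₁ = u₁ ∧ v₂ = u₂ ∨ v₀ = u₁ ∧ v₁ = u₂ ∧ v₂ = u₀ ∨ v₀ = u₂ ∧ v₁ = u₀ ∧ v₂ = u₁) ∧
    F.Node b₀ v₀ a₀ 1 ∧ F.Node b₁ v₁ a₁ 1 := by
  have hex : ∀ v ∈ F.rays, ∃ b a c, F.Node b v a c := by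
    intro v hv
    obtain ⟨a, ha⟩ := exists_next hv
    obtain ⟨b, hb⟩ := exists_prev hv
    obtain ⟨c, hc⟩ := R.smooth.exists_node hb ha
    exact ⟨b, a, c, hc⟩
  obtain ⟨b₀, a₀, c₀, h₀⟩ := hex u₀ R.mem₀
  obtain ⟨b₁, a₁, c₁, h₁⟩ := hex u₁ R.mem₁
  obtain ⟨b₂, a₂, c₂, h₂⟩ := hex u₂ R.mem₂
  have l₀ := R.rotate.rotate.node_le_one h₀
  have l₁ := R.node_le_one h₁
  have l₂ := R.rotate.node_le_one h₂
  have n₀ := R.not_node_nonpos h₀ h₁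
  have n₁ := R.rotate.not_node_nonpos h₁ h₂
  have n₂ := R.rotate.rotate.not_node_nonpos h₂ h₀
  -- All three numbers are at most `1`, and no two of them are nonpositive.
  have h : (c₀ = 1 ∧ c₁ = 1) ∨ (c₁ = 1 ∧ c₂ = 1) ∨ (c₂ = 1 ∧ c₀ = 1) := by omega
  rcases h with ⟨rfl, rfl⟩ | ⟨rfl, rfl⟩ | ⟨rfl, rfl⟩
  · exact ⟨_, _, _, _, _, _, _, Or.inl ⟨rfl, rfl, rfl⟩, h₀, h₁⟩
  · exact ⟨_, _, u₀, _, _, _, _, Or.inr (Or.inl ⟨rfl, rfl, rfl⟩), h₁, h₂⟩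
  · exact ⟨_, _, u₁, _, _, _, _, Or.inr (Or.inr ⟨rfl, rfl, rfl⟩), h₂, h₀⟩

end IsResolution
end CompleteFan
end ToricSurface

namespace ToricSurface
namespace CompleteFan

variable {F : CompleteFan}

namespace IsResolution

variable {u₀ u₁ u₂ : ℤ × ℤ}

/-! ### Blowing down a minimal resolution that is not basic -/

/-- Contracting `u₀` lowers the numbers `β` and `α` of its neighbours by one and changes no others.
The neighbour that does not become the new vertex has number at least `3`, so it does not become a
`(-1)`-curve and the resolution stays minimal. -/
theorem of_erase (R : F.IsResolution u₀ u₁ u₂) {b a x y : ℤ × ℤ} {β α : ℤ} (h : F.Node b u₀ a 1)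
    (hx : F.Node x b u₀ β) (hy : F.Node u₀ a y α) {G : CompleteFan}
    (hG : G.rays = F.rays.erase u₀)
    (hadj : ∀ x y, G.Adj x y ↔ (F.Adj x y ∧ x ≠ u₀ ∧ y ≠ u₀) ∨ (x = b ∧ y = a)) {v₀ : ℤ × ℤ}
    (hv : (v₀ = a ∧ 3 ≤ β) ∨ (v₀ = b ∧ 3 ≤ α)) (h₀ : 2 ≤ det v₀ u₁) (h₂ : 2 ≤ det u₂ v₀) :
    G.IsResolution v₀ u₁ u₂ := by
  have hu : b + a = u₀ := by rw [h.2.2, one_smul]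
  have hba : det b a = 1 := by
    have := R.smooth _ _ h.1
    rwa [← hu, det_add_right, det_self, zero_add] at this
  have hd0 := R.det₀
  have hd2 := R.det₂
  have ha0 := R.smooth _ _ h.2.1
  have hb0 := R.smooth _ _ h.1
  refine ⟨?_, ?_, ?_, ?_, h₀, R.det₁, h₂, ?_⟩
  · intro p q hpq
    rcases (hadj p q).mp hpq with h | ⟨rfl, rfl⟩
    · exact R.smooth _ _ h.1
    · exact hba
  · rw [hG, Finset.mem_erase]
    rcases hv with ⟨rfl, -⟩ | ⟨rfl, -⟩
    · refine ⟨?_, h.2.1.2.1⟩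
      rintro rfl
      rw [det_self] at ha0
      omega
    · refine ⟨?_, h.1.1⟩
      rintro rfl
      rw [det_self] at hb0
      omega
  · rw [hG, Finset.mem_erase]
    refine ⟨?_, R.mem₁⟩
    rintro rfl
    rw [det_self] at hd0
    omega
  · rw [hG, Finset.mem_erase]
    refine ⟨?_, R.mem₂⟩
    rintro rfl
    rw [det_self] at hd2
    omega
  · rintro p v n ⟨hpv, hvn, he⟩
    rw [one_smul] at he
    rcases (hadj _ _).mp hpv with h1 | ⟨rfl, rfl⟩ <;> rcases (hadj _ _).mp hvn with h2 | ⟨h2, rfl⟩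
    · rcases R.minimal p v n ⟨h1.1, h2.1, by rw [one_smul, he]⟩ with h3 | h3
      · exact absurd h3 h2.2.1
      · exact Or.inr h3
    · subst h2
      rcases hv with ⟨rfl, hβ⟩ | ⟨rfl, -⟩
      · have := h1.1.left_unique hx.1
        subst this
        have h4 := hx.map (detHom v)
        have h5 := congrArg (detHom v) he
        have h6 := hx.map (detHom p)
        rw [map_add] at h5
        simp only [detHom_apply, det_self, hb0, hba] at h4 h5 h6
        have h7 : det p u₀ = det p v + det p v₀ := by rw [← hu, det_add_right]
        have h8 : det p v = det p v₀ := by rw [← he, det_add_right, det_self, zero_add]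
        have h9 : det p v = 1 := R.smooth _ _ h1.1
        rw [h7, ← h8, h9] at h6
        omega
      · exact Or.inl rfl
    · rcases hv with ⟨rfl, -⟩ | ⟨rfl, hα⟩
      · exact Or.inl rfl
      · have := h2.1.right_unique hy.2.1
        subst this
        have h6 := hy.map (detHom n)
        simp only [detHom_apply, det_self] at h6
        have h7 : det n u₀ = det n v₀ + det n v := by rw [← hu, det_add_right]
        have h8 : det n v = det n v₀ := by rw [← he, det_add_right, det_self, add_zero]
        have h9 : det v n = 1 := R.smooth _ _ h2.1
        rw [det_swap] at h9
        rw [h7, ← h8, show det n v = -1 by omega] at h6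
        omega
    · rw [h2, det_self] at hba
      omega

theorem two_le_prev (R : F.IsResolution u₀ u₁ u₂) {x b : ℤ × ℤ} {β : ℤ} (hx : F.Node x b u₀ β) :
    2 ≤ β :=
  R.rotate.rotate.convexArc.two_le _ _ _ _ hx (R.rotate.rotate.prev_mem_arc hx.2.1)
    hx.2.1.2.2.1

theorem two_le_next (R : F.IsResolution u₀ u₁ u₂) {a y : ℤ × ℤ} {α : ℤ} (hy : F.Node u₀ a y α) :
    2 ≤ α :=
  R.convexArc.two_le _ _ _ _ hy hy.1.2.2.1 (R.next_mem_arc hy.1)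

/-- The function `det u₂` is `0` at `u₂` and `1` at the next ray, so it increases along the convex
arc up to `u₀`. -/
theorem det_prev_lt (R : F.IsResolution u₀ u₁ u₂) {b x : ℤ × ℤ} (hb : F.Adj b u₀)
    (hx : F.Adj x b) : det u₂ x + 1 ≤ det u₂ b := by
  obtain ⟨n, hn⟩ := exists_next R.mem₂
  have e1 : detHom u₂ n = 1 := R.smooth _ _ hn
  have e0 : detHom u₂ u₂ = 0 := det_self u₂
  exact (R.rotate.rotate.convexArc.increasing R.smooth hn (detHom u₂) (by omega) (by omega) hx
    (R.rotate.rotate.prev_mem_arc hb) hb.2.2.1.le).1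

theorem det_next_lt (R : F.IsResolution u₀ u₁ u₂) {a y : ℤ × ℤ} (ha : F.Adj u₀ a)
    (hy : F.Adj a y) : det y u₁ + 1 ≤ det a u₁ := by
  obtain ⟨n, hn⟩ := exists_prev R.mem₁
  have e1 : det n u₁ = 1 := R.smooth _ _ hn
  have e0 : detHom u₁ u₁ = 0 := det_self u₁
  have e2 := det_swap u₁ n
  have e3 := det_swap u₁ a
  have e4 := det_swap u₁ y
  have := (R.convexArc.decreasing R.smooth hn (-detHom u₁)
    (by rw [LinearMap.neg_apply, detHom_apply]; omega)
    (by rw [LinearMap.neg_apply, LinearMap.neg_apply, detHom_apply u₁ n]; omega) hy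
    ha.2.2.1.le (R.next_mem_arc ha)).1
  simp only [LinearMap.neg_apply, detHom_apply] at this
  omega

/-- If `β ≥ 3`, convexity at `b` gives `det u₂ a > det u₂ b ≥ 1`, so `a` can be the new vertex
unless `det a u₁ = 1`; symmetrically for `b` if `α ≥ 3`. The exceptional cases are excluded by `det
u₁ u₂ ≥ 2`. -/
theorem exists_vertex (R : F.IsResolution u₀ u₁ u₂) {b a x y : ℤ × ℤ} {β α : ℤ}
    (h : F.Node b u₀ a 1) (hx : F.Node x b u₀ β) (hy : F.Node u₀ a y α) (hc : 3 ≤ β ∨ 3 ≤ α) :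
    ∃ v₀, ((v₀ = a ∧ 3 ≤ β) ∨ (v₀ = b ∧ 3 ≤ α)) ∧ 2 ≤ det v₀ u₁ ∧ 2 ≤ det u₂ v₀ := by
  have hu : b + a = u₀ := by rw [h.2.2, one_smul]
  have hd1 := R.det₁
  have hb : 0 < det u₂ b := R.rotate.rotate.prev_mem_arc h.1
  have ha : 0 < det a u₁ := R.next_mem_arc h.2.1
  have hα := R.two_le_next hy
  have hβ := R.two_le_prev hx
  have hlx := R.det_prev_lt h.1 hx.1
  have hly := R.det_next_lt h.2.1 hy.2.1
  have h1 : det u₂ x + det u₂ u₀ = β * det u₂ b := hx.map (detHom u₂)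
  have h2 : det u₁ u₀ + det u₁ y = α * det u₁ a := hy.map (detHom u₁)
  rw [det_swap y, det_swap a, det_swap u₀] at h2
  have e1 : det u₂ u₀ = det u₂ b + det u₂ a := by rw [← hu, det_add_right]
  have e2 : det u₀ u₁ = det b u₁ + det a u₁ := by rw [← hu, det_add_left]
  have k1 : 3 ≤ β → det u₂ b + 1 ≤ det u₂ a := fun h => by
    have : 3 * det u₂ b ≤ β * det u₂ b := by gcongr
    omega
  have k2 : 3 ≤ α → det a u₁ + 1 ≤ det b u₁ := fun h => by
    have : 3 * det a u₁ ≤ α * det a u₁ := by gcongr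
    linarith
  have s1 : det a u₁ = 1 → y = u₁ := fun h1 => by
    by_contra hne
    have := hy.2.1.det_pos_right R.mem₁ ha (Ne.symm hne)
    omega
  have s2 : det u₂ b = 1 → x = u₂ := fun h1 => by
    by_contra hne
    have := hx.1.det_pos_left R.mem₂ hb (Ne.symm hne)
    omega
  have hd21 := det_swap u₁ u₂
  by_cases c1 : 2 ≤ det a u₁ ∧ 3 ≤ β
  · exact ⟨a, Or.inl ⟨rfl, c1.2⟩, c1.1, by have := k1 c1.2; omega⟩
  by_cases c2 : 2 ≤ det u₂ b ∧ 3 ≤ α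
  · exact ⟨b, Or.inr ⟨rfl, c2.2⟩, by have := k2 c2.2; omega, c2.1⟩
  -- If `det a u₁ = 1`, then `y = u₁` since `det y u₁` is smaller; likewise `x = u₂` if `det u₂ b =
  -- 1`. The relations at `a` and `b` then involve `u₁` and `u₂` and force `det u₁ u₂` to be
  -- negative.
  exfalso
  have t1 : det a u₁ = 1 → det u₂ u₀ + det u₂ u₁ = α * det u₂ a := fun h => by
    have := hy.map (detHom u₂)
    rwa [s1 h] at this
  have t2 : det u₂ b = 1 → det u₂ u₁ + det u₀ u₁ = β * det b u₁ := fun h => by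
    have := hx.map (detHom u₁)
    rw [s2 h] at this
    simp only [detHom_apply] at this
    rw [det_swap u₂, det_swap b, det_swap u₀] at this
    linarith
  by_cases c3 : 3 ≤ β
  · have h3 : det a u₁ = 1 := by omega
    have h4 := t1 h3
    have h5 := k1 c3
    by_cases c4 : 3 ≤ α
    · have h6 : det u₂ b = 1 := by omega
      have h7 := t2 h6
      have h8 : 3 * det u₂ a ≤ α * det u₂ a := by gcongr; omega
      have h9 : det a u₂ = -det u₂ a := det_swap _ _
      rw [s2 h6, det_self, h6] at h1
      rw [s1 h3, det_self, h3] at h2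
      have h10 : det u₂ a = β - 1 := by omega
      have h11 : det b u₁ = α - 1 := by omega
      rw [e1, h6, h10] at h4
      have h12 : 3 * β ≤ α * β := by gcongr
      have h13 : α * (β - 1) = α * β - α := by ring
      have h14 : α * 3 ≤ α * β := by gcongr
      omega
    · have h6 : α = 2 := by omega
      subst h6
      omega
  · have h3 : β = 2 := by omega
    subst h3
    have h4 : 3 ≤ α := by omega
    have h5 := t2 (by omega)
    have h6 := k2 h4
    omega

/-- If the minimal resolution is not basic, then a `(-1)`-curve can be blown down. -/
theorem exists_blowDown (R : F.IsResolution u₀ u₁ u₂) {b a x y : ℤ × ℤ} {β α : ℤ}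
    (h : F.Node b u₀ a 1) (hx : F.Node x b u₀ β) (hy : F.Node u₀ a y α) (hc : 3 ≤ β ∨ 3 ≤ α) :
    ∃ (G : CompleteFan) (v₀ : ℤ × ℤ), G.IsResolution v₀ u₁ u₂ ∧ G.Adj b a ∧
      F.rays = insert (b + a) G.rays ∧ G.rays.card < F.rays.card := by
  have hu : a + b = u₀ := by rw [add_comm, h.2.2, one_smul]
  obtain ⟨v₀, hv, h₀, h₂⟩ := R.exists_vertex h hx hy hc
  obtain ⟨G, hG, hadj⟩ := exists_erase (hu ▸ h.1) (hu ▸ h.2.1)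
  rw [hu] at hG hadj
  refine ⟨G, v₀, R.of_erase h hx hy hG hadj hv h₀ h₂, (hadj _ _).mpr (Or.inr ⟨rfl, rfl⟩), ?_, ?_⟩
  · rw [hG, add_comm, hu, Finset.insert_erase R.mem₀]
  · rw [hG]
    exact Finset.card_erase_lt_of_mem R.mem₀

/-- A minimal resolution is basic or is obtained by a blow-up from the minimal resolution of another
surface with three singular points. -/
theorem isBasic_or_exists_blowDown (R : F.IsResolution u₀ u₁ u₂) : F.IsBasic ∨
    ∃ (G : CompleteFan) (v₀ v₁ v₂ b a : ℤ × ℤ), G.IsResolution v₀ v₁ v₂ ∧ G.Adj b a ∧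
      F.rays = insert (b + a) G.rays ∧ G.rays.card < F.rays.card := by
  refine or_iff_not_imp_left.mpr fun hb => ?_
  simp only [IsBasic, not_forall] at hb
  obtain ⟨c, d, ⟨p, n, hp, hn, he⟩, hcd, e, ⟨q, r, hq, hr, he'⟩, hlt⟩ := hb
  have hN : F.Node p c n 1 := ⟨hp, hn, he⟩
  obtain ⟨x, hx⟩ := exists_prev hp.1
  obtain ⟨y, hy⟩ := exists_next hn.2.1
  obtain ⟨β, hβ⟩ := R.smooth.exists_node hx hp
  obtain ⟨α, hα⟩ := R.smooth.exists_node hn hy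
  have hc : 3 ≤ β ∨ 3 ≤ α := by
    have key : ∀ {p v n : ℤ × ℤ} {c c' : ℤ}, F.Node p v n c → F.Node p v n c' → c = c' := by
      intro p v n c c' h h'
      have h1 := h.map (detHom p)
      have h2 := h'.map (detHom p)
      have h3 : detHom p v = 1 := R.smooth _ _ h.1
      rw [h3] at h1 h2
      omega
    rcases hcd with h | h
    · obtain rfl := hn.right_unique h
      obtain rfl := hn.left_unique hq
      obtain rfl := hy.right_unique hr
      have := key hα ⟨hq, hr, he'⟩
      omega
    · obtain rfl := hp.left_unique h
      obtain rfl := hp.right_unique hr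
      obtain rfl := hx.left_unique hq
      have := key hβ ⟨hq, hr, he'⟩
      omega
  have fin : ∀ {v₀ v₁ v₂}, F.IsResolution v₀ v₁ v₂ → c = v₀ →
      ∃ (G : CompleteFan) (v₀ v₁ v₂ b a : ℤ × ℤ), G.IsResolution v₀ v₁ v₂ ∧ G.Adj b a ∧
      F.rays = insert (b + a) G.rays ∧ G.rays.card < F.rays.card := by
    rintro v₀ v₁ v₂ R rfl
    obtain ⟨G, v₀, h⟩ := R.exists_blowDown hN hβ hα hc
    exact ⟨G, v₀, _, _, _, _, h⟩
  rcases R.minimal _ _ _ hN with h | h | h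
  · exact fin R h
  · exact fin R.rotate h
  · exact fin R.rotate.rotate h

end IsResolution
end CompleteFan
end ToricSurface

namespace ToricSurface
namespace CompleteFan

variable {F : CompleteFan}

/-! ### The dual cycles of basic surfaces -/

/-- A nonempty set of rays that contains the ray following each of its members contains all rays. -/
theorem subset_of_forall_exists_adj {s : Finset (ℤ × ℤ)} (hs : s.Nonempty)
    (h : ∀ v ∈ s, ∃ w ∈ s, F.Adj v w) : F.rays ⊆ s := by
  intro r hr
  by_contra hrs
  -- The successor of the member of `s` that precedes `r` most closely cannot pass `r`, so it would
  -- be closer still. If no member of `s` precedes `r` within a half-turn, all of them precede `-r`,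
  -- and the same argument applies to `-r`.
  by_cases hA : ∃ v ∈ s, 0 < det v r
  · obtain ⟨v, hv, hvr, hmin⟩ := exists_nearest_right hA
    obtain ⟨w, hw, hvw⟩ := h v hv
    have h1 := hvw.det_pos_right hr hvr (by rintro rfl; exact hrs hw)
    have h2 := hmin w hw h1
    rw [det_swap] at h2
    linarith [hvw.2.2.1]
  · push Not at hA
    have hneg : ∀ v w, det v (-w) = -det v w := fun v w => by
      simp only [det, Prod.fst_neg, Prod.snd_neg]
      ring
    have hB : ∀ v ∈ s, 0 < det v (-r) := by
      intro v hv
      rw [hneg]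
      refine neg_pos.mpr ((hA v hv).lt_of_ne fun h0 => ?_)
      obtain ⟨w, hw, hvw⟩ := h v hv
      rcases eq_or_eq_neg_of_det_eq_zero (F.primitive _ hvw.1) (F.primitive _ hr) h0 with rfl | rfl
      · exact hrs hv
      · have h1 := hA w hw
        have h2 := hvw.2.2.1
        rw [hneg] at h1
        rw [det_swap] at h2
        linarith
    obtain ⟨v₀, hv₀⟩ := hs
    obtain ⟨v, hv, hvr, hmin⟩ := exists_nearest_right ⟨v₀, hv₀, hB v₀ hv₀⟩
    obtain ⟨w, hw, hvw⟩ := h v hv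
    have h2 := hmin w hw (hB w hw)
    rw [det_swap] at h2
    linarith [hvw.2.2.1]

/-- The listed rays are closed under passing to the successor, hence exhaust the fan. -/
theorem hasDualCycle_of_injective {b : List ℤ} (hb : b ≠ []) (ρ : Fin b.length → ℤ × ℤ)
    (hρ : Function.Injective ρ)
    (h : ∀ i, F.Adj (ρ i) (ρ (finRotate _ i)) ∧ F.SelfInt (ρ i) (b.get i)) :
    F.HasDualCycle b := by
  classical
  refine ⟨ρ, hρ, Set.Subset.antisymm ?_ ?_, h⟩
  · rintro _ ⟨i, rfl⟩
    exact (h i).1.1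
  · have h1 : F.rays ⊆ Finset.univ.image ρ := by
      refine subset_of_forall_exists_adj ?_ ?_
      · have : 0 < b.length := List.length_pos_iff.mpr hb
        exact ⟨ρ ⟨0, this⟩, Finset.mem_image_of_mem _ (Finset.mem_univ _)⟩
      · intro v hv
        obtain ⟨i, -, rfl⟩ := Finset.mem_image.mp hv
        exact ⟨_, Finset.mem_image_of_mem _ (Finset.mem_univ _), (h i).1⟩
    intro v hv
    obtain ⟨i, -, hi⟩ := Finset.mem_image.mp (h1 hv)
    exact ⟨i, hi⟩

theorem Node.selfInt {p v n : ℤ × ℤ} {c : ℤ} (h : F.Node p v n c) : F.SelfInt v (-c) :=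
  ⟨p, n, h.1, h.2.1, by rw [neg_neg, h.2.2]⟩

theorem hasDualCycle_cycle3A2 {v₀ v₁ v₂ v₃ v₄ v₅ v₆ v₇ v₈ : ℤ × ℤ} (hd : det v₇ v₀ = 1)
    (h₀ : F.Node v₈ v₀ v₁ 2) (h₁ : F.Node v₀ v₁ v₂ 2) (h₂ : F.Node v₁ v₂ v₃ 1)
    (h₃ : F.Node v₂ v₃ v₄ 2) (h₄ : F.Node v₃ v₄ v₅ 2) (h₅ : F.Node v₄ v₅ v₆ 1)
    (h₆ : F.Node v₅ v₆ v₇ 2) (h₇ : F.Node v₆ v₇ v₈ 2) (h₈ : F.Node v₇ v₈ v₀ 1) :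
    F.HasDualCycle cycle3A2 := by
  refine hasDualCycle_of_injective (List.cons_ne_nil _ _)
    (![v₀, v₁, v₂, v₃, v₄, v₅, v₆, v₇, v₈] : Fin 9 → ℤ × ℤ) ?_ ?_
  · let f : ℤ × ℤ → ℤ × ℤ := fun v => (detHom v₇ v, detHom v₀ v)
    -- These are the coordinates `(det v₇ ·, det v₀ ·)`, obtained by running the relations `p + n =
    -- c v` from the basis `v₇, v₀`. The vectors are visibly distinct.
    let g : Fin 9 → ℤ × ℤ :=
      ![(1, 0), (1, 1), (1, 2), (0, 1), (-1, 0), (-2, -1), (-1, -1), (0, -1), (1, -1)]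
    have key : f ∘ (![v₀, v₁, v₂, v₃, v₄, v₅, v₆, v₇, v₈] : Fin 9 → ℤ × ℤ) = g := by
      have e := det_swap v₀ v₇
      have a0 := h₈.map (detHom v₇)
      have a1 := h₀.map (detHom v₇)
      have a2 := h₁.map (detHom v₇)
      have a3 := h₂.map (detHom v₇)
      have a4 := h₃.map (detHom v₇)
      have a5 := h₄.map (detHom v₇)
      have a6 := h₅.map (detHom v₇)
      have b0 := h₈.map (detHom v₀)
      have b1 := h₀.map (detHom v₀)
      have b2 := h₁.map (detHom v₀)
      have b3 := h₂.map (detHom v₀)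
      have b4 := h₃.map (detHom v₀)
      have b5 := h₄.map (detHom v₀)
      have b6 := h₅.map (detHom v₀)
      have c0 : detHom v₇ v₀ = 1 := hd
      have c1 : detHom v₇ v₇ = 0 := det_self _
      have c2 : detHom v₀ v₀ = 0 := det_self _
      have c3 : detHom v₀ v₇ = -1 := by rw [detHom_apply, det_swap, hd]
      funext i
      fin_cases i <;> simp [f, g] <;> omega
    have hg : Function.Injective g := by
      unfold Function.Injective
      decide
    exact Function.Injective.of_comp (f := f) (key ▸ hg)
  · intro i
    fin_cases i
    · exact ⟨h₁.1, h₀.selfInt⟩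
    · exact ⟨h₂.1, h₁.selfInt⟩
    · exact ⟨h₃.1, h₂.selfInt⟩
    · exact ⟨h₄.1, h₃.selfInt⟩
    · exact ⟨h₅.1, h₄.selfInt⟩
    · exact ⟨h₆.1, h₅.selfInt⟩
    · exact ⟨h₇.1, h₆.selfInt⟩
    · exact ⟨h₈.1, h₇.selfInt⟩
    · exact ⟨h₀.1, h₈.selfInt⟩

theorem hasDualCycle_cycleStd2 {N : ℕ} {v₀ v₁ v₂ v₃ v₄ v₅ v₆ v₇ : ℤ × ℤ} (hN : 2 ≤ N)
    (hd : det v₅ v₇ = 1)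
    (h₀ : F.Node v₇ v₀ v₁ N) (h₁ : F.Node v₀ v₁ v₂ 2) (h₂ : F.Node v₁ v₂ v₃ 1)
    (h₃ : F.Node v₂ v₃ v₄ 2) (h₄ : F.Node v₃ v₄ v₅ (2 - N)) (h₅ : F.Node v₄ v₅ v₆ 2)
    (h₆ : F.Node v₅ v₆ v₇ 1) (h₇ : F.Node v₆ v₇ v₀ 2) :
    F.HasDualCycle (cycleStd2 N) := by
  refine hasDualCycle_of_injective (List.cons_ne_nil _ _)
    (![v₀, v₁, v₂, v₃, v₄, v₅, v₆, v₇] : Fin 8 → ℤ × ℤ) ?_ ?_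
  · let f : ℤ × ℤ → ℤ × ℤ := fun v => (detHom v₅ v, detHom v₇ v)
    let g : Fin 8 → ℤ × ℤ := ![(1, 1), (N - 1, N), (2 * N - 3, 2 * N - 1), (N - 2, N - 1), (-1, -1),
          (0, -1), (1, -1), (1, 0)]
    have key : f ∘ (![v₀, v₁, v₂, v₃, v₄, v₅, v₆, v₇] : Fin 8 → ℤ × ℤ) = g := by
      have a0 := h₆.map (detHom v₅)
      have a1 := h₇.map (detHom v₅)
      have a2 := h₀.map (detHom v₅)
      have a3 := h₁.map (detHom v₅)
      have a4 := h₂.map (detHom v₅)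
      have a5 := h₃.map (detHom v₅)
      have b0 := h₆.map (detHom v₇)
      have b1 := h₇.map (detHom v₇)
      have b2 := h₀.map (detHom v₇)
      have b3 := h₁.map (detHom v₇)
      have b4 := h₂.map (detHom v₇)
      have b5 := h₃.map (detHom v₇)
      have c0 : detHom v₅ v₇ = 1 := hd
      have c1 : detHom v₅ v₅ = 0 := det_self _
      have c2 : detHom v₇ v₇ = 0 := det_self _
      have c3 : detHom v₇ v₅ = -1 := by rw [detHom_apply, det_swap, hd]
      -- Both coordinates of `v₀` are `1`, so substituting them in the relation with coefficient `N`
      -- leaves a linear system.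
      have d1 : detHom v₅ v₀ = 1 := by omega
      have d2 : detHom v₇ v₀ = 1 := by omega
      rw [d1, mul_one] at a2
      rw [d2, mul_one] at b2
      funext i
      fin_cases i <;> simp [f, g] <;> omega
    have hg : Function.Injective g := by
      intro i j hij
      have e1 := congrArg Prod.fst hij
      have e2 := congrArg Prod.snd hij
      fin_cases i <;> fin_cases j <;> first | rfl | (exfalso; simp [g] at e1 e2 <;> omega)
    exact Function.Injective.of_comp (f := f) (key ▸ hg)
  · have e : F.SelfInt v₄ (N - 2) := by
      have := h₄.selfInt
      rwa [neg_sub] at this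
    intro i
    fin_cases i
    · exact ⟨h₁.1, h₀.selfInt⟩
    · exact ⟨h₂.1, h₁.selfInt⟩
    · exact ⟨h₃.1, h₂.selfInt⟩
    · exact ⟨h₄.1, h₃.selfInt⟩
    · exact ⟨h₅.1, e⟩
    · exact ⟨h₆.1, h₅.selfInt⟩
    · exact ⟨h₇.1, h₆.selfInt⟩
    · exact ⟨h₀.1, h₇.selfInt⟩

end CompleteFan
end ToricSurface

namespace ToricSurface
namespace CompleteFan

variable {F : CompleteFan}

/-! ### The classification of basic surfaces with three singular points -/

theorem IsBasic.node_le_two (hb : F.IsBasic) {p c n q d r : ℤ × ℤ} {e : ℤ} (h : F.Node p c n 1)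
    (hcd : F.Adj c d ∨ F.Adj d c) (h' : F.Node q d r e) : e ≤ 2 := by
  have := hb c d h.selfInt hcd _ h'.selfInt
  omega

/-- By Cramer's rule `v` is a nonnegative combination of `u` and `w` with a positive coefficient at
`w`. -/
theorem one_le_map_of_between {u v w : ℤ × ℤ} (ψ : ℤ × ℤ →ₗ[ℤ] ℤ) (huv : 0 < det u v)
    (hvw : 0 ≤ det v w) (huw : 0 < det u w) (hu : 1 ≤ ψ u) (hw : 1 ≤ ψ w) : 1 ≤ ψ v := by
  have h : det u w • v = det v w • u + det u v • w := by
    ext <;> simp only [det, Prod.fst_add, Prod.snd_add, Prod.smul_fst, Prod.smul_snd, smul_eq_mul]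
      <;> ring
  have h1 := congrArg ψ h
  simp only [map_add, map_smul, smul_eq_mul] at h1
  have h2 : 0 ≤ det v w * ψ u := mul_nonneg hvw (by omega)
  have h3 : 0 < det u v * ψ w := mul_pos huv (by omega)
  exact pos_of_mul_pos_right (a := det u w) (by linarith) huw.le

namespace IsResolution

variable {u₀ u₁ u₂ : ℤ × ℤ}

/-- Basicness bounds the number of the neighbour by `2` from above, and convexity of the arc bounds
it by `2` from below. -/
theorem exists_node_next (R : F.IsResolution u₀ u₁ u₂) (hb : F.IsBasic) {b a : ℤ × ℤ}
    (h : F.Node b u₀ a 1) : ∃ y, F.Node u₀ a y 2 := by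
  obtain ⟨y, hy⟩ := exists_next h.2.1.2.1
  obtain ⟨c, hc⟩ := R.smooth.exists_node h.2.1 hy
  have h1 := hb.node_le_two h (Or.inl h.2.1) hc
  obtain rfl : c = 2 := le_antisymm h1 (R.two_le_next hc)
  exact ⟨y, hc⟩

theorem exists_node_prev (R : F.IsResolution u₀ u₁ u₂) (hb : F.IsBasic) {b a : ℤ × ℤ}
    (h : F.Node b u₀ a 1) : ∃ x, F.Node x b u₀ 2 := by
  obtain ⟨x, hx⟩ := exists_prev h.1.1
  obtain ⟨c, hc⟩ := R.smooth.exists_node hx h.1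
  have h1 := hb.node_le_two h (Or.inr h.1) hc
  obtain rfl : c = 2 := le_antisymm h1 (R.two_le_prev hc)
  exact ⟨x, hc⟩

/-- A linear function that increases from `-1` to `0` at the start of the arc from `a` to `u₁`. -/
theorem increasing_arc (R : F.IsResolution u₀ u₁ u₂) {a y : ℤ × ℤ} (ha : F.Adj u₀ a)
    (hy : F.Adj a y) {ψ : ℤ × ℤ →ₗ[ℤ] ℤ} (hψa : ψ a = -1) (hψy : ψ y = 0)
    {p v : ℤ × ℤ} (hpv : F.Adj p v) (hav : 0 < det a v) (hvu : 0 ≤ det v u₁) :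
    v = y ∨ 1 ≤ ψ v := by
  have h := (R.convexArc.subarc_right hy.1 ha.2.2.1 (R.next_mem_arc ha)).increasing R.smooth hy ψ
    hψy.ge (by omega) hpv hav hvu
  exact h.2.imp_right fun h => by omega

/-- A linear function that decreases from `0` to `-1` at the end of the arc from `u₂` to `b`. -/
theorem decreasing_arc (R : F.IsResolution u₀ u₁ u₂) {x b : ℤ × ℤ} (hb : F.Adj b u₀)
    (hx : F.Adj x b) {ψ : ℤ × ℤ →ₗ[ℤ] ℤ} (hψb : ψ b = -1) (hψx : ψ x = 0)
    {v p : ℤ × ℤ} (hpv : F.Adj v p) (huv : 0 ≤ det u₂ v) (hvb : 0 < det v b) :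
    v = x ∨ 1 ≤ ψ v := by
  have h := (R.rotate.rotate.convexArc.subarc_left hx.2.1 (R.rotate.rotate.prev_mem_arc hb)
    hb.2.2.1).decreasing R.smooth hx ψ hψx.ge (by omega) hpv huv hvb
  exact h.2.imp_right fun h => by omega

/-- With values `-1` and `0` at the first two rays `a`, `y` after `u₀`, the function `ψ` is positive
on the rest of the arc. So a ray two steps before `u₁` at which `ψ` is negative can only be `a`. -/
theorem left_arc (R : F.IsResolution u₀ u₁ u₂) {a y z p : ℤ × ℤ} (ha : F.Adj u₀ a)
    (hy : F.Adj a y) (hne : y ≠ u₁) {ψ : ℤ × ℤ →ₗ[ℤ] ℤ} (hψa : ψ a = -1) (hψy : ψ y = 0)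
    (hz : F.Adj z p) (hp : F.Adj p u₁) :
    1 ≤ ψ u₁ ∧ (z = a ∨ z = y ∨ 1 ≤ ψ z) := by
  have hau := R.next_mem_arc ha
  refine ⟨(R.increasing_arc ha hy hψa hψy hp hau (det_self _).ge).resolve_left hne.symm, ?_⟩
  refine or_iff_not_imp_left.mpr fun hza => ?_
  have hap : 0 < det a p := by
    refine hp.det_pos_left hy.1 hau ?_
    rintro rfl
    exact hne (hy.right_unique hp)
  obtain ⟨q, hq⟩ := exists_prev hz.1
  exact R.increasing_arc ha hy hψa hψy hq (hz.det_pos_left hy.1 hap (Ne.symm hza))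
    (hz.det_pos_of_mem_arc' hy.1 hau hap hp.2.2.1.le).le

/-- The neighbourhood of the third curve of a basic surface. -/
theorem third_node (R : F.IsResolution u₀ u₁ u₂) (hbas : F.IsBasic) {b a x : ℤ × ℤ}
    (h : F.Node b u₀ a 1) (hx : F.Node x b u₀ 2) (hne : x ≠ u₂) {ψ : ℤ × ℤ →ₗ[ℤ] ℤ}
    (hψb : ψ b = -1) (hψx : ψ x = 0)
    (hψ : ∀ q' q, F.Adj q' q → F.Adj q u₂ → 1 ≤ ψ q' ∧ 1 ≤ ψ q) :
    F.Node (-b) (-a) u₂ 2 ∧ F.Node (-a) u₂ x 1 ∧ F.Node u₂ x b 2 := by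
  obtain ⟨q, hq⟩ := exists_prev R.mem₂
  obtain ⟨r, hr⟩ := exists_next R.mem₂
  obtain ⟨q', hq'⟩ := exists_prev hq.1
  obtain ⟨r', hr'⟩ := exists_next hr.2.1
  obtain ⟨c, hc⟩ := R.smooth.exists_node hq hr
  have hc1 := R.rotate.node_le_one hc
  obtain ⟨hψq', hψq⟩ := hψ q' q hq' hq
  have hub : 0 < det u₂ b := R.rotate.rotate.prev_mem_arc h.1
  have hψu : 1 ≤ ψ u₂ :=
    (R.decreasing_arc h.1 hx.1 hψb hψx hr (det_self _).ge hub).resolve_left hne.symm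
  have hrb : 0 < det r b := by
    refine h.1.det_pos_left hr.2.1 (R.rotate.rotate.next_mem_arc hr) ?_
    rintro rfl
    exact hne (hx.1.left_unique hr)
  have hψr : 0 ≤ ψ r := by
    rcases R.decreasing_arc h.1 hx.1 hψb hψx hr' hr.2.2.1.le hrb with rfl | h
    · exact hψx.ge
    · omega
  have hcm := hc.map ψ
  -- Both neighbours of `u₂` have nonnegative values under `ψ`, one of them positive, so `c > 0`;
  -- together with `c ≤ 1` this makes the third curve a `(-1)`-curve.
  have hc0 : 0 < c := pos_of_mul_pos_left (b := ψ u₂) (by omega) (by omega)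
  obtain rfl : c = 1 := by omega
  obtain ⟨q₂, hq₂⟩ := R.rotate.rotate.exists_node_prev hbas hc
  obtain ⟨r₂, hr₂⟩ := R.rotate.rotate.exists_node_next hbas hc
  obtain rfl := hq₂.1.left_unique hq'
  obtain rfl := hr₂.2.1.right_unique hr'
  have e1 : q₂ + r₂ = 0 := by
    linear_combination hq₂.2.2 + hr₂.2.2 + 2 * hc.2.2
  have e2 : ψ q₂ + ψ r₂ = 0 := by rw [← map_add, e1, map_zero]
  -- Since `ψ r₂ = -ψ q₂ < 0`, the second ray after `u₂` cannot lie before `b`, where `ψ` is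
  -- nonnegative. Hence `r₂ = b` and `r = x`.
  have hrx : r = x := by
    by_contra hrx
    obtain ⟨s, hs⟩ := exists_next hr'.2.1
    have := R.decreasing_arc h.1 hx.1 hψb hψx hs
      (hr'.det_pos_of_mem_arc hx.2.1.1 hub hr.2.2.1.le hrb).le
      (hr'.det_pos_right hx.2.1.1 hrb (by rintro rfl; exact hrx (hr'.left_unique hx.1)))
    rcases this with h | h
    · rw [h, hψx] at e2
      omega
    · omega
  subst hrx
  obtain rfl := hr₂.2.1.right_unique hx.1
  obtain rfl : q₂ = -r₂ := eq_neg_of_add_eq_zero_left e1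
  obtain rfl : q = -a := by
    linear_combination hc.2.2 + hr₂.2.2 + hx.2.2 + h.2.2
  exact ⟨hq₂, hc, hr₂⟩

/-- If `y = u₁`, then `a = p`, and the relations give `n = -b` and `t = -u₀` for the two rays after
`u₁`. The function `det u₁` is positive on the arc to `u₂`, so `third_node` applies and says that
`-b` is followed by `-a`. Then `u₀ = a`, so `b = 0`. -/
theorem next_next_ne (R : F.IsResolution u₀ u₁ u₂) (hbas : F.IsBasic) {b a p n y : ℤ × ℤ}
    (h₀ : F.Node b u₀ a 1) (h₁ : F.Node p u₁ n 1) (hy : F.Node u₀ a y 2) : y ≠ u₁ := by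
  rintro rfl
  obtain ⟨x, hx⟩ := R.exists_node_prev hbas h₀
  obtain ⟨t, ht⟩ := R.rotate.exists_node_next hbas h₁
  obtain rfl := h₁.1.left_unique hy.2.1
  have ey : y = p - b := by linear_combination hy.2.2 + h₀.2.2
  have ex : x = b - p := by linear_combination hx.2.2 + h₀.2.2
  have en : n = -b := by linear_combination h₁.2.2 + ey
  have et : t = -u₀ := by linear_combination ht.2.2 + 2 * en - ey - h₀.2.2
  have d0 := R.det₀
  have d1 := R.det₁
  have d2 := R.det₂
  have e1 : detHom y p = -1 := by
    rw [detHom_apply, det_swap, R.smooth _ _ hy.2.1]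
  have e2 : detHom y b = -1 := by
    rw [show b = p - y by rw [ey]; abel, map_sub, e1, detHom_apply, det_self, sub_zero]
  have e3 : detHom y x = 0 := by rw [ex, map_sub, e1, e2, sub_self]
  have e4 : detHom y n = 1 := by rw [en, map_neg, e2, neg_neg]
  have e5 : detHom y y = 0 := det_self y
  have hne : x ≠ u₂ := by
    rintro rfl
    have : det y x = 0 := e3
    omega
  have htu : t ≠ u₂ := by
    rintro rfl
    rw [et, show -u₀ = (-1 : ℤ) • u₀ by simp, det_smul_left, det_self] at d2
    omega
  have key := R.third_node hbas h₀ hx hne e2 e3 (fun q' q hq' hq => by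
    have hqy : 0 < det y q := R.rotate.prev_mem_arc hq
    have h1 := R.rotate.convexArc.increasing R.smooth h₁.2.1 (detHom y) (by omega) (by omega) hq'
      hqy hq.2.2.1.le
    have hqn : q ≠ n := by
      rintro rfl
      exact htu (ht.2.1.right_unique hq)
    have hq'y : 0 < det y q' := by
      refine hq'.det_pos_left R.mem₁ hqy ?_
      rintro rfl
      exact hqn (hq'.right_unique h₁.2.1)
    obtain ⟨s, hs⟩ := exists_prev hq'.1
    have h2 := R.rotate.convexArc.increasing R.smooth h₁.2.1 (detHom y) (by omega) (by omega) hs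
      hq'y (hq'.det_pos_of_mem_arc' R.mem₁ (by omega) hqy hq.2.2.1.le).le
    have h3 := h1.2.resolve_left hqn
    refine ⟨?_, by omega⟩
    rcases h2.2 with rfl | h2
    · omega
    · omega)
  have h1 := key.1.1.right_unique (en ▸ ht.2.1)
  have h3 : b = 0 := by linear_combination h1 + et + h₀.2.2
  exact ne_zero h₀.1.1 h3

/-- The chains around the two `(-1)`-curves are `x, b, u₀, a, y` with `x = -y` and `z, p, u₁, n, t`
with `z = -t`. The function `det y` has value `-1` at `b` and `a` and `0` at `x` and `y`. Its
monotonicity on the arcs leaves `z = y`, `t = x = u₂` or `z = a`, `p = y`. -/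
theorem hasDualCycle_of_nodes (R : F.IsResolution u₀ u₁ u₂) (hbas : F.IsBasic) {b a p n : ℤ × ℤ}
    (h₀ : F.Node b u₀ a 1) (h₁ : F.Node p u₁ n 1) :
    F.HasDualCycle cycle3A2 ∨ ∃ N : ℕ, 2 ≤ N ∧ F.HasDualCycle (cycleStd2 N) := by
  obtain ⟨x, hx⟩ := R.exists_node_prev hbas h₀
  obtain ⟨y, hy⟩ := R.exists_node_next hbas h₀
  obtain ⟨z, hz⟩ := R.rotate.exists_node_prev hbas h₁
  obtain ⟨t, ht⟩ := R.rotate.exists_node_next hbas h₁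
  have hyu := R.next_next_ne hbas h₀ h₁ hy
  have ey : y = a - b := by linear_combination hy.2.2 + h₀.2.2
  have ex : x = b - a := by linear_combination hx.2.2 + h₀.2.2
  have ez : z = -t := by linear_combination hz.2.2 + ht.2.2 + 2 * h₁.2.2
  have d0 := R.det₀
  have d1 := R.det₁
  have d2 := R.det₂
  have hba : det b a = 1 := by
    have h1 := R.smooth _ _ h₀.1
    rwa [show u₀ = b + a by rw [h₀.2.2, one_smul], det_add_right, det_self, zero_add] at h1
  have e1 : detHom y a = -1 := by
    rw [detHom_apply, det_swap, R.smooth _ _ hy.2.1]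
  have e0 : detHom y y = 0 := det_self y
  have e2 : detHom y b = -1 := by
    rw [show b = a - y by rw [ey]; abel, map_sub, e1, e0, sub_zero]
  have e3 : detHom y x = 0 := by rw [ex, map_sub, e1, e2, sub_self]
  obtain ⟨f1, f2⟩ := R.left_arc hy.1 hy.2.1 hyu e1 e0 hz.1 hz.2.1
  have f3 : detHom y z = -detHom y t := by rw [ez, map_neg]
  have hnu : 0 < det n u₂ := R.rotate.next_mem_arc h₁.2.1
  have hut : 0 < det u₁ t := ht.2.1.det_pos_of_mem_arc R.mem₂ (by omega) h₁.2.1.2.2.1.le hnu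
  have htu : 0 ≤ det t u₂ := ht.2.1.det_nonneg_right R.mem₂ hnu
  by_cases hxu : x = u₂
  · subst hxu
    obtain ⟨w, hw⟩ := exists_prev R.mem₂
    have hwx : 0 < det u₁ w := R.rotate.prev_mem_arc hw
    obtain ⟨c, hc⟩ := R.smooth.exists_node hw hx.1
    have f4 : detHom y w = 1 := by
      have := hc.map (detHom y)
      rw [e2, e3] at this
      omega
    by_cases htx : t = x
    · subst htx
      obtain rfl : z = y := by rw [ez, ex, ey]; abel
      obtain ⟨N, hN⟩ := R.smooth.exists_node hy.2.1 hz.1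
      have hN2 : 2 ≤ N := by
        refine R.convexArc.two_le _ _ _ _ hN ?_ ?_
        · exact hy.2.1.det_pos_of_mem_arc R.mem₁ (by omega) hy.1.2.2.1.le (R.next_mem_arc hy.1)
        · exact hy.2.1.det_pos_right R.mem₁ (R.next_mem_arc hy.1) hyu.symm
      obtain ⟨N, rfl⟩ := Int.eq_ofNat_of_zero_le (show 0 ≤ N by omega)
      -- The two chains close up to a cycle with sections `y` and `x = -y`. The relation at `x` has
      -- coefficient `2 - N`, that is, self-intersection number `N - 2`.
      refine Or.inr ⟨N, by omega, hasDualCycle_cycleStd2 (by omega) hba hN hz h₁ ht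
        ⟨ht.2.1, hx.1, ?_⟩ hx h₀ hy⟩
      have h1 := hN.2.2
      rw [sub_smul, ex]
      have h2 : p = (N : ℤ) • (a - b) - a := by rw [← ey, ← h1]; abel
      have h3 : n = p - z := by linear_combination h₁.2.2 + hz.2.2
      rw [h3, h2, ey]
      module
    · exfalso
      obtain ⟨s, hs⟩ := exists_next ht.2.1.2.1
      have f6 := (R.rotate.convexArc.decreasing R.smooth hw (detHom y) (by omega) (by omega)
        hs hut.le (htu.lt_of_ne fun h => htx
        (eq_of_det_eq_zero' ht.2.1.2.1 R.mem₂ h.symm hut (by omega)))).2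
      have f7 : detHom y t = 1 ∧ z = a ∧ t = w := by
        have f8 : 1 ≤ detHom y t := by
          rcases f6 with h | h
          · rw [h, f4]
          · omega
        have f9 : z = a := by
          rcases f2 with h | h | h
          · exact h
          · rw [h, e0] at f3
            omega
          · omega
        rw [f9, e1] at f3
        refine ⟨by omega, f9, f6.resolve_right (by omega)⟩
      obtain ⟨f8, rfl, rfl⟩ := f7
      have hn : n = -b := by
        have h1 := hz.1.right_unique hy.2.1
        linear_combination h₁.2.2 + hz.2.2 + h1 + ey
      have hu : F.Node t x b 1 := ⟨hw, hx.1, by rw [one_smul, ex, ez]; abel⟩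
      -- In this configuration `n = -b` and `t = -a`, so `n + x = -a = t`. Thus `t` would be a
      -- `(-1)`-curve between `u₁` and `u₂`, contrary to convexity.
      obtain ⟨c', hc'⟩ := R.smooth.exists_node ht.2.1 hw
      have h1 := R.rotate.convexArc.two_le _ _ _ _ hc' hut hw.2.2.1
      have h2 := hc'.map (detHom b)
      rw [hn, ex, map_neg, map_sub, detHom_apply b b, det_self, detHom_apply, hba,
        show t = -z by rw [ez, neg_neg], map_neg, detHom_apply, hba] at h2
      omega
  · obtain ⟨r, hr⟩ := exists_next R.mem₂
    have f4 : 1 ≤ detHom y u₂ := (R.decreasing_arc h₀.1 hx.1 e2 e3 hr (det_self _).ge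
      (R.rotate.rotate.prev_mem_arc h₀.1)).resolve_left (Ne.symm hxu)
    have f5 : 1 ≤ detHom y t := one_le_map_of_between _ hut htu (by omega) f1 f4
    -- Here `det y` is positive at `u₁` and `u₂`, hence at `t` between them, so it is negative at `z
    -- = -t`; on the arc from `u₀` to `u₁` only `a` qualifies.
    have f6 : z = a := by
      rcases f2 with h | h | h
      · exact h
      · rw [h, e0] at f3
        omega
      · omega
    subst f6
    have h1 := hz.1.right_unique hy.2.1
    subst h1
    obtain rfl : n = -b := by linear_combination h₁.2.2 + hz.2.2 + ey
    obtain rfl : t = -z := by rw [ez, neg_neg]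
    obtain ⟨k1, k2, k3⟩ := R.third_node hbas h₀ hx hxu e2 e3 (fun q' q hq' hq => by
      have hq0 : 0 < det u₁ q := R.rotate.prev_mem_arc hq
      refine ⟨?_, one_le_map_of_between _ hq0 hq.2.2.1.le (by omega) f1 f4⟩
      by_cases hqu : q' = u₁
      · rw [hqu]
        exact f1
      · exact one_le_map_of_between _ (hq'.det_pos_left R.mem₁ hq0 (Ne.symm hqu))
          (hq'.det_pos_of_mem_arc' R.mem₁ (by omega) hq0 hq.2.2.1.le).le (by omega) f1 f4)
    exact Or.inl (hasDualCycle_cycle3A2 hba hy hz h₁ ht k1 k2 k3 hx h₀)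

theorem hasDualCycle (R : F.IsResolution u₀ u₁ u₂) (hbas : F.IsBasic) :
    F.HasDualCycle cycle3A2 ∨ ∃ N : ℕ, 2 ≤ N ∧ F.HasDualCycle (cycleStd2 N) := by
  obtain ⟨v₀, v₁, v₂, b₀, a₀, b₁, a₁, h, h₀, h₁⟩ := R.exists_two_nodes
  rcases h with ⟨rfl, rfl, rfl⟩ | ⟨rfl, rfl, rfl⟩ | ⟨rfl, rfl, rfl⟩
  · exact R.hasDualCycle_of_nodes hbas h₀ h₁
  · exact R.rotate.hasDualCycle_of_nodes hbas h₀ h₁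
  · exact R.rotate.rotate.hasDualCycle_of_nodes hbas h₀ h₁

end IsResolution
end CompleteFan
end ToricSurface

namespace ToricSurface
namespace CompleteFan

/-! ### Cascades -/

theorem IsSmooth.singularLocus_eq_empty {F : CompleteFan} (hF : F.IsSmooth) (k : Type u) [Field k] :
    singularLocus (toricSurface k F).left = ∅ := by
  rw [← Set.encard_eq_zero, (toricAtlas k F).encard_singularLocus, Set.encard_eq_zero]
  exact Set.eq_empty_of_forall_notMem fun p hp => hp.2 (hF _ _ hp.1)

namespace IsResolution

variable {F : CompleteFan} {u₀ u₁ u₂ : ℤ × ℤ}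

theorem exists_triangle (R : F.IsResolution u₀ u₁ u₂) :
    ∃ T : CompleteFan, T.IsTriangle u₀ u₁ u₂ :=
  CompleteFan.exists_triangle (F.primitive _ R.mem₀) (F.primitive _ R.mem₁) (F.primitive _ R.mem₂)
    (by have := R.det₀; omega) (by have := R.det₁; omega) (by have := R.det₂; omega)

theorem exists_isMinimalResolution (R : F.IsResolution u₀ u₁ u₂) {T : CompleteFan}
    (hT : T.IsTriangle u₀ u₁ u₂) (k : Type u) [Field k] :
    ∃ π : toricSurface k F ⟶ toricSurface k T, IsMinimalResolution k π := by
  obtain ⟨π, hπ⟩ := exists_isToric k (F := T) (F' := F) (by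
    rw [hT.rays_eq]
    intro v hv
    simp only [Finset.mem_insert, Finset.mem_singleton] at hv
    rcases hv with rfl | rfl | rfl
    exacts [R.mem₀, R.mem₁, R.mem₂])
  refine ⟨π, hπ, R.smooth.singularLocus_eq_empty k, ?_⟩
  rintro v - hvT ⟨p, n, hp, hn, he⟩
  have := R.minimal p v n ⟨hp, hn, he⟩
  rw [hT.rays_eq] at hvT
  simp only [Finset.mem_insert, Finset.mem_singleton] at hvT
  exact hvT this

/-- The induction is on a bound for the number of rays: each contraction leads to the minimal
resolution of another triangle with three singular corners, and the process can only end at a basic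
surface. -/
theorem exists_cascade (k : Type u) [Field k] (n : ℕ) :
    ∀ {F : CompleteFan} {u₀ u₁ u₂ : ℤ × ℤ}, F.IsResolution u₀ u₁ u₂ →
    ∀ {T : CompleteFan}, T.IsTriangle u₀ u₁ u₂ → F.rays.card ≤ n →
    ∃ b : List ℤ, (b = cycle3A2 ∨ ∃ N : ℕ, 2 ≤ N ∧ b = cycleStd2 N) ∧
    ∃ (t : ℕ) (S S' : ℕ → CompleteFan), S t = T ∧ S' t = F ∧
      (∀ i ≤ t, (S i).IsLogDelPezzo ∧ HasPicardNumberOne (toricSurface k (S i)).left) ∧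
      (∀ i ≤ t, ∃ π : toricSurface k (S' i) ⟶ toricSurface k (S i), IsMinimalResolution k π) ∧
      (∀ i < t, ∃ φ : toricSurface k (S' (i + 1)) ⟶ toricSurface k (S' i),
        IsToricBlowDown k φ) ∧
      (S' 0).IsBasic ∧ (S' 0).HasDualCycle b := by
  induction n with
  | zero =>
    intro F u₀ u₁ u₂ R T hT hF
    have := Finset.card_pos.mpr ⟨_, R.mem₀⟩
    omega
  | succ n ih =>
    intro F u₀ u₁ u₂ R T hT hF
    have hTP : T.IsLogDelPezzo ∧ HasPicardNumberOne (toricSurface k T).left :=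
      ⟨hT.isLogDelPezzo, (toricAtlas k T).hasPicardNumberOne_iff.mpr hT.card⟩
    rcases R.isBasic_or_exists_blowDown with hb | ⟨G, v₀, v₁, v₂, b, a, RG, hba, hrays, hcard⟩
    · have hbase : ∀ c, F.HasDualCycle c → ∃ (t : ℕ) (S S' : ℕ → CompleteFan), S t = T ∧ S' t = F ∧
          (∀ i ≤ t, (S i).IsLogDelPezzo ∧ HasPicardNumberOne (toricSurface k (S i)).left) ∧
          (∀ i ≤ t, ∃ π : toricSurface k (S' i) ⟶ toricSurface k (S i),
            IsMinimalResolution k π) ∧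
          (∀ i < t, ∃ φ : toricSurface k (S' (i + 1)) ⟶ toricSurface k (S' i),
            IsToricBlowDown k φ) ∧ (S' 0).IsBasic ∧ (S' 0).HasDualCycle c := fun c hc =>
        ⟨0, fun _ => T, fun _ => F, rfl, rfl, fun _ _ => hTP,
          fun _ _ => R.exists_isMinimalResolution hT k, fun i hi => absurd hi (Nat.not_lt_zero i),
          hb, hc⟩
      rcases R.hasDualCycle hb with h | ⟨N, hN, h⟩
      · exact ⟨_, Or.inl rfl, hbase _ h⟩
      · exact ⟨_, Or.inr ⟨N, hN, rfl⟩, hbase _ h⟩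
    · obtain ⟨TG, hTG⟩ := RG.exists_triangle
      obtain ⟨c, hc, t, S, S', hS, hS', h1, h2, h3, h4, h5⟩ := ih RG hTG (by omega)
      -- The new surface is appended as term `t + 1`; the values beyond it play no role.
      have extend : ∀ (s : ℕ → CompleteFan) (x : CompleteFan),
          ∃ s' : ℕ → CompleteFan, (∀ i ≤ t, s' i = s i) ∧ s' (t + 1) = x := fun s x =>
        ⟨fun i => if i ≤ t then s i else x, fun _ hi => if_pos hi, if_neg (by omega)⟩
      obtain ⟨E, hE, hE1⟩ := extend S T
      obtain ⟨E', hE', hE'1⟩ := extend S' F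
      refine ⟨c, hc, t + 1, E, E', hE1, hE'1, ?_, ?_, ?_, ?_, ?_⟩
      · intro i hi
        rcases Nat.le_succ_iff.mp hi with hit | rfl
        · rw [hE i hit]
          exact h1 i hit
        · rw [hE1]
          exact hTP
      · intro i hi
        rcases Nat.le_succ_iff.mp hi with hit | rfl
        · rw [hE i hit, hE' i hit]
          exact h2 i hit
        · rw [hE1, hE'1]
          exact R.exists_isMinimalResolution hT k
      · intro i hi
        rcases Nat.lt_succ_iff_lt_or_eq.mp hi with hit | rfl
        · rw [hE' i hit.le, hE' (i + 1) hit]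
          exact h3 i hit
        · rw [hE' i le_rfl, hE'1, hS']
          obtain ⟨φ, hφ⟩ := exists_isToric k (F := G) (F' := F)
            (by rw [hrays]; exact Finset.subset_insert _ _)
          exact ⟨φ, hφ, b, a, hba, hrays⟩
      · rw [hE' 0 (Nat.zero_le t)]
        exact h4
      · rw [hE' 0 (Nat.zero_le t)]
        exact h5

end IsResolution

namespace IsTriangle

variable {F : CompleteFan} {u₀ u₁ u₂ : ℤ × ℤ}

theorem exists_isResolution (T : F.IsTriangle u₀ u₁ u₂) (h₀ : 2 ≤ det u₀ u₁) (h₁ : 2 ≤ det u₁ u₂)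
    (h₂ : 2 ≤ det u₂ u₀) : ∃ G : CompleteFan, G.IsResolution u₀ u₁ u₂ := by
  obtain ⟨G, hG, hs, hm⟩ := F.exists_minimal_refinement
  refine ⟨G, hs, hG T.mem₀, hG T.rotate.mem₀, hG T.rotate.rotate.mem₀, h₀, h₁, h₂, ?_⟩
  intro p v n hn
  by_contra hv
  refine hm v hn.2.1.1 ?_ hn.selfInt
  rw [T.rays_eq]
  simpa only [Finset.mem_insert, Finset.mem_singleton] using hv

theorem admitsCascadeTo (T : F.IsTriangle u₀ u₁ u₂) (h₀ : 2 ≤ det u₀ u₁) (h₁ : 2 ≤ det u₁ u₂)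
    (h₂ : 2 ≤ det u₂ u₀) {k : Type u} [Field k] {S : Over (Spec (.of k))}
    (hS : Nonempty (S ≅ toricSurface k F)) :
    AdmitsCascadeTo k S cycle3A2 ∨ ∃ n : ℕ, 2 ≤ n ∧ AdmitsCascadeTo k S (cycleStd2 n) := by
  obtain ⟨G, R⟩ := T.exists_isResolution h₀ h₁ h₂
  obtain ⟨b, hb, t, E, E', rfl, -, h⟩ := R.exists_cascade k _ T le_rfl
  have key : AdmitsCascadeTo k S b := ⟨t, E, E', hS, h⟩
  rcases hb with rfl | ⟨N, hN, rfl⟩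
  · exact Or.inl key
  · exact Or.inr ⟨N, hN, key⟩

/-! ### Weighted projective planes -/

theorem smul_add_smul_add_smul (u₀ u₁ u₂ : ℤ × ℤ) :
    det u₁ u₂ • u₀ + det u₂ u₀ • u₁ + det u₀ u₁ • u₂ = 0 := by
  ext <;> simp only [det, Prod.fst_add, Prod.snd_add, Prod.smul_fst, Prod.smul_snd, smul_eq_mul,
    Prod.fst_zero, Prod.snd_zero] <;> ring

end IsTriangle
end CompleteFan

/-- The characters are `0` and the basis dual to `u₁, u₂`. The value on `u₀` need not be prescribed:
since `u₀` has weight `1`, it is determined by the condition of degree zero. -/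
theorem exists_coxData {u₀ u₁ u₂ : ℤ × ℤ} {m₁ m₂ : ℕ} (hd : det u₁ u₂ = 1 ∨ det u₁ u₂ = -1)
    (h₁ : 0 < m₁) (h₂ : 0 < m₂) (h : u₀ + (m₁ : ℤ) • u₁ + (m₂ : ℤ) • u₂ = 0) :
    ∃ χ, CoxData ![1, m₁, m₂] ![u₀, u₁, u₂] χ := by
  obtain ⟨χ₁, a1, a2⟩ := exists_pairing_eq hd 1 0
  obtain ⟨χ₂, b1, b2⟩ := exists_pairing_eq hd 0 1
  have hfst := congrArg Prod.fst h
  have hsnd := congrArg Prod.snd h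
  simp only [Prod.fst_add, Prod.snd_add, Prod.smul_fst, Prod.smul_snd, smul_eq_mul, Prod.fst_zero,
    Prod.snd_zero] at hfst hsnd
  have hu : ∀ m, pairing m u₀ = -(m₁ * pairing m u₁ + m₂ * pairing m u₂) := fun m => by
    simp only [pairing]
    linear_combination m.1 * hfst + m.2 * hsnd
  have hc : ∀ (x y : ℤ) (v : ℤ × ℤ), pairing (x • χ₁ + y • χ₂) v =
      x * pairing χ₁ v + y * pairing χ₂ v := fun x y v => by
    simp only [pairing, Prod.fst_add, Prod.snd_add, Prod.smul_fst, Prod.smul_snd, smul_eq_mul]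
    ring
  refine ⟨![0, χ₁, χ₂], ?_, ?_, ?_, ?_⟩
  · intro i
    fin_cases i
    exacts [one_pos, h₁, h₂]
  · intro m
    simp only [Fin.sum_univ_three, Matrix.cons_val]
    rw [hu m]
    push_cast
    ring
  · intro e he
    simp only [Fin.sum_univ_three, Matrix.cons_val] at he ⊢
    push_cast at he
    intro i
    rw [smul_zero, zero_add, hc]
    fin_cases i
    · simp only [Fin.zero_eta, Matrix.cons_val]
      rw [hu, hu, a1, a2, b1, b2]
      linear_combination -he
    · simp only [Fin.mk_one, Matrix.cons_val]
      rw [a1, b1]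
      ring
    · simp only [Fin.reduceFinMk, Matrix.cons_val]
      rw [a2, b2]
      ring
  · intro m m' hm
    have e1 := hm 1
    have e2 := hm 2
    simp only [Matrix.cons_val, pairing] at e1 e2
    have hdd : det u₁ u₂ * det u₁ u₂ = 1 := by rcases hd with h | h <;> rw [h] <;> norm_num
    have hd' : det u₁ u₂ = u₁.1 * u₂.2 - u₁.2 * u₂.1 := rfl
    have f1 : det u₁ u₂ * (m.1 - m'.1) = 0 := by
      rw [hd']
      linear_combination u₂.2 * e1 - u₁.2 * e2
    have f2 : det u₁ u₂ * (m.2 - m'.2) = 0 := by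
      rw [hd']
      linear_combination u₁.1 * e2 - u₂.1 * e1
    ext
    · linear_combination det u₁ u₂ * f1 - (m.1 - m'.1) * hdd
    · linear_combination det u₁ u₂ * f2 - (m.2 - m'.2) * hdd

namespace CompleteFan.IsTriangle

variable {F : CompleteFan} {u₀ u₁ u₂ : ℤ × ℤ}

/-- The linear relation between the three rays has the determinants as coefficients, and one of them
is `1`. Both orders of the other two weights are provided, so that later the larger one can be put
last. -/
theorem nonempty_iso (T : F.IsTriangle u₀ u₁ u₂) (h : det u₁ u₂ = 1) {m₁ m₂ : ℕ}
    (h₁ : det u₂ u₀ = m₁) (h₂ : det u₀ u₁ = m₂) (k : Type u) [Field k] :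
    Nonempty (toricSurface k F ≅ weightedProjectivePlane k ![1, m₁, m₂]) ∧
    Nonempty (toricSurface k F ≅ weightedProjectivePlane k ![1, m₂, m₁]) := by
  have p₁ : 0 < m₁ := by have := T.det₂; omega
  have p₂ : 0 < m₂ := by have := T.det₀; omega
  have hrel := smul_add_smul_add_smul u₀ u₁ u₂
  rw [h, h₁, h₂, one_smul] at hrel
  have n01 := ne_of_det_pos T.det₀
  have n12 := ne_of_det_pos T.det₁
  have n20 := ne_of_det_pos T.det₂
  constructor
  · obtain ⟨χ, H⟩ := exists_coxData (Or.inl h) p₁ p₂ hrel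
    refine H.nonempty_iso k ?_ F T.isCone_iff
    intro i j hij
    revert hij
    fin_cases i <;> fin_cases j <;> simp [n01, n12, n20, n01.symm, n12.symm, n20.symm]
  · obtain ⟨χ, H⟩ := exists_coxData (u₀ := u₀) (u₁ := u₂) (u₂ := u₁) (Or.inr (by rw [det_swap, h])) p₂ p₁
      (by rw [← hrel]; abel)
    refine H.nonempty_iso k ?_ F fun c => ?_
    · intro i j hij
      revert hij
      fin_cases i <;> fin_cases j <;> simp [n01, n12, n20, n01.symm, n12.symm, n20.symm]
    · rw [T.isCone_iff]
      simp only [Fin.exists_fin_succ, Matrix.cons_val]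
      simp [or_comm]

/-- A common divisor of the weights divides `u₀ = -(m₁ u₁ + m₂ u₂)`, which is primitive. -/
theorem coprime (T : F.IsTriangle u₀ u₁ u₂) (h : det u₁ u₂ = 1) {m₁ m₂ : ℕ}
    (h₁ : det u₂ u₀ = m₁) (h₂ : det u₀ u₁ = m₂) : Nat.Coprime m₁ m₂ := by
  have hrel := smul_add_smul_add_smul u₀ u₁ u₂
  rw [h, h₁, h₂, one_smul] at hrel
  have hfst := congrArg Prod.fst hrel
  have hsnd := congrArg Prod.snd hrel
  simp only [Prod.fst_add, Prod.snd_add, Prod.smul_fst, Prod.smul_snd, smul_eq_mul, Prod.fst_zero,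
    Prod.snd_zero] at hfst hsnd
  have g1 : ((Nat.gcd m₁ m₂ : ℕ) : ℤ) ∣ m₁ := by exact_mod_cast Nat.gcd_dvd_left m₁ m₂
  have g2 : ((Nat.gcd m₁ m₂ : ℕ) : ℤ) ∣ m₂ := by exact_mod_cast Nat.gcd_dvd_right m₁ m₂
  have d1 : ((Nat.gcd m₁ m₂ : ℕ) : ℤ) ∣ u₀.1 := by
    rw [show u₀.1 = -(m₁ * u₁.1 + m₂ * u₂.1) by linear_combination hfst]
    exact (dvd_add (g1.mul_right _) (g2.mul_right _)).neg_right
  have d2 : ((Nat.gcd m₁ m₂ : ℕ) : ℤ) ∣ u₀.2 := by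
    rw [show u₀.2 = -(m₁ * u₁.2 + m₂ * u₂.2) by linear_combination hsnd]
    exact (dvd_add (g1.mul_right _) (g2.mul_right _)).neg_right
  have := Int.dvd_coe_gcd d1 d2
  rw [F.primitive _ T.mem₀] at this
  exact Nat.dvd_one.mp (by exact_mod_cast this)

/-- A triangle with two smooth corners. -/
theorem exists_iso_one_one (T : F.IsTriangle u₀ u₁ u₂) (h₁ : det u₁ u₂ = 1) (h₂ : det u₂ u₀ = 1)
    (k : Type u) [Field k] : ∃ n : ℕ, 1 ≤ n ∧
      Nonempty (toricSurface k F ≅ weightedProjectivePlane k ![1, 1, n]) := by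
  have h := T.det₀
  obtain ⟨n, hn⟩ := Int.eq_ofNat_of_zero_le h.le
  exact ⟨n, by omega, (T.nonempty_iso h₁ (m₁ := 1) (by rw [h₂]; rfl) hn k).1⟩

/-- Division with remainder: `n - 1` is the quotient and `q₁` the remainder, which is nonzero
because the numbers are coprime and `m₁ ≥ 2`. -/
theorem exists_mod {m₁ m₂ : ℕ} (h : Nat.Coprime m₁ m₂) (h₁ : 2 ≤ m₁) (hlt : m₁ < m₂) :
    ∃ n q₁ : ℕ, 2 ≤ n ∧ 1 ≤ q₁ ∧ q₁ < m₁ ∧ Nat.Coprime m₁ q₁ ∧ m₂ = (n - 1) * m₁ + q₁ := by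
  have hco : Nat.Coprime m₁ (m₂ % m₁) := by
    rw [Nat.Coprime, Nat.gcd_comm, ← Nat.gcd_rec]
    exact h
  refine ⟨m₂ / m₁ + 1, m₂ % m₁, ?_, ?_, Nat.mod_lt _ (by omega), hco, ?_⟩
  · have := Nat.div_pos hlt.le (by omega : 0 < m₁)
    omega
  · by_contra h0
    rw [show m₂ % m₁ = 0 by omega, Nat.coprime_zero_right] at hco
    omega
  · rw [Nat.add_sub_cancel, Nat.mul_comm, Nat.div_add_mod]

/-- A triangle with one smooth corner. -/
theorem exists_iso_one (T : F.IsTriangle u₀ u₁ u₂) (h₀ : 2 ≤ det u₀ u₁) (h₁ : det u₁ u₂ = 1)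
    (h₂ : 2 ≤ det u₂ u₀) (k : Type u) [Field k] :
    ∃ n q q₁ : ℕ, 2 ≤ n ∧ 1 ≤ q₁ ∧ q₁ < q ∧ Nat.Coprime q q₁ ∧
      Nonempty (toricSurface k F ≅ weightedProjectivePlane k ![1, q, (n - 1) * q + q₁]) := by
  obtain ⟨m₁, hm₁⟩ := Int.eq_ofNat_of_zero_le (show 0 ≤ det u₂ u₀ by omega)
  obtain ⟨m₂, hm₂⟩ := Int.eq_ofNat_of_zero_le (show 0 ≤ det u₀ u₁ by omega)
  obtain ⟨i₁, i₂⟩ := T.nonempty_iso h₁ hm₁ hm₂ k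
  have hco := T.coprime h₁ hm₁ hm₂
  have l1 : 2 ≤ m₁ := by omega
  have l2 : 2 ≤ m₂ := by omega
  -- Equal weights would not be coprime, as both are at least `2`; otherwise the smaller one becomes
  -- `q`.
  rcases lt_trichotomy m₁ m₂ with h | h | h
  · obtain ⟨n, q₁, a, b, c, d, e⟩ := exists_mod hco l1 h
    exact ⟨n, m₁, q₁, a, b, c, d, e ▸ i₁⟩
  · rw [h, Nat.coprime_self] at hco
    omega
  · obtain ⟨n, q₁, a, b, c, d, e⟩ := exists_mod hco.symm l2 h
    exact ⟨n, m₂, q₁, a, b, c, d, e ▸ i₂⟩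

end CompleteFan.IsTriangle
end ToricSurface

/-! ### The main theorem -/

theorem mainTheorem5 {k : Type u} [Field k] [IsAlgClosed k] [CharZero k] (S : Over (Spec (.of k)))
    (hS : ToricSurface.IsToricLogDelPezzo k S) (hρ : ToricSurface.HasPicardNumberOne S.left) :
    ((ToricSurface.singularLocus S.left).encard ≤ 1 →
      ∃ n : ℕ, 1 ≤ n ∧ Nonempty (S ≅ ToricSurface.weightedProjectivePlane k ![1, 1, n])) ∧
    ((ToricSurface.singularLocus S.left).encard = 2 →
      ∃ n q q₁ : ℕ, 2 ≤ n ∧ 1 ≤ q₁ ∧ q₁ < q ∧ Nat.Coprime q q₁ ∧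
        Nonempty (S ≅ ToricSurface.weightedProjectivePlane k ![1, q, (n - 1) * q + q₁])) ∧
    ((ToricSurface.singularLocus S.left).encard = 3 →
      ToricSurface.AdmitsCascadeTo k S ToricSurface.cycle3A2 ∨
        ∃ n : ℕ, 2 ≤ n ∧ ToricSurface.AdmitsCascadeTo k S (ToricSurface.cycleStd2 n)) ∧
    ((ToricSurface.singularLocus S.left).encard ≤ 2 →
      ∃ a b c : ℕ, 1 ≤ a ∧ 1 ≤ b ∧ 1 ≤ c ∧
        Nonempty (S ≅ ToricSurface.weightedProjectivePlane k ![a, b, c])) := by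
  obtain ⟨F, -, ⟨e⟩⟩ := hS
  let A : ToricSurface.Atlas k F S.left := (ToricSurface.toricAtlas k F).congr
    ((Over.forget _).mapIso e.symm)
  obtain ⟨u₀, u₁, u₂, T⟩ := ToricSurface.CompleteFan.exists_isTriangle
    (A.hasPicardNumberOne_iff.mp hρ)
  have hcard := T.encard_singularLocus A
  have d₀ := T.det₀
  have d₁ := T.det₁
  have d₂ := T.det₂
  have trans : ∀ {X : Over (Spec (.of k))}, Nonempty (ToricSurface.toricSurface k F ≅ X) →
      Nonempty (S ≅ X) := fun ⟨i⟩ => ⟨e.trans i⟩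
  have H1 : (ToricSurface.singularLocus S.left).encard ≤ 1 →
      ∃ n : ℕ, 1 ≤ n ∧ Nonempty (S ≅ ToricSurface.weightedProjectivePlane k ![1, 1, n]) := by
    intro h
    rw [hcard] at h
    replace h := Nat.cast_le_one.mp h
    -- At most one singular point means that at least two of the three corners are smooth; up to
    -- rotation these are the last two.
    have key : (ToricSurface.det u₁ u₂ = 1 ∧ ToricSurface.det u₂ u₀ = 1) ∨
        (ToricSurface.det u₂ u₀ = 1 ∧ ToricSurface.det u₀ u₁ = 1) ∨
        (ToricSurface.det u₀ u₁ = 1 ∧ ToricSurface.det u₁ u₂ = 1) := by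
      split_ifs at h <;> omega
    have main : ∃ n : ℕ, 1 ≤ n ∧ Nonempty (ToricSurface.toricSurface k F ≅
        ToricSurface.weightedProjectivePlane k ![1, 1, n]) := by
      rcases key with ⟨a, b⟩ | ⟨a, b⟩ | ⟨a, b⟩
      · exact T.exists_iso_one_one a b k
      · exact T.rotate.exists_iso_one_one a b k
      · exact T.rotate.rotate.exists_iso_one_one a b k
    obtain ⟨n, hn, i⟩ := main
    exact ⟨n, hn, trans i⟩
  have H2 : (ToricSurface.singularLocus S.left).encard = 2 →
      ∃ n q q₁ : ℕ, 2 ≤ n ∧ 1 ≤ q₁ ∧ q₁ < q ∧ Nat.Coprime q q₁ ∧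
        Nonempty (S ≅ ToricSurface.weightedProjectivePlane k ![1, q, (n - 1) * q + q₁]) := by
    intro h
    rw [hcard] at h
    replace h := ENat.natCast_inj.mp (h : _ = ((2 : ℕ) : ℕ∞))
    have main : ∃ n q q₁ : ℕ, 2 ≤ n ∧ 1 ≤ q₁ ∧ q₁ < q ∧ Nat.Coprime q q₁ ∧
        Nonempty (ToricSurface.toricSurface k F ≅
          ToricSurface.weightedProjectivePlane k ![1, q, (n - 1) * q + q₁]) := by
      by_cases a : ToricSurface.det u₀ u₁ = 1 <;> by_cases b : ToricSurface.det u₁ u₂ = 1 <;>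
        by_cases c : ToricSurface.det u₂ u₀ = 1 <;> simp only [a, b, c, if_true, if_false] at h <;>
        try omega
      · exact T.rotate.rotate.exists_iso_one (by omega) a (by omega) k
      · exact T.exists_iso_one (by omega) b (by omega) k
      · exact T.rotate.exists_iso_one (by omega) c (by omega) k
    obtain ⟨n, q, q₁, a, b, c, d, i⟩ := main
    exact ⟨n, q, q₁, a, b, c, d, trans i⟩
  refine ⟨H1, H2, fun h => ?_, fun h => ?_⟩
  · rw [hcard] at h
    replace h := ENat.natCast_inj.mp (h : _ = ((3 : ℕ) : ℕ∞))
    split_ifs at h <;> try omega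
    exact T.admitsCascadeTo (by omega) (by omega) (by omega) ⟨e⟩
  · rcases le_or_gt (ToricSurface.singularLocus S.left).encard 1 with h1 | h1
    · obtain ⟨n, hn, i⟩ := H1 h1
      exact ⟨1, 1, n, le_rfl, le_rfl, hn, i⟩
    · have h2 : (ToricSurface.singularLocus S.left).encard = 2 :=
        le_antisymm h (Order.add_one_le_of_lt h1)
      obtain ⟨n, q, q₁, -, hq₁, hlt, -, i⟩ := H2 h2
      exact ⟨1, q, (n - 1) * q + q₁, le_rfl, by omega, by omega, i⟩
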